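/- **Setting.** Let $d\ge 2$ and let $\mathcal T_h$ be a finite conforming triangulation, by $d$-simplices, of a polyhedral domain $\Omega_h\subset\mathbb R^d$ with $\Gamma_h=\partial\Omega_h$. Let $h$ and $h_\Gamma$ be the maximal mesh widths of $\mathcal T_h$ and of the induced mesh of $\Gamma_h$. The triangulation is quasi-uniform with parameter $\vartheta\ge 2$ if $r/R\ge\vartheta^{-1}$ for the inradius $r$ and the circumradius $R$ of every element. Let $\phi_j$ be the continuous piecewise linear nodal basis functions, with the interior nodes numbered first (index 1) and the surface nodes last (index 2). Let $\kappa\in L^\infty(\Omega_h)$ with $0<\kappa_{\min}\le\kappa\le\kappa_{\max}$, and let $\alpha_\Omega,\alpha_\Gamma,\beta\ge 0$. Define $$M_{ij}=\int_{\Omega_h}\phi_j\phi_i\,dx,\qquad A_{ij}=\int_{\Omega_h}\alpha_\Omega\phi_j\phi_i+\kappa\nabla\phi_j\cdot\nabla\phi_i\,dx$$ for bulk nodes $i,j$, $$(M_\Gamma)_{ij}=\int_{\Gamma_h}\phi_j\phi_i\,d\sigma,\qquad (A_\Gamma)_{ij}=\int_{\Gamma_h}\alpha_\Gamma\phi_j\phi_i+\beta\nabla_\Gamma\phi_j\cdot\nabla_\Gamma\phi_i\,d\sigma$$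 for surface nodes $i,j$, and $B_{ij}=\int_{\Gamma_h}\phi_j\phi_i\,d\sigma$ for surface nodes $i$ and bulk nodes $j$. Let $M_{kl},A_{kl}$, $k,l\in\{1,2\}$, be the blocks of $M,A$, and write $\|x\|_Q^2=x^TQx$. Let $T>0$, and let $f_\Omega=(f_1,f_2)$ and $f_\Gamma$ be vector-valued $H^1$ functions on $[0,T]$. Let $(u,p,\lambda)$ satisfy on $[0,T]$ the semi-discrete problem $$M\dot u+Au+B^T\lambda=f_\Omega,\qquad M_\Gamma\dot p+A_\Gamma p-M_\Gamma\lambda=f_\Gamma,\qquad Bu=M_\Gamma p,$$ with $\dot u,\dot p$ absolutely continuous. For $\tau>0$ and $t^n=n\tau$ let $(u_1^n,p^n)$ be given by the fully discrete Lie splitting: $u_1^0=u_1(0)$, $p^0=p(0)$, $\partial_\tau p^0=\dot p(0)$, $\partial_\tau w^{n+1}=\tau^{-1}(w^{n+1}-w^n)$ for $n\ge 0$, and, as long as $t^{n+1}\le T$, $$M_{11}\partial_\tau u_1^{n+1}+A_{11}u_1^{n+1}=f_1(t^{n+1})-M_{12}\partial_\tau p^n-A_{12}p^n,$$ $$M_\Gamma\partial_\tau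 p^{n+1}+A_\Gamma p^{n+1}=f_\Gamma(t^{n+1})+f_2(t^{n+1})-M_{22}\partial_\tau p^n-A_{22}p^n-M_{21}\partial_\tau u_1^{n+1}-A_{21}u_1^{n+1}.$$ Put $u^n=(u_1^n,p^n)$ and $$\mathcal R=\|\dot u(0)\|_A^2+\|\dot p(0)\|_{A_\Gamma}^2+\|\dot p(0)\|_{M_\Gamma}^2+\int_0^T\!\big(\|\dot f_\Omega\|_{M^{-1}}^2+\|\dot f_\Gamma\|_{M_\Gamma^{-1}}^2+\|\dot p\|_{A_{22}}^2\big)dt+\Big(\int_0^T\!\|\ddot u\|_{M}\,dt\Big)^2+\Big(\int_0^T\!\|\ddot p\|_{M_\Gamma}\,dt\Big)^2 .$$ **Constants.** Let $c_M>0$ and $c_{\rm inv}>0$ denote constants in the boundary estimate and the inverse estimate $$\|v\|_{M_{22}}^2\le c_M h_\Gamma\|v\|_{M_\Gamma}^2,\qquad \|v\|_{A_{22}}^2\le(\alpha_\Omega+c_{\rm inv}h^{-2})\|v\|_{M_{22}}^2\qquad\text{for all surface vectors } v .$$ **Theorem.** (i) Such constants exist uniformly on quasi-uniform families: for given $d,\vartheta,\varrho,\kappa_{\min},\kappa_{\max}$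 there are $c_M$ and $c_{\rm inv}$ that are valid for all triangulations that are quasi-uniform with parameter $\vartheta$ and satisfy $h\le\varrho\, r$ for the inradius $r$ of every element ($c_M$ not depending on $\kappa$, and $c_{\rm inv}$ for all $\kappa$ with values in $[\kappa_{\min},\kappa_{\max}]$ and all $\alpha_\Omega\ge 0$). (ii) Given $c_M,c_{\rm inv}>0$, $\alpha_\Omega\ge 0$ and $T>0$ (and $d,\vartheta,\kappa_{\min},\kappa_{\max}$), there is $C>0$ such that the following holds for every triangulation that is quasi-uniform with parameter $\vartheta$ and for all $\kappa,\alpha_\Gamma,\beta,f_\Omega,f_\Gamma,(u,p,\lambda)$ as above for which $c_M,c_{\rm inv}$ are valid constants. If the weak CFL condition $7c_{\rm inv}c_M\tau<3h$ holds and $7h<1/c_M$, then for all $n\ge 0$ with $t^{n+1}\le T$ $$\text{(a)}\quad\|u(t^{n+1})-u^{n+1}\|_M^2+\tau\sum_{k=0}^n\|u(t^{k+1})-u^{k+1}\|_A^2+\|p(t^{n+1})-p^{n+1}\|_{M_\Gamma}^2+\tau\sum_{k=0}^n\|p(t^{k+1})-p^{k+1}\|_{A_\Gamma}^2\le C\,\mathcal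 R\,\tau^2,$$ $$\text{(b)}\quad\|u(t^{n+1})-u^{n+1}\|_A^2+\|p(t^{n+1})-p^{n+1}\|_{A_\Gamma}^2\le C\,\mathcal R\,\tau .$$ The constant $C$ is independent of $\tau$ and $h$ (and of the mesh, $\kappa,\alpha_\Gamma,\beta$, the data and the solution). -/

import Mathlib

open MeasureTheory Set
open scoped Matrix

noncomputable section

namespace BulkSurface

/-- The Euclidean space `ℝ^d`. -/
abbrev Pt (d : ℕ) : Type := EuclideanSpace ℝ (Fin d)

/-! ### Triangulations -/

/-- A (conforming, finite) triangulation of a polyhedral domain in `ℝ^d`: a finite nonempty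
simplicial complex in which every face is contained in a `d`-simplex. A simplex is represented by
the finite set of its vertices. -/
structure Triangulation (d : ℕ) where
  complex : Geometry.SimplicialComplex ℝ (Pt d)
  finite : complex.faces.Finite
  nonempty : complex.faces.Nonempty
  pure : ∀ s ∈ complex.faces, ∃ t ∈ complex.faces, s ⊆ t ∧ t.card = d + 1

namespace Triangulation

variable {d : ℕ} (𝒯 : Triangulation d)

/-- The polyhedral domain `Ω_h`, as a closed set. -/
def domain : Set (Pt d) := 𝒯.complex.space

open Classical in
/-- The elements: the `d`-simplices of the triangulation. -/
def elements : Finset (Finset (Pt d)) :=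
  𝒯.finite.toFinset.filter fun s => s.card = d + 1

open Classical in
/-- The boundary facets: the `(d-1)`-simplices contained in `Γ_h = ∂Ω_h`. -/
def boundaryFacets : Finset (Finset (Pt d)) :=
  𝒯.finite.toFinset.filter fun s => s.card = d ∧ convexHull ℝ (s : Set (Pt d)) ⊆ frontier 𝒯.domain

open Classical in
/-- All nodes of the triangulation. -/
def nodes : Finset (Pt d) := 𝒯.elements.biUnion id

open Classical in
/-- The surface nodes. -/
def boundaryNodes : Finset (Pt d) := 𝒯.boundaryFacets.biUnion id

/-- The surface nodes, as an index type. -/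
abbrev BdNode : Type := {x : Pt d // x ∈ 𝒯.boundaryNodes}

/-- The interior nodes, as an index type. -/
abbrev IntNode : Type := {x : Pt d // x ∈ 𝒯.nodes ∧ x ∉ 𝒯.boundaryNodes}

/-- The index set of the bulk nodes, interior nodes first and surface nodes last. -/
abbrev Node : Type := 𝒯.IntNode ⊕ 𝒯.BdNode

instance : Fintype 𝒯.IntNode :=
  @Fintype.ofFinite _ (Set.Finite.subset 𝒯.nodes.finite_toSet fun _ hx => hx.1)

instance : DecidableEq 𝒯.IntNode := Classical.decEq _

instance : DecidableEq 𝒯.BdNode := Classical.decEq _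

/-- The position of a node. -/
def pos : 𝒯.Node → Pt d := Sum.elim Subtype.val Subtype.val

/-- The maximal mesh width `h` of the bulk mesh. -/
def meshWidth : ℝ :=
  sSup ((fun s : Finset (Pt d) => Metric.diam (convexHull ℝ (s : Set (Pt d)))) '' 𝒯.elements)

/-- The maximal mesh width `h_Γ` of the surface mesh. -/
def surfaceMeshWidth : ℝ :=
  sSup ((fun s : Finset (Pt d) => Metric.diam (convexHull ℝ (s : Set (Pt d)))) '' 𝒯.boundaryFacets)

end Triangulation

/-- The inradius of a simplex: the largest radius of a ball contained in it. -/
def inradius {d : ℕ} (s : Finset (Pt d)) : ℝ :=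
  sSup {r : ℝ | 0 ≤ r ∧ ∃ c : Pt d, Metric.closedBall c r ⊆ convexHull ℝ (s : Set (Pt d))}

/-- The circumradius of a `d`-simplex: the radius of the unique sphere through its vertices. -/
def circumradius {d : ℕ} (s : Finset (Pt d)) : ℝ :=
  sInf {R : ℝ | 0 ≤ R ∧ ∃ c : Pt d, ∀ x ∈ s, dist x c = R}

/-- Quasi-uniformity with parameter `θ`: the ratio of inradius and circumradius of every element
is at least `1 / θ`. -/
def Triangulation.IsQuasiUniform {d : ℕ} (𝒯 : Triangulation d) (θ : ℝ) : Prop :=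
  ∀ E ∈ 𝒯.elements, θ⁻¹ ≤ inradius E / circumradius E

/-- All elements are of size comparable to the maximal mesh width: `h ≤ ϱ r` for the inradius `r`
of every element. -/
def Triangulation.HasComparableElements {d : ℕ} (𝒯 : Triangulation d) (ϱ : ℝ) : Prop :=
  ∀ E ∈ 𝒯.elements, 𝒯.meshWidth ≤ ϱ * inradius E

/-! ### Linear finite elements -/

/-- On a nondegenerate simplex there is exactly one tangential vector which is the gradient of the
affine function with value `1` at the vertex `x` and `0` at all others. -/
theorem existsUnique_nodalGrad {d : ℕ} {s : Finset (Pt d)}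
    (hs : AffineIndependent ℝ ((↑) : s → Pt d)) {x : Pt d} (hx : x ∈ s) :
    ∃! g : Pt d, g ∈ vectorSpan ℝ (s : Set (Pt d)) ∧ ∀ y ∈ s, y ≠ x → inner ℝ g (x - y) = 1 := by
  classical
  have hexist : ∃ g : Pt d, g ∈ vectorSpan ℝ (s : Set (Pt d)) ∧
      ∀ y ∈ s, y ≠ x → inner ℝ g (x - y) = 1 := by
    by_cases hne : ∃ y ∈ s, y ≠ x
    · obtain ⟨y₀, hy₀, hy₀x⟩ := hne
      set t : Set (Pt d) := (s : Set (Pt d)) \ {x} with ht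
      have hy₀t : y₀ ∈ t := ⟨hy₀, hy₀x⟩
      have : Nonempty (affineSpan ℝ t) := ⟨⟨y₀, subset_affineSpan ℝ t hy₀t⟩⟩
      set π : affineSpan ℝ t := EuclideanGeometry.orthogonalProjection (affineSpan ℝ t) x with hπ
      set a : Pt d := x - (π : Pt d) with ha
      have hxt : x ∉ affineSpan ℝ t := by
        have h := hs.notMem_affineSpan_sdiff ⟨x, hx⟩ Set.univ
        have himg : ((↑) : s → Pt d) '' (Set.univ \ {⟨x, hx⟩}) = t := by
          ext z
          simp only [Set.mem_image, Set.mem_sdiff, Set.mem_univ, true_and, Set.mem_singleton_iff,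
            Subtype.exists, Subtype.mk.injEq, ht, Finset.mem_coe]
          constructor
          · rintro ⟨w, hw, hwx, rfl⟩
            exact ⟨hw, hwx⟩
          · rintro ⟨hz, hzx⟩
            exact ⟨z, hz, hzx, rfl⟩
        rwa [himg] at h
      have ha0 : a ≠ 0 := by
        intro h0
        apply hxt
        have : x = (π : Pt d) := sub_eq_zero.mp h0
        rw [this]
        exact π.2
      have horth : ∀ y ∈ s, y ≠ x → inner ℝ a ((π : Pt d) - y) = 0 := by
        intro y hy hyx
        have hyt : y ∈ affineSpan ℝ t := subset_affineSpan ℝ t ⟨hy, hyx⟩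
        have h1 : (π : Pt d) - y ∈ (affineSpan ℝ t).direction :=
          AffineSubspace.vsub_mem_direction π.2 hyt
        have h2 : x -ᵥ (π : Pt d) ∈ (affineSpan ℝ t).directionᗮ :=
          EuclideanGeometry.vsub_orthogonalProjection_mem_direction_orthogonal _ x
        have h3 := Submodule.inner_left_of_mem_orthogonal h1 h2
        simpa [ha] using h3
      refine ⟨(‖a‖ ^ 2)⁻¹ • a, ?_, ?_⟩
      · apply Submodule.smul_mem
        have h1 : (π : Pt d) ∈ affineSpan ℝ (s : Set (Pt d)) :=
          affineSpan_mono ℝ Set.sdiff_subset π.2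
        have h2 : x ∈ affineSpan ℝ (s : Set (Pt d)) := subset_affineSpan ℝ _ hx
        have h3 := AffineSubspace.vsub_mem_direction h2 h1
        rwa [direction_affineSpan] at h3
      · intro y hy hyx
        have hsplit : x - y = a + ((π : Pt d) - y) := by simp [ha]
        have hn : ‖a‖ ^ 2 ≠ 0 := by positivity
        rw [hsplit, inner_add_right, inner_smul_left, inner_smul_left, horth y hy hyx,
          real_inner_self_eq_norm_sq]
        simp [hn]
    · refine ⟨0, Submodule.zero_mem _, fun y hy hyx => (hne ⟨y, hy, hyx⟩).elim⟩
  obtain ⟨g, hg, hg1⟩ := hexist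
  refine ⟨g, ⟨hg, hg1⟩, ?_⟩
  rintro g' ⟨hg', hg1'⟩
  have hmem : g' - g ∈ vectorSpan ℝ (s : Set (Pt d)) := Submodule.sub_mem _ hg' hg
  have hperp : g' - g ∈ (vectorSpan ℝ (s : Set (Pt d)))ᗮ := by
    rw [vectorSpan_eq_span_vsub_set_left ℝ (show x ∈ (s : Set (Pt d)) from hx),
      Submodule.mem_orthogonal']
    intro v hv
    induction hv using Submodule.span_induction with
    | mem v hv =>
      obtain ⟨y, hy, rfl⟩ := hv
      by_cases hyx : y = x
      · simp [hyx]
      · have e1 := hg1' y hy hyx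
        have e2 := hg1 y hy hyx
        change inner ℝ (g' - g) (x - y) = 0
        rw [inner_sub_left, e1, e2, sub_self]
    | zero => simp
    | add v w _ _ hv hw => rw [inner_add_right, hv, hw, add_zero]
    | smul c v _ hv => rw [inner_smul_right, hv, mul_zero]
  have hz : inner ℝ (g' - g) (g' - g) = 0 := Submodule.inner_left_of_mem_orthogonal hmem hperp
  exact sub_eq_zero.mp (inner_self_eq_zero.mp hz)

open Classical in
/-- The gradient, on the simplex with vertex set `s`, of the nodal basis function of the node `x`:
the (constant) vector tangential to the simplex with `⟪g, x - y⟫ = 1` for every other vertex `y`.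
It is the full gradient on an element and the tangential gradient on a boundary facet, and it
vanishes if `x` is not a vertex of the simplex. -/
def nodalGrad {d : ℕ} (s : Finset (Pt d)) (x : Pt d) : Pt d :=
  if h : x ∈ s ∧ ∃ g : Pt d, g ∈ vectorSpan ℝ (s : Set (Pt d)) ∧
      ∀ y ∈ s, y ≠ x → inner ℝ g (x - y) = 1
  then Classical.choose h.2 else 0

theorem nodalGrad_spec {d : ℕ} {s : Finset (Pt d)}
    (hs : AffineIndependent ℝ ((↑) : s → Pt d)) {x : Pt d} (hx : x ∈ s) :
    nodalGrad s x ∈ vectorSpan ℝ (s : Set (Pt d)) ∧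
      ∀ y ∈ s, y ≠ x → inner ℝ (nodalGrad s x) (x - y) = 1 := by
  have h := (existsUnique_nodalGrad hs hx).exists
  rw [nodalGrad, dif_pos ⟨hx, h⟩]
  exact Classical.choose_spec h

open Classical in
/-- The restriction, to the simplex with vertex set `s`, of the continuous piecewise linear nodal
basis function of the node `x`: the affine function with value `1` at `x` and `0` at the other
vertices, and zero if `x` is not a vertex of the simplex. -/
def nodalFun {d : ℕ} (s : Finset (Pt d)) (x y : Pt d) : ℝ :=
  if x ∈ s then 1 + inner ℝ (nodalGrad s x) (y - x) else 0

/-- The nodal basis functions satisfy `φ_x(y) = δ_{xy}` at the vertices. -/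
theorem nodalFun_vertex {d : ℕ} {s : Finset (Pt d)}
    (hs : AffineIndependent ℝ ((↑) : s → Pt d)) (x : Pt d) {y : Pt d} (hy : y ∈ s) :
    nodalFun s x y = if y = x then 1 else 0 := by
  by_cases hx : x ∈ s
  · by_cases hyx : y = x
    · simp [nodalFun, hyx, hx]
    · have h := (nodalGrad_spec hs hx).2 y hy hyx
      rw [nodalFun, if_pos hx, if_neg hyx, ← neg_sub x y, inner_neg_right, h]
      norm_num
  · have hyx : y ≠ x := fun h => hx (h ▸ hy)
    simp [nodalFun, hx, hyx]

namespace Triangulation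

variable {d : ℕ} (𝒯 : Triangulation d)

/-- The bulk mass matrix `M_Ω`, with entries `∫_{Ω_h} φ_j φ_i`. -/
def bulkMass : Matrix 𝒯.Node 𝒯.Node ℝ :=
  Matrix.of fun i j => ∑ E ∈ 𝒯.elements, ∫ y in convexHull ℝ (E : Set (Pt d)),
    nodalFun E (𝒯.pos j) y * nodalFun E (𝒯.pos i) y

/-- The bulk stiffness matrix `A_Ω`, with entries `∫_{Ω_h} α_Ω φ_j φ_i + κ ∇φ_j · ∇φ_i`. -/
def bulkStiff (κ : Pt d → ℝ) (αΩ : ℝ) : Matrix 𝒯.Node 𝒯.Node ℝ :=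
  Matrix.of fun i j => ∑ E ∈ 𝒯.elements, ∫ y in convexHull ℝ (E : Set (Pt d)),
    (αΩ * (nodalFun E (𝒯.pos j) y * nodalFun E (𝒯.pos i) y) +
      κ y * inner ℝ (nodalGrad E (𝒯.pos j)) (nodalGrad E (𝒯.pos i)))

/-- The surface integral `∫_{Γ_h} φ_x φ_y dσ`, where `σ` is the `(d-1)`-dimensional Hausdorff
measure (normalised to agree with Lebesgue measure on `ℝ^(d-1)`). -/
def surfaceMassForm (x y : Pt d) : ℝ :=
  ∑ F ∈ 𝒯.boundaryFacets, ∫ z in convexHull ℝ (F : Set (Pt d)),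
    nodalFun F x z * nodalFun F y z ∂(Measure.euclideanHausdorffMeasure (d - 1))

/-- The surface mass matrix `M_Γ`, with entries `∫_{Γ_h} φ_j φ_i dσ`. -/
def surfaceMass : Matrix 𝒯.BdNode 𝒯.BdNode ℝ :=
  Matrix.of fun i j => 𝒯.surfaceMassForm j i

/-- The surface stiffness matrix `A_Γ`, with entries
`∫_{Γ_h} α_Γ φ_j φ_i + β ∇_Γ φ_j · ∇_Γ φ_i dσ`. -/
def surfaceStiff (αΓ β : ℝ) : Matrix 𝒯.BdNode 𝒯.BdNode ℝ :=
  Matrix.of fun i j => ∑ F ∈ 𝒯.boundaryFacets, ∫ z in convexHull ℝ (F : Set (Pt d)),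
    (αΓ * (nodalFun F (j : Pt d) z * nodalFun F (i : Pt d) z) +
      β * inner ℝ (nodalGrad F (j : Pt d)) (nodalGrad F (i : Pt d)))
      ∂(Measure.euclideanHausdorffMeasure (d - 1))

/-- The coupling matrix `B`, with entries `∫_{Γ_h} φ_j φ_i dσ` for surface nodes `i` and bulk
nodes `j`. -/
def coupling : Matrix 𝒯.BdNode 𝒯.Node ℝ :=
  Matrix.of fun i j => 𝒯.surfaceMassForm (𝒯.pos j) i

end Triangulation

/-- The square `‖x‖_Q² = xᵀ Q x` of the (semi-)norm given by a matrix `Q`. -/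
def normSq {ι : Type*} [Fintype ι] (Q : Matrix ι ι ℝ) (x : ι → ℝ) : ℝ := x ⬝ᵥ (Q *ᵥ x)

/-- `κ ∈ L^∞(Ω_h)` with `κ_min ≤ κ ≤ κ_max` almost everywhere. -/
def IsDiffusion {d : ℕ} (𝒯 : Triangulation d) (κmin κmax : ℝ) (κ : Pt d → ℝ) : Prop :=
  AEStronglyMeasurable κ (volume.restrict 𝒯.domain) ∧
    ∀ᵐ x ∂(volume.restrict 𝒯.domain), κmin ≤ κ x ∧ κ x ≤ κmax

/-- `c_M` is an admissible constant in the boundary estimate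
`‖·‖_{M₂₂}² ≤ c_M h_Γ ‖·‖_{M_Γ}²` on the given mesh. -/
def IsBoundaryConst {d : ℕ} (𝒯 : Triangulation d) (cM : ℝ) : Prop :=
  ∀ v : 𝒯.BdNode → ℝ,
    normSq 𝒯.bulkMass.toBlocks₂₂ v ≤ cM * 𝒯.surfaceMeshWidth * normSq 𝒯.surfaceMass v

/-- `c_inv` is an admissible constant in the inverse estimate
`‖·‖_{A₂₂}² ≤ (α_Ω + c_inv h⁻²) ‖·‖_{M₂₂}²` on the given mesh. -/
def IsInverseConst {d : ℕ} (𝒯 : Triangulation d) (κ : Pt d → ℝ) (αΩ cinv : ℝ) : Prop :=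
  ∀ v : 𝒯.BdNode → ℝ,
    normSq (𝒯.bulkStiff κ αΩ).toBlocks₂₂ v ≤
      (αΩ + cinv / 𝒯.meshWidth ^ 2) * normSq 𝒯.bulkMass.toBlocks₂₂ v

/-! ### The semi-discrete problem and the splitting scheme -/

/-- `g` is absolutely continuous on `[0, T]` with almost everywhere derivative `g'`. -/
def HasACDeriv {ι : Type*} [Fintype ι] (T : ℝ) (g g' : ℝ → ι → ℝ) : Prop :=
  IntervalIntegrable g' volume 0 T ∧ ∀ t ∈ Icc 0 T, g t = g 0 + ∫ s in (0 : ℝ)..t, g' s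

/-- `g` lies in `H¹(0, T)` with derivative `g' ∈ L²(0, T)`. -/
def HasL2Deriv {ι : Type*} [Fintype ι] (T : ℝ) (g g' : ℝ → ι → ℝ) : Prop :=
  HasACDeriv T g g' ∧ IntervalIntegrable (fun s => ‖g' s‖ ^ 2) volume 0 T

/-- `(u, p, λ)` solves the linear bulk-surface finite element semi-discretisation on `[0, T]`;
`du`, `dp` are the derivatives of `u`, `p`. -/
structure IsSemidiscreteSolution {d : ℕ} (𝒯 : Triangulation d) (κ : Pt d → ℝ) (αΩ αΓ β T : ℝ)
    (fΩ : ℝ → 𝒯.Node → ℝ) (fΓ : ℝ → 𝒯.BdNode → ℝ)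
    (u du : ℝ → 𝒯.Node → ℝ) (p dp lam : ℝ → 𝒯.BdNode → ℝ) : Prop where
  deriv_u : ∀ t ∈ Icc 0 T, HasDerivWithinAt u (du t) (Icc 0 T) t
  deriv_p : ∀ t ∈ Icc 0 T, HasDerivWithinAt p (dp t) (Icc 0 T) t
  bulk : ∀ t ∈ Icc 0 T,
    𝒯.bulkMass *ᵥ du t + 𝒯.bulkStiff κ αΩ *ᵥ u t + 𝒯.couplingᵀ *ᵥ lam t = fΩ t
  surface : ∀ t ∈ Icc 0 T,
    𝒯.surfaceMass *ᵥ dp t + 𝒯.surfaceStiff αΓ β *ᵥ p t - 𝒯.surfaceMass *ᵥ lam t = fΓ t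
  constraint : ∀ t ∈ Icc 0 T, 𝒯.coupling *ᵥ u t = 𝒯.surfaceMass *ᵥ p t

/-- The fully discrete Lie splitting (implicit Euler on both subsystems) with step size `τ`, on all
time steps that lie in `[0, T]`. Here `q n` is `∂_τ pⁿ`, whose value for `n = 0` is initial data. -/
structure IsLieEuler {d : ℕ} (𝒯 : Triangulation d) (κ : Pt d → ℝ) (αΩ αΓ β T τ : ℝ)
    (fΩ : ℝ → 𝒯.Node → ℝ) (fΓ : ℝ → 𝒯.BdNode → ℝ)
    (u₁ : ℕ → 𝒯.IntNode → ℝ) (p q : ℕ → 𝒯.BdNode → ℝ) : Prop where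
  diff_p : ∀ n : ℕ, q (n + 1) = τ⁻¹ • (p (n + 1) - p n)
  bulk_step : ∀ n : ℕ, ((n : ℝ) + 1) * τ ≤ T →
    𝒯.bulkMass.toBlocks₁₁ *ᵥ (τ⁻¹ • (u₁ (n + 1) - u₁ n))
        + (𝒯.bulkStiff κ αΩ).toBlocks₁₁ *ᵥ u₁ (n + 1)
      = (fun i => fΩ (((n : ℝ) + 1) * τ) (Sum.inl i))
        - 𝒯.bulkMass.toBlocks₁₂ *ᵥ q n - (𝒯.bulkStiff κ αΩ).toBlocks₁₂ *ᵥ p n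
  surface_step : ∀ n : ℕ, ((n : ℝ) + 1) * τ ≤ T →
    𝒯.surfaceMass *ᵥ q (n + 1) + 𝒯.surfaceStiff αΓ β *ᵥ p (n + 1)
      = fΓ (((n : ℝ) + 1) * τ) + (fun i => fΩ (((n : ℝ) + 1) * τ) (Sum.inr i))
        - 𝒯.bulkMass.toBlocks₂₂ *ᵥ q n - (𝒯.bulkStiff κ αΩ).toBlocks₂₂ *ᵥ p n
        - 𝒯.bulkMass.toBlocks₂₁ *ᵥ (τ⁻¹ • (u₁ (n + 1) - u₁ n))
        - (𝒯.bulkStiff κ αΩ).toBlocks₂₁ *ᵥ u₁ (n + 1)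

/-- The sum of the squared norms of the semi-discrete solution and of the data which enter the
error constant. `ddu`, `ddp`, `dfΩ`, `dfΓ` stand for the second derivatives of `u`, `p` and the
derivatives of the right-hand sides. -/
def dataNormSq {d : ℕ} (𝒯 : Triangulation d) (κ : Pt d → ℝ) (αΩ αΓ β T : ℝ)
    (du ddu dfΩ : ℝ → 𝒯.Node → ℝ) (dp ddp dfΓ : ℝ → 𝒯.BdNode → ℝ) : ℝ :=
  normSq (𝒯.bulkStiff κ αΩ) (du 0) + normSq (𝒯.surfaceStiff αΓ β) (dp 0)
    + normSq 𝒯.surfaceMass (dp 0)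
    + (∫ s in (0 : ℝ)..T, normSq 𝒯.bulkMass⁻¹ (dfΩ s))
    + (∫ s in (0 : ℝ)..T, normSq 𝒯.surfaceMass⁻¹ (dfΓ s))
    + (∫ s in (0 : ℝ)..T, √(normSq 𝒯.bulkMass (ddu s))) ^ 2
    + (∫ s in (0 : ℝ)..T, √(normSq 𝒯.surfaceMass (ddp s))) ^ 2
    + ∫ s in (0 : ℝ)..T, normSq (𝒯.bulkStiff κ αΩ).toBlocks₂₂ (dp s)

end BulkSurface

end

open BulkSurface

/-!
The proof has two independent halves, geometric and analytic.

*The constants.* An affine function on a `k`-simplex attains its largest absolute value over the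
simplex at a vertex, and on the copy of the simplex shrunk by the factor `1/4` towards that vertex
it is at least half as large. So its square integral controls the squares of its vertex values
(`sq_vertex_mul_measure_le`), and the gradient is at most the largest vertex value divided by the
radius of an inscribed ball (`norm_grad_mul_le`). The two facts give the inverse estimate element
by element. For the boundary estimate, both mass norms are compared with the sum of the squared
nodal values. The bulk mass is bounded above because the elements around a node overlap in null
sets and lie in a ball of radius `h`, so that no bound on their number is needed
(`Triangulation.sum_volume_star_le`). The surface mass is bounded below because every facet of an
element contains a disc whose radius is that of a ball inside the element: the section of the
element parallel to the facet through the centre of the ball is a scaled-down copy of the facet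
(`exists_disc_subset_facet`).

*The error estimate.* Nodal functions of interior nodes vanish on the surface, so `B = (0, M_Γ)`,
and `M_Γ` is positive definite. Hence the constraint says `u₂ = p`, and the multiplier disappears
when the equations are tested with a bulk vector and its trace. The splitting scheme has the same
weak form, except that the surface values in the bulk form are taken from the previous step. With
`E` the error, `δ` the error of the surface increments, `ι` the extension by zero and `π` the
trace, the error equation is
`m(Eⁿ⁺¹ - Eⁿ - ι(δⁿ⁺¹ - δⁿ), v) + τ a(Eⁿ⁺¹ - ι δⁿ⁺¹, v) + s(δⁿ⁺¹, π v) + τ b(π Eⁿ⁺¹, π v) = ρⁿ(v)`.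
It is tested with `v = Eⁿ⁺¹`. The energy that makes the mass terms telescope is
`½ m(E, E) + ½ s(πE, πE) - m(ι δ, E) + (2/7) s(δ, δ)`, and `½ s(δⁿ⁺¹, δⁿ⁺¹)` is gained in each
step. The condition `7h < 1/c_M` makes the bulk mass of a surface vector at most `1/7` of its
surface mass, and the weak CFL condition makes `τ a(ι δ, ι δ)` at most `(3/7 + τ α/7) s(δ, δ)`.
Half of the latter is what Young's inequality leaves of the explicit stiffness term. Its part with
`3/7` and the term `(2/7) s(δ, δ)` of the new energy together use up exactly the gain
(`IsErrorRecursion.energy_step`).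

The part `τ α/14 · s(δ, δ)` cannot be absorbed, since `τ α` is not restricted. It is bounded by
the energy of the previous step, through a direct estimate of one step
(`IsErrorRecursion.incr_le`), and a discrete Gronwall inequality finishes the stability proof
(`IsErrorRecursion.stability`). The residual consists of Taylor remainders in time, of size
`τ ∫ ‖ü‖` and `τ ∫ ‖p̈‖` per step, and of the surface increment measured in the stiffness norm
(`abs_splitResidual_le`, `sum_defects_le`). Since the residual enters through a square root in the
Gronwall argument, `L¹` norms of the second derivatives suffice. The second estimate keeps the
last summand of the accumulated energy norms in the first and divides by `τ`.
-/

namespace BulkSurface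

/-! ### Discrete stability -/

section Forms

variable {V : Type*} [AddCommGroup V] [Module ℝ V]

/-- The Cauchy–Schwarz inequality for a positive semidefinite form. -/
theorem abs_form_le {B : LinearMap.BilinForm ℝ V} (h0 : ∀ x, 0 ≤ B x x) (hB : ∀ x y, B x y = B y x)
    (x y : V) : |B x y| ≤ √(B x x) * √(B y y) := by
  rw [← Real.sqrt_mul (h0 x)]
  apply Real.abs_le_sqrt
  have := LinearMap.BilinForm.apply_mul_apply_le_of_forall_zero_le B h0 x y
  rw [hB y x] at this
  nlinarith

/-- Young's inequality for a positive semidefinite form. -/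
theorem form_le_young {B : LinearMap.BilinForm ℝ V} (h0 : ∀ x, 0 ≤ B x x)
    (hB : ∀ x y, B x y = B y x) {c : ℝ} (hc : 0 < c) (x y : V) :
    B x y ≤ c * B x x + (4 * c)⁻¹ * B y y := by
  have h := h0 ((2 * c) • x - y)
  simp only [map_sub, map_smul, LinearMap.sub_apply, LinearMap.smul_apply, smul_eq_mul] at h
  rw [hB y x] at h
  have e : c * B x x + (4 * c)⁻¹ * B y y - B x y
      = (4 * c)⁻¹ * (2 * c * (2 * c * B x x) - 2 * c * B x y - (2 * c * B x y - B y y)) := by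
    field_simp; ring
  have : 0 ≤ c * B x x + (4 * c)⁻¹ * B y y - B x y := by
    rw [e]; apply mul_nonneg (by positivity); linarith
  linarith

theorem neg_form_le_young {B : LinearMap.BilinForm ℝ V} (h0 : ∀ x, 0 ≤ B x x)
    (hB : ∀ x y, B x y = B y x) {c : ℝ} (hc : 0 < c) (x y : V) :
    -B x y ≤ c * B x x + (4 * c)⁻¹ * B y y := by
  have := form_le_young h0 hB hc (-x) y
  simpa using this

theorem form_sub_self_le {B : LinearMap.BilinForm ℝ V} (h0 : ∀ x, 0 ≤ B x x)
    (hB : ∀ x y, B x y = B y x) (x y : V) :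
    B (x - y) (x - y) ≤ 2 * B x x + 2 * B y y := by
  have h := neg_form_le_young h0 hB (c := 1 / 2) (by norm_num) x y
  norm_num at h
  simp only [map_sub, LinearMap.sub_apply]
  rw [hB y x]
  linarith

/-- An estimate for the pairing of `x` with itself by duality: a seminorm of a remainder is bounded
by bounding the pairing of the remainder with a fixed vector. -/
theorem sqrt_form_le_of_abs_le {B : LinearMap.BilinForm ℝ V} (h0 : ∀ x, 0 ≤ B x x) {x : V} {c : ℝ}
    (hc : 0 ≤ c) (h : |B x x| ≤ √(B x x) * c) : √(B x x) ≤ c := by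
  by_contra hcon
  push Not at hcon
  have h1 := Real.sq_sqrt (h0 x)
  have h2 := le_abs_self (B x x)
  nlinarith [Real.sqrt_nonneg (B x x)]

end Forms

/-- A discrete Gronwall inequality in which the new value occurs on the right-hand side through
its square root. The bound is linear in the sum of the coefficients `β`, which is why an `L¹` norm
in time of the data suffices. -/
theorem discrete_gronwall_sqrt {Z β γ : ℕ → ℝ} {ω : ℝ} {N : ℕ} (hω : 1 ≤ ω)
    (hZ : ∀ n, 0 ≤ Z n) (hβ : ∀ n, 0 ≤ β n) (hγ : ∀ n, 0 ≤ γ n) (hZ0 : Z 0 = 0)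
    (h : ∀ n < N, Z (n + 1) ≤ ω ^ 2 * Z n + β n * √(Z (n + 1)) + γ n) :
    √(Z N) ≤ ω ^ N * (∑ n ∈ Finset.range N, β n + √(∑ n ∈ Finset.range N, γ n)) := by
  have key : ∀ n ≤ N, √(Z n) ≤ ω ^ n *
      (∑ k ∈ Finset.range n, β k + √(∑ k ∈ Finset.range n, γ k)) := by
    intro n
    induction n with
    | zero => intro _; simp [hZ0]
    | succ n ih =>
      intro hn
      have ih := ih (by omega)
      have h1 := h n (by omega)
      rw [Finset.sum_range_succ, Finset.sum_range_succ]
      have hB : 0 ≤ ∑ k ∈ Finset.range n, β k := Finset.sum_nonneg fun k _ => hβ k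
      have hG : 0 ≤ ∑ k ∈ Finset.range n, γ k := Finset.sum_nonneg fun k _ => hγ k
      set B := ∑ k ∈ Finset.range n, β k
      set G := ∑ k ∈ Finset.range n, γ k
      set x := √(Z (n + 1)) with hx
      have hx0 : 0 ≤ x := Real.sqrt_nonneg _
      have hxx : Z (n + 1) = x ^ 2 := (Real.sq_sqrt (hZ _)).symm
      have hω1 : 1 ≤ ω ^ (n + 1) := one_le_pow₀ hω
      set q := ω ^ (n + 1) with hq
      have hzn : ω ^ 2 * Z n ≤ q ^ 2 * (B + √G) ^ 2 := by
        have : Z n ≤ (ω ^ n * (B + √G)) ^ 2 := by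
          rw [← Real.sq_sqrt (hZ n)]
          exact pow_le_pow_left₀ (Real.sqrt_nonneg _) ih 2
        calc ω ^ 2 * Z n ≤ ω ^ 2 * (ω ^ n * (B + √G)) ^ 2 :=
              mul_le_mul_of_nonneg_left this (sq_nonneg _)
          _ = q ^ 2 * (B + √G) ^ 2 := by rw [hq]; ring
      have hsG : √G ≤ √(G + γ n) := Real.sqrt_le_sqrt (by linarith [hγ n])
      have hsG0 := Real.sqrt_nonneg G
      have e1 := Real.sq_sqrt hG
      have e2 := Real.sq_sqrt (add_nonneg hG (hγ n))
      set y := B + √(G + γ n)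
      have hy0 : 0 ≤ y := by positivity
      have hA : q ^ 2 * (B + √G) ^ 2 + γ n ≤ (q * y) ^ 2 := by
        have h2 : (B + √G) ^ 2 + γ n ≤ y ^ 2 := by
          simp only [y]; nlinarith [mul_le_mul_of_nonneg_left hsG hB]
        have h3 : γ n ≤ q ^ 2 * γ n := le_mul_of_one_le_left (hγ n) (one_le_pow₀ hω1)
        calc _ ≤ q ^ 2 * ((B + √G) ^ 2 + γ n) := by linarith
          _ ≤ q ^ 2 * y ^ 2 := mul_le_mul_of_nonneg_left h2 (sq_nonneg _)
          _ = _ := by ring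
      have hfin : x ^ 2 ≤ (q * y) ^ 2 + β n * x := by rw [← hxx]; linarith
      have hqy : 0 ≤ q * y := by positivity
      -- a nonnegative `x` with `x ^ 2 ≤ A ^ 2 + β x` is at most `A + β`
      have : x ≤ q * y + β n := by
        by_contra hcon
        push Not at hcon
        nlinarith [hβ n]
      have h4 : β n ≤ q * β n := le_mul_of_one_le_left (hβ n) hω1
      calc x ≤ q * y + q * β n := by linarith
        _ = _ := by simp only [y]; ring
  exact key N le_rfl

section Scheme

variable {V W : Type*} [AddCommGroup V] [Module ℝ V] [AddCommGroup W] [Module ℝ W]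

/-- The bilinear forms `m`, `a` (bulk) and `s`, `b` (surface) of a coupled bulk-surface problem,
with the extension `ι` by zero of surface vectors and the trace `π`. The two inequalities are the
form in which the weak CFL condition is used. -/
structure IsSplitSystem (m a : LinearMap.BilinForm ℝ V) (s b : LinearMap.BilinForm ℝ W)
    (ι : W →ₗ[ℝ] V) (π : V →ₗ[ℝ] W) (α τ : ℝ) : Prop where
  m_nonneg : ∀ x, 0 ≤ m x x
  a_nonneg : ∀ x, 0 ≤ a x x
  s_nonneg : ∀ x, 0 ≤ s x x
  b_nonneg : ∀ x, 0 ≤ b x x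
  m_symm : ∀ x y, m x y = m y x
  a_symm : ∀ x y, a x y = a y x
  s_symm : ∀ x y, s x y = s y x
  trace_ext : ∀ x, π (ι x) = x
  mass_le : ∀ x, m (ι x) (ι x) ≤ 1 / 7 * s x x
  stiff_le : ∀ x, τ * a (ι x) (ι x) ≤ (3 / 7 + τ * α / 7) * s x x

/-- The error equation of the Lie splitting on the first `N` steps. Here `E` is the error, `δ (n + 1)`
the increment of its trace in the step `n`, and `ρ n` the residual, which is bounded by `G n` in the
mass norms and by `k n` in the stiffness seminorm. The value `δ 0` is not an increment of `E`: it
accounts for the initial difference quotient that the scheme is started with. -/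
structure IsErrorRecursion (m a : LinearMap.BilinForm ℝ V) (s b : LinearMap.BilinForm ℝ W)
    (ι : W →ₗ[ℝ] V) (π : V →ₗ[ℝ] W) (τ : ℝ) (N : ℕ) (E : ℕ → V) (δ : ℕ → W) (ρ : ℕ → V → ℝ)
    (G k : ℕ → ℝ) : Prop where
  incr : ∀ n < N, δ (n + 1) = π (E (n + 1)) - π (E n)
  eqn : ∀ n < N, ∀ v, m (E (n + 1) - E n - ι (δ (n + 1) - δ n)) v
    + τ * a (E (n + 1) - ι (δ (n + 1))) v + s (δ (n + 1)) (π v) + τ * b (π (E (n + 1))) (π v)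
    = ρ n v
  G_nonneg : ∀ n, 0 ≤ G n
  k_nonneg : ∀ n, 0 ≤ k n
  bound : ∀ n < N, ∀ v,
    |ρ n v| ≤ τ * (G n * (√(m v v) + √(s (π v) (π v))) + k n * √(a v v))

variable {m a : LinearMap.BilinForm ℝ V} {s b : LinearMap.BilinForm ℝ W}
  {ι : W →ₗ[ℝ] V} {π : V →ₗ[ℝ] W} {α τ : ℝ} {N : ℕ} {E : ℕ → V} {δ : ℕ → W} {ρ : ℕ → V → ℝ}
  {G k : ℕ → ℝ}

/-- The energy of the splitting error: the cross term compensates the explicit treatment of the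
difference quotients on the surface. -/
noncomputable def splitEnergy (m : LinearMap.BilinForm ℝ V) (s : LinearMap.BilinForm ℝ W)
    (ι : W →ₗ[ℝ] V) (π : V →ₗ[ℝ] W) (e : V) (x : W) : ℝ :=
  1 / 2 * m e e + 1 / 2 * s (π e) (π e) - m (ι x) e + 2 / 7 * s x x

theorem IsSplitSystem.le_splitEnergy (S : IsSplitSystem m a s b ι π α τ) (e : V) (x : W) :
    1 / 4 * m e e + 1 / 2 * s (π e) (π e) + 1 / 7 * s x x ≤ splitEnergy m s ι π e x := by
  have h1 := form_le_young S.m_nonneg S.m_symm (c := 1) one_pos (ι x) e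
  have h2 := S.mass_le x
  unfold splitEnergy
  linarith

/-- One step of the energy estimate, from the error equation tested with the new error. On the
right-hand side remains the part of the explicit stiffness term that comes from the mass
contribution `α`. -/
theorem IsErrorRecursion.energy_step (S : IsSplitSystem m a s b ι π α τ)
    (H : IsErrorRecursion m a s b ι π τ N E δ ρ G k) (hτ : 0 < τ) {n : ℕ} (hn : n < N) :
    splitEnergy m s ι π (E (n + 1)) (δ (n + 1))
      + τ * (1 / 4 * a (E (n + 1)) (E (n + 1)) + b (π (E (n + 1))) (π (E (n + 1))))
      ≤ splitEnergy m s ι π (E n) (δ n)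
        + τ * G n * (√(m (E (n + 1)) (E (n + 1))) + √(s (π (E (n + 1))) (π (E (n + 1)))))
        + τ * k n ^ 2 + τ * α / 14 * s (δ (n + 1)) (δ (n + 1)) := by
  have heq := H.eqn n hn (E (n + 1))
  have hρ := (le_abs_self _).trans (H.bound n hn (E (n + 1)))
  have hy := form_le_young S.a_nonneg S.a_symm (c := 1 / 2) (by norm_num) (ι (δ (n + 1))) (E (n + 1))
  have hst := S.stiff_le (δ (n + 1))
  -- the part of the explicit mass term that does not telescope
  have hm := neg_form_le_young S.m_nonneg S.m_symm (c := 1 / 2) (by norm_num) (ι (δ n))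
    (E (n + 1) - E n)
  have hm2 := S.mass_le (δ n)
  have hs0 := S.s_nonneg (δ n)
  have hk : k n * √(a (E (n + 1)) (E (n + 1))) ≤ k n ^ 2 + 1 / 4 * a (E (n + 1)) (E (n + 1)) := by
    have := Real.sq_sqrt (S.a_nonneg (E (n + 1)))
    nlinarith [sq_nonneg (k n - 1 / 2 * √(a (E (n + 1)) (E (n + 1))))]
  have hk' := mul_le_mul_of_nonneg_left hk hτ.le
  have hy' := mul_le_mul_of_nonneg_left hy hτ.le
  -- the implicit surface mass term yields the gain of half the square of the increment
  have hδ2 : s (δ (n + 1)) (δ (n + 1))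
      = s (π (E (n + 1))) (π (E (n + 1))) - 2 * s (π (E n)) (π (E (n + 1)))
        + s (π (E n)) (π (E n)) := by
    rw [H.incr n hn]
    simp only [map_sub, LinearMap.sub_apply]
    rw [S.s_symm (π (E (n + 1))) (π (E n))]
    ring
  have hsE : s (δ (n + 1)) (π (E (n + 1)))
      = s (π (E (n + 1))) (π (E (n + 1))) - s (π (E n)) (π (E (n + 1))) := by
    rw [H.incr n hn]; simp only [map_sub, LinearMap.sub_apply]
  simp only [map_sub, LinearMap.sub_apply] at heq hm
  rw [S.m_symm (E (n + 1)) (E n)] at hm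
  unfold splitEnergy
  norm_num at hm hy'
  ring_nf at *
  linarith

/-- The residual bound in a form ready for absorption, by Young's inequality. -/
theorem IsErrorRecursion.residual_le (S : IsSplitSystem m a s b ι π α τ)
    (H : IsErrorRecursion m a s b ι π τ N E δ ρ G k) (hτ : 0 < τ) {n : ℕ} (hn : n < N) (v : V)
    {c : ℝ} (hc : 0 < c) :
    ρ n v ≤ 4 * (τ ^ 2 * G n ^ 2) + c * (τ * k n ^ 2)
      + 1 / 8 * m v v + 1 / 8 * s (π v) (π v) + (4 * c)⁻¹ * (τ * a v v) := by
  refine ((le_abs_self _).trans (H.bound n hn v)).trans ?_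
  have e1 := Real.sq_sqrt (S.m_nonneg v)
  have e2 := Real.sq_sqrt (S.s_nonneg (π v))
  have e3 := Real.sq_sqrt (S.a_nonneg v)
  have f1 : τ * G n * √(m v v) ≤ 2 * (τ ^ 2 * G n ^ 2) + 1 / 8 * m v v := by
    nlinarith [sq_nonneg (4 * (τ * G n) - √(m v v))]
  have f2 : τ * G n * √(s (π v) (π v)) ≤ 2 * (τ ^ 2 * G n ^ 2) + 1 / 8 * s (π v) (π v) := by
    nlinarith [sq_nonneg (4 * (τ * G n) - √(s (π v) (π v)))]
  have f3 : k n * √(a v v) ≤ c * k n ^ 2 + (4 * c)⁻¹ * a v v := by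
    have : 0 ≤ (4 * c)⁻¹ * (2 * c * k n - √(a v v)) ^ 2 := by positivity
    have e : (4 * c)⁻¹ * (2 * c * k n - √(a v v)) ^ 2
        = c * k n ^ 2 + (4 * c)⁻¹ * √(a v v) ^ 2 - k n * √(a v v) := by
      field_simp; ring
    rw [e, e3] at this
    linarith
  have f3' := mul_le_mul_of_nonneg_left f3 hτ.le
  linarith

/-- A bound, obtained from the interior equation alone, on the vector which combines the new
interior error with the old surface error. It needs no relation between the step size and `α`. -/
theorem IsErrorRecursion.interior_le (S : IsSplitSystem m a s b ι π α τ)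
    (H : IsErrorRecursion m a s b ι π τ N E δ ρ G k) (hτ : 0 < τ) {L : ℝ} (hα : 0 ≤ α)
    (hL : 1 + τ * α ≤ L) {n : ℕ} (hn : n < N) :
    m (E (n + 1) - ι (δ (n + 1))) (E (n + 1) - ι (δ (n + 1)))
      + τ * a (E (n + 1) - ι (δ (n + 1))) (E (n + 1) - ι (δ (n + 1)))
      ≤ 16 * L * (7 * splitEnergy m s ι π (E n) (δ n) + τ ^ 2 * G n ^ 2 + τ * k n ^ 2) := by
  have hτα : 0 ≤ τ * α := by positivity
  have hL1 : 1 ≤ L := by linarith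
  -- a test vector with trace zero removes the surface forms from the error equation
  have heq := H.eqn n hn (E (n + 1) - ι (δ (n + 1)) - ι (π (E n)))
  have hdiff : E (n + 1) - E n - ι (δ (n + 1) - δ n)
      = E (n + 1) - ι (δ (n + 1)) - (E n - ι (δ n)) := by
    rw [map_sub]; abel
  have hπv : π (E (n + 1) - ι (δ (n + 1)) - ι (π (E n))) = 0 := by
    rw [map_sub, map_sub, S.trace_ext, S.trace_ext, H.incr n hn]; abel
  have hr := H.residual_le S hτ hn (E (n + 1) - ι (δ (n + 1)) - ι (π (E n))) two_pos
  rw [hπv] at heq hr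
  rw [hdiff] at heq
  have hmy := S.mass_le (π (E n))
  have hay : τ * a (ι (π (E n))) (ι (π (E n))) ≤ L * s (π (E n)) (π (E n)) :=
    (S.stiff_le (π (E n))).trans (mul_le_mul_of_nonneg_right (by linarith) (S.s_nonneg _))
  have hen := S.le_splitEnergy (E n) (δ n)
  have hmE := S.m_nonneg (E n)
  have hsE := S.s_nonneg (π (E n))
  have hsδ := S.s_nonneg (δ n)
  have hmz := form_sub_self_le S.m_nonneg S.m_symm (E n) (ι (δ n))
  have hmδ := S.mass_le (δ n)
  have hg : 0 ≤ τ ^ 2 * G n ^ 2 := by positivity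
  have hk : 0 ≤ τ * k n ^ 2 := by positivity
  generalize τ ^ 2 * G n ^ 2 = g at *
  generalize τ * k n ^ 2 = r at *
  generalize splitEnergy m s ι π (E n) (δ n) = X at *
  generalize E (n + 1) - ι (δ (n + 1)) = w at *
  generalize E n - ι (δ n) = z at *
  generalize ι (π (E n)) = y at *
  simp only [map_zero] at hr heq
  have h1 := form_le_young S.m_nonneg S.m_symm (c := 1 / 4) (by norm_num) w y
  have h2 := mul_le_mul_of_nonneg_left
    (form_le_young S.a_nonneg S.a_symm (c := 1 / 4) (by norm_num) w y) hτ.le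
  have h3 := form_le_young S.m_nonneg S.m_symm (c := 2) (by norm_num) z (w - y)
  have h4 := form_sub_self_le S.m_nonneg S.m_symm w y
  have h5 := mul_le_mul_of_nonneg_left (form_sub_self_le S.a_nonneg S.a_symm w y) hτ.le
  have hmw := S.m_nonneg w
  have haw := mul_nonneg hτ.le (S.a_nonneg w)
  have hmain : m w w + τ * a w w = m w y + τ * a w y + m z (w - y) + ρ n (w - y) := by
    rw [← heq]
    simp only [map_sub, LinearMap.sub_apply]
    ring
  have hfin : m w w + τ * a w w ≤ 6 * (1 / 7 * s (π (E n)) (π (E n))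
      + L * s (π (E n)) (π (E n))) + 8 * m z z + 16 * (g + r) := by
    have hLs := mul_nonneg (zero_le_one.trans hL1) hsE
    linarith only [hr, h1, h2, h3, h4, h5, hmain, hmy, hay, hmw, haw, hg, hk, hLs, hsE]
  have g1 := mul_le_mul_of_nonneg_right hL1 hsE
  have g2 := mul_le_mul_of_nonneg_right hL1 hmE
  have g3 := mul_le_mul_of_nonneg_right hL1 hsδ
  have g4 := mul_le_mul_of_nonneg_right hL1 (add_nonneg hg hk)
  calc m w w + τ * a w w ≤ 16 * L * (s (π (E n)) (π (E n)) + m (E n) (E n)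
        + s (δ n) (δ n) + g + r) := by
        linarith only [hfin, g1, g2, g3, g4, hmz, hmδ, hsE, hmE, hsδ]
    _ ≤ _ := by
      apply mul_le_mul_of_nonneg_left _ (by positivity)
      linarith only [hen, hmE, hsE, hsδ]

/-- A bound on the new surface error, from the error equation tested with its extension by zero. -/
theorem IsErrorRecursion.surface_le (S : IsSplitSystem m a s b ι π α τ)
    (H : IsErrorRecursion m a s b ι π τ N E δ ρ G k) (hτ : 0 < τ) {L : ℝ} (hα : 0 ≤ α)
    (hL : 1 + τ * α ≤ L) {n : ℕ} (hn : n < N) :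
    s (π (E (n + 1))) (π (E (n + 1))) ≤ 900 * L ^ 2 *
      (splitEnergy m s ι π (E n) (δ n) + τ ^ 2 * G n ^ 2 + τ * k n ^ 2) := by
  have hτα : 0 ≤ τ * α := by positivity
  have hL1 : 1 ≤ L := by linarith
  have hL0 : 0 < L := by linarith
  have hN := H.interior_le S hτ hα hL hn
  have heq := H.eqn n hn (ι (π (E (n + 1))))
  have hdiff : E (n + 1) - E n - ι (δ (n + 1) - δ n)
      = E (n + 1) - ι (δ (n + 1)) - (E n - ι (δ n)) := by
    rw [map_sub]; abel
  have hr := H.residual_le S hτ hn (ι (π (E (n + 1)))) (c := 2 * L) (by positivity)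
  rw [S.trace_ext] at heq hr
  rw [hdiff] at heq
  have hδ : s (δ (n + 1)) (π (E (n + 1)))
      = s (π (E (n + 1))) (π (E (n + 1))) - s (π (E n)) (π (E (n + 1))) := by
    rw [H.incr n hn, map_sub, LinearMap.sub_apply]
  rw [hδ] at heq
  have hsx := S.s_nonneg (π (E (n + 1)))
  have hax : τ * a (ι (π (E (n + 1)))) (ι (π (E (n + 1))))
      ≤ L * s (π (E (n + 1))) (π (E (n + 1))) :=
    (S.stiff_le _).trans (mul_le_mul_of_nonneg_right (by linarith) hsx)
  have hmx := S.mass_le (π (E (n + 1)))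
  have hen := S.le_splitEnergy (E n) (δ n)
  have hmE := S.m_nonneg (E n)
  have hsE := S.s_nonneg (π (E n))
  have hsδ := S.s_nonneg (δ n)
  have hmz := form_sub_self_le S.m_nonneg S.m_symm (E n) (ι (δ n))
  have hmδ := S.mass_le (δ n)
  have hg : 0 ≤ τ ^ 2 * G n ^ 2 := by positivity
  have hk : 0 ≤ τ * k n ^ 2 := by positivity
  generalize τ ^ 2 * G n ^ 2 = g at *
  generalize τ * k n ^ 2 = r at *
  generalize splitEnergy m s ι π (E n) (δ n) = X at *
  generalize E (n + 1) - ι (δ (n + 1)) = w at *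
  generalize E n - ι (δ n) = z at *
  generalize π (E (n + 1)) = x at *
  have hbx := mul_nonneg hτ.le (S.b_nonneg x)
  have hax' : (4 * (2 * L))⁻¹ * (τ * a (ι x) (ι x)) ≤ 1 / 8 * s x x := by
    calc _ ≤ (4 * (2 * L))⁻¹ * (L * s x x) := mul_le_mul_of_nonneg_left hax (by positivity)
      _ = _ := by field_simp; ring
  have h1 := form_le_young S.s_nonneg S.s_symm (c := 2) (by norm_num) (π (E n)) x
  have h2 := neg_form_le_young S.m_nonneg S.m_symm (c := 2) (by norm_num) w (ι x)
  have h3 := form_le_young S.m_nonneg S.m_symm (c := 2) (by norm_num) z (ι x)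
  have h4 : τ * -a w (ι x) ≤ 2 * L * (τ * a w w) + 1 / 8 * s x x := by
    have := mul_le_mul_of_nonneg_left
      (neg_form_le_young S.a_nonneg S.a_symm (c := 2 * L) (by positivity) w (ι x)) hτ.le
    calc _ ≤ _ := this
      _ = 2 * L * (τ * a w w) + (4 * (2 * L))⁻¹ * (τ * a (ι x) (ι x)) := by ring
      _ ≤ _ := by linarith only [hax']
  have hmain : s x x + τ * b x x
      = s (π (E n)) x - m w (ι x) + τ * -a w (ι x) + m z (ι x) + ρ n (ι x) := by
    rw [← heq, map_sub, LinearMap.sub_apply]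
    ring
  have hmw := S.m_nonneg w
  have hX0 : 0 ≤ X := by linarith
  have hNL : 2 * m w w + 2 * L * (τ * a w w)
      ≤ 224 * (L ^ 2 * X) + 32 * (L ^ 2 * g) + 32 * (L ^ 2 * r) := by
    have h5 := mul_le_mul_of_nonneg_left hN (show 0 ≤ 2 * L by positivity)
    have h6 := mul_le_mul_of_nonneg_right hL1 hmw
    calc _ ≤ 2 * L * (m w w + τ * a w w) := by linarith only [h6]
      _ ≤ _ := h5
      _ = _ := by ring
  have hL2 : 1 ≤ L ^ 2 := one_le_pow₀ hL1
  have g1 := mul_le_mul_of_nonneg_right hL2 hX0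
  have g2 := mul_le_mul_of_nonneg_right hL2 hg
  have g3 : L * r ≤ L ^ 2 * r := mul_le_mul_of_nonneg_right (by nlinarith) hk
  have g4 : 0 ≤ L ^ 2 * r := by positivity
  have hgoal : 900 * L ^ 2 * (X + g + r)
      = 900 * (L ^ 2 * X) + 900 * (L ^ 2 * g) + 900 * (L ^ 2 * r) := by ring
  rw [hgoal]
  linarith only [hr, h1, h2, h3, h4, hmain, hNL, g1, g2, g3, g4, hax', hmx, hbx, hmz, hmδ, hen,
    hsE, hmE, hsδ, hsx, hmw, hg, hk, hX0]

/-- A bound on the increment of the surface error which does not need any relation between the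
step size and `α`. -/
theorem IsErrorRecursion.incr_le (S : IsSplitSystem m a s b ι π α τ)
    (H : IsErrorRecursion m a s b ι π τ N E δ ρ G k) (hτ : 0 < τ) {L : ℝ} (hα : 0 ≤ α)
    (hL : 1 + τ * α ≤ L) {n : ℕ} (hn : n < N) :
    s (δ (n + 1)) (δ (n + 1)) ≤ 2000 * L ^ 2 *
      (splitEnergy m s ι π (E n) (δ n) + τ ^ 2 * G n ^ 2 + τ * k n ^ 2) := by
  have hs := H.surface_le S hτ hα hL hn
  have hfin := form_sub_self_le S.s_nonneg S.s_symm (π (E (n + 1))) (π (E n))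
  rw [← H.incr n hn] at hfin
  have hen := S.le_splitEnergy (E n) (δ n)
  have hmE := S.m_nonneg (E n)
  have hsE := S.s_nonneg (π (E n))
  have hsδ := S.s_nonneg (δ n)
  have hL2 : 1 ≤ L ^ 2 := one_le_pow₀ (by nlinarith)
  have hG0 : 0 ≤ τ ^ 2 * G n ^ 2 := by positivity
  have hk0 : 0 ≤ τ * k n ^ 2 := by positivity
  have g1 := mul_le_mul_of_nonneg_right hL2
    (show 0 ≤ splitEnergy m s ι π (E n) (δ n) + τ ^ 2 * G n ^ 2 + τ * k n ^ 2 by linarith)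
  linarith only [hs, hfin, hen, hmE, hsE, hsδ, hG0, hk0, g1]

/-- The rate in the Gronwall argument for the splitting scheme: the coefficient `α / 14` of the
remaining term in the energy estimate times the constant of the bound on the surface increment. -/
noncomputable def splitRate (α T : ℝ) : ℝ := α / 14 * (2000 * (1 + T * α) ^ 2)

/-- The stability constant of the splitting scheme. It depends on `α` and `T` only. -/
noncomputable def splitConst (α T : ℝ) : ℝ :=
  8 * Real.exp (2 * (splitRate α T * T)) * (17 + splitRate α T * T)

/-- Stability of the Lie splitting in the norm of the error estimate. -/
theorem IsErrorRecursion.stability (S : IsSplitSystem m a s b ι π α τ)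
    (H : IsErrorRecursion m a s b ι π τ N E δ ρ G k) (hτ : 0 < τ) (hα : 0 ≤ α) {T : ℝ}
    (hT : 0 < T) (hN : N * τ ≤ T) (hE0 : E 0 = 0) (hδ0 : δ 0 = 0) :
    m (E N) (E N) + τ * ∑ j ∈ Finset.range N, a (E (j + 1)) (E (j + 1))
      + s (π (E N)) (π (E N)) + τ * ∑ j ∈ Finset.range N, b (π (E (j + 1))) (π (E (j + 1)))
      ≤ splitConst α T * ((τ * ∑ j ∈ Finset.range N, G j) ^ 2
        + τ * ∑ j ∈ Finset.range N, k j ^ 2) := by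
  set K := splitRate α T with hK
  have hK0 : 0 ≤ K := by rw [hK, splitRate]; positivity
  set D : ℕ → ℝ := fun j => τ * (1 / 4 * a (E (j + 1)) (E (j + 1))
    + b (π (E (j + 1))) (π (E (j + 1)))) with hD
  have hD0 : ∀ j, 0 ≤ D j := fun j => by
    have h1 := S.a_nonneg (E (j + 1))
    have h2 := S.b_nonneg (π (E (j + 1)))
    simp only [hD]; positivity
  set e : ℕ → ℝ := fun n => splitEnergy m s ι π (E n) (δ n) with he
  have hlow : ∀ n, 1 / 4 * m (E n) (E n) + 1 / 2 * s (π (E n)) (π (E n)) + 1 / 7 * s (δ n) (δ n)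
      ≤ e n := fun n => S.le_splitEnergy _ _
  have he0 : ∀ n, 0 ≤ e n := fun n => by
    have h1 := S.m_nonneg (E n)
    have h2 := S.s_nonneg (π (E n))
    have h3 := S.s_nonneg (δ n)
    linarith [hlow n]
  -- the Gronwall argument is run on the energy plus the accumulated dissipation
  set Z : ℕ → ℝ := fun n => e n + ∑ j ∈ Finset.range n, D j with hZ
  have heZ : ∀ n, e n ≤ Z n := fun n => by
    have := Finset.sum_nonneg fun j (_ : j ∈ Finset.range n) => hD0 j
    simp only [hZ]; linarith
  have hZn : ∀ n, 0 ≤ Z n := fun n => (he0 n).trans (heZ n)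
  have hZ0 : Z 0 = 0 := by simp [hZ, he, splitEnergy, hE0, hδ0]
  have hstep : ∀ n < N, Z (n + 1) ≤ (1 + K * τ) ^ 2 * Z n + 4 * τ * G n * √(Z (n + 1))
      + (1 + K * T) * (τ ^ 2 * G n ^ 2 + τ * k n ^ 2) := by
    intro n hn
    have hτT : τ ≤ T := by
      have : (1 : ℝ) ≤ N := by exact_mod_cast (show 1 ≤ N by omega)
      nlinarith
    have h1 := H.energy_step S hτ hn
    have h2 := H.incr_le S hτ (L := 1 + T * α) hα (by gcongr) hn
    have hG0 := H.G_nonneg n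
    have hk0 := H.k_nonneg n
    have h3 : √(m (E (n + 1)) (E (n + 1))) ≤ 2 * √(Z (n + 1)) := by
      rw [show (2 : ℝ) = √4 by rw [show (4 : ℝ) = 2 ^ 2 by norm_num]; simp,
        ← Real.sqrt_mul (by norm_num)]
      apply Real.sqrt_le_sqrt
      linarith [hlow (n + 1), heZ (n + 1), S.s_nonneg (π (E (n + 1))), S.s_nonneg (δ (n + 1))]
    have h4 : √(s (π (E (n + 1))) (π (E (n + 1)))) ≤ 2 * √(Z (n + 1)) := by
      rw [show (2 : ℝ) = √4 by rw [show (4 : ℝ) = 2 ^ 2 by norm_num]; simp,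
        ← Real.sqrt_mul (by norm_num)]
      apply Real.sqrt_le_sqrt
      linarith [hlow (n + 1), heZ (n + 1), S.m_nonneg (E (n + 1)), S.s_nonneg (δ (n + 1)),
        S.s_nonneg (π (E (n + 1)))]
    have h5 := mul_le_mul_of_nonneg_left (add_le_add h3 h4) (mul_nonneg hτ.le hG0)
    have h6 : τ * α / 14 * s (δ (n + 1)) (δ (n + 1))
        ≤ K * τ * (Z n + τ ^ 2 * G n ^ 2 + τ * k n ^ 2) := by
      calc _ ≤ τ * α / 14 * (2000 * (1 + T * α) ^ 2 * (e n + τ ^ 2 * G n ^ 2 + τ * k n ^ 2)) :=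
            mul_le_mul_of_nonneg_left h2 (by positivity)
        _ = K * τ * (e n + τ ^ 2 * G n ^ 2 + τ * k n ^ 2) := by rw [hK, splitRate]; ring
        _ ≤ _ := by have := heZ n; gcongr
    have h7 : K * τ * (τ ^ 2 * G n ^ 2 + τ * k n ^ 2)
        ≤ K * T * (τ ^ 2 * G n ^ 2 + τ * k n ^ 2) := by gcongr
    have h8 : Z (n + 1) ≤ Z n + 4 * τ * G n * √(Z (n + 1)) + τ * k n ^ 2
        + K * τ * (Z n + τ ^ 2 * G n ^ 2 + τ * k n ^ 2) := by
      have : Z (n + 1) = e (n + 1) + D n + ∑ j ∈ Finset.range n, D j := by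
        simp only [hZ, Finset.sum_range_succ]; ring
      rw [this]
      have hZe : Z n = e n + ∑ j ∈ Finset.range n, D j := rfl
      change e (n + 1) + D n ≤ _ at h1
      rw [← this]
      linarith
    have h9 : 0 ≤ K * τ * Z n := by have := hZn n; positivity
    have h10 : 0 ≤ (K * τ) ^ 2 * Z n := by have := hZn n; positivity
    have h11 : 0 ≤ τ ^ 2 * G n ^ 2 := by positivity
    nlinarith
  have hgr := discrete_gronwall_sqrt (β := fun n => 4 * τ * G n)
    (γ := fun n => (1 + K * T) * (τ ^ 2 * G n ^ 2 + τ * k n ^ 2)) (ω := 1 + K * τ) (N := N)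
    (by have := mul_nonneg hK0 hτ.le; linarith) hZn
    (fun n => by have := H.G_nonneg n; positivity) (fun n => by positivity) hZ0 hstep
  set B := τ * ∑ j ∈ Finset.range N, G j with hB
  set Q := τ * ∑ j ∈ Finset.range N, k j ^ 2 with hQ
  have hQ0 : 0 ≤ Q := mul_nonneg hτ.le (Finset.sum_nonneg fun j _ => sq_nonneg _)
  have hB0 : 0 ≤ B := mul_nonneg hτ.le (Finset.sum_nonneg fun j _ => H.G_nonneg j)
  have hβ : ∑ n ∈ Finset.range N, 4 * τ * G n = 4 * B := by
    rw [← Finset.mul_sum, hB]; ring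
  have hγ : ∑ n ∈ Finset.range N, (1 + K * T) * (τ ^ 2 * G n ^ 2 + τ * k n ^ 2)
      ≤ (1 + K * T) * (B ^ 2 + Q) := by
    rw [← Finset.mul_sum, Finset.sum_add_distrib, ← Finset.mul_sum, ← Finset.mul_sum, hB, mul_pow]
    have := Finset.sum_sq_le_sq_sum_of_nonneg (s := Finset.range N) fun j _ => H.G_nonneg j
    gcongr
  have hω : (1 + K * τ) ^ N ≤ Real.exp (K * T) := by
    calc (1 + K * τ) ^ N ≤ Real.exp (K * τ) ^ N := by
          gcongr; linarith [Real.add_one_le_exp (K * τ)]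
      _ = Real.exp (K * (N * τ)) := by rw [← Real.exp_nat_mul]; congr 1; ring
      _ ≤ _ := by gcongr
  have hZN : Z N ≤ Real.exp (2 * (K * T)) * (2 * ((17 + K * T) * (B ^ 2 + Q))) := by
    rw [hβ] at hgr
    set Γ := √(∑ n ∈ Finset.range N, (1 + K * T) * (τ ^ 2 * G n ^ 2 + τ * k n ^ 2))
    have hΓ0 : 0 ≤ Γ := Real.sqrt_nonneg _
    have hΓ : Γ ^ 2 ≤ (1 + K * T) * (B ^ 2 + Q) := by
      rw [Real.sq_sqrt (Finset.sum_nonneg fun n _ => by positivity)]; exact hγ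
    have h1 : √(Z N) ≤ Real.exp (K * T) * (4 * B + Γ) :=
      hgr.trans (mul_le_mul_of_nonneg_right hω (by positivity))
    calc Z N = √(Z N) ^ 2 := (Real.sq_sqrt (hZn N)).symm
      _ ≤ (Real.exp (K * T) * (4 * B + Γ)) ^ 2 := pow_le_pow_left₀ (Real.sqrt_nonneg _) h1 2
      _ = Real.exp (2 * (K * T)) * (4 * B + Γ) ^ 2 := by
        rw [mul_pow, ← Real.exp_nat_mul]; norm_num
      _ ≤ _ := by
        gcongr
        nlinarith [sq_nonneg (4 * B - Γ)]
  have hfin : m (E N) (E N) + τ * ∑ j ∈ Finset.range N, a (E (j + 1)) (E (j + 1))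
      + s (π (E N)) (π (E N)) + τ * ∑ j ∈ Finset.range N, b (π (E (j + 1))) (π (E (j + 1)))
      ≤ 4 * Z N := by
    have h1 : ∑ j ∈ Finset.range N, D j
        = τ * (1 / 4 * ∑ j ∈ Finset.range N, a (E (j + 1)) (E (j + 1))
          + ∑ j ∈ Finset.range N, b (π (E (j + 1))) (π (E (j + 1)))) := by
      simp only [hD, Finset.mul_sum, ← Finset.sum_add_distrib]
    have h2 : 0 ≤ τ * ∑ j ∈ Finset.range N, b (π (E (j + 1))) (π (E (j + 1))) :=
      mul_nonneg hτ.le (Finset.sum_nonneg fun j _ => S.b_nonneg _)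
    have h3 := hlow N
    have hZe : Z N = e N + ∑ j ∈ Finset.range N, D j := rfl
    rw [hZe, h1]
    linarith [S.s_nonneg (δ N), S.s_nonneg (π (E N))]
  calc _ ≤ 4 * Z N := hfin
    _ ≤ 4 * (Real.exp (2 * (K * T)) * (2 * ((17 + K * T) * (B ^ 2 + Q)))) := by gcongr
    _ = _ := by rw [splitConst]; ring

end Scheme

/-! ### Taylor remainders in the seminorm of a bilinear form -/

section Time

variable {ι : Type*} [Fintype ι] {B : LinearMap.BilinForm ℝ (ι → ℝ)} {T : ℝ} {g g' : ℝ → ι → ℝ}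

/-- A bilinear form on a finite-dimensional space, as a map into the continuous dual. -/
noncomputable def formToDual (B : LinearMap.BilinForm ℝ (ι → ℝ)) :
    (ι → ℝ) →L[ℝ] (ι → ℝ) →L[ℝ] ℝ :=
  LinearMap.toContinuousLinearMap
    ((LinearMap.toContinuousLinearMap : ((ι → ℝ) →ₗ[ℝ] ℝ) ≃ₗ[ℝ] _).toLinearMap ∘ₗ B)

theorem continuous_form_self (B : LinearMap.BilinForm ℝ (ι → ℝ)) :
    Continuous fun x => B x x :=
  (formToDual B).continuous.clm_apply continuous_id

theorem intervalIntegrable_form (B : LinearMap.BilinForm ℝ (ι → ℝ)) (w : ι → ℝ) {a b : ℝ}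
    (h : IntervalIntegrable g' volume a b) :
    IntervalIntegrable (fun t => B w (g' t)) volume a b :=
  ⟨(formToDual B w).integrable_comp h.1, (formToDual B w).integrable_comp h.2⟩

theorem intervalIntegrable_sqrt_form (B : LinearMap.BilinForm ℝ (ι → ℝ)) {a b : ℝ}
    (h : IntervalIntegrable g' volume a b) :
    IntervalIntegrable (fun t => √(B (g' t) (g' t))) volume a b := by
  refine (h.norm.const_mul (√‖formToDual B‖)).mono_fun ?_ (Filter.Eventually.of_forall fun t => ?_)
  · exact (Real.continuous_sqrt.comp (continuous_form_self B)).comp_aestronglyMeasurable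
      (intervalIntegrable_iff.1 h).aestronglyMeasurable
  · beta_reduce
    rw [Real.norm_of_nonneg (Real.sqrt_nonneg _), Real.norm_of_nonneg (by positivity)]
    apply Real.sqrt_le_iff.2 ⟨by positivity, ?_⟩
    rw [mul_pow, Real.sq_sqrt (norm_nonneg (formToDual B))]
    calc B (g' t) (g' t) ≤ ‖formToDual B (g' t) (g' t)‖ := le_abs_self _
      _ ≤ ‖formToDual B‖ * ‖g' t‖ * ‖g' t‖ := (formToDual B).le_opNorm₂ _ _
      _ = _ := by ring

theorem HasACDeriv.mono_interval (h : HasACDeriv T g g') {a b : ℝ} (ha : a ∈ Icc 0 T)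
    (hb : b ∈ Icc 0 T) : IntervalIntegrable g' volume a b :=
  h.1.mono_set (by
    rw [uIcc_of_le (ha.1.trans ha.2)]
    exact uIcc_subset_Icc ha hb)

theorem HasACDeriv.sub_eq (h : HasACDeriv T g g') {a b : ℝ} (ha : a ∈ Icc 0 T)
    (hb : b ∈ Icc 0 T) : g b - g a = ∫ t in a..b, g' t := by
  have h0 : (0 : ℝ) ∈ Icc 0 T := ⟨le_rfl, ha.1.trans ha.2⟩
  rw [h.2 a ha, h.2 b hb, add_sub_add_left_eq_sub]
  exact intervalIntegral.integral_interval_sub_left (h.mono_interval h0 hb)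
    (h.mono_interval h0 ha)

theorem HasACDeriv.form_sub_eq (h : HasACDeriv T g g') (w : ι → ℝ) {a b : ℝ} (ha : a ∈ Icc 0 T)
    (hb : b ∈ Icc 0 T) : B w (g b - g a) = ∫ t in a..b, B w (g' t) := by
  rw [h.sub_eq ha hb]
  exact ((LinearMap.toContinuousLinearMap (B w)).intervalIntegral_comp_comm
    (h.mono_interval ha hb)).symm

theorem HasACDeriv.abs_form_sub_le (h : HasACDeriv T g g') (h0 : ∀ x, 0 ≤ B x x)
    (hB : ∀ x y, B x y = B y x) (w : ι → ℝ) {a b : ℝ} (ha : a ∈ Icc 0 T)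
    (hb : b ∈ Icc 0 T) (hab : a ≤ b) :
    |B w (g b - g a)| ≤ √(B w w) * ∫ t in a..b, √(B (g' t) (g' t)) := by
  rw [h.form_sub_eq w ha hb, ← intervalIntegral.integral_const_mul]
  refine (intervalIntegral.abs_integral_le_integral_abs hab).trans ?_
  have hi := h.mono_interval ha hb
  exact intervalIntegral.integral_mono_on hab (intervalIntegrable_form B w hi).abs
    ((intervalIntegrable_sqrt_form B hi).const_mul _) fun t _ => abs_form_le h0 hB w (g' t)

/-- Remainder of the first-order Taylor formula, with the derivative taken at any point `c`. The
remainder is paired with itself, which reduces the claim to the mean value inequality for a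
real-valued function. -/
theorem sqrt_form_taylor_le {g'' : ℝ → ι → ℝ}
    (hg : ∀ t ∈ Icc 0 T, HasDerivWithinAt g (g' t) (Icc 0 T) t)
    (h : HasACDeriv T g' g'') (h0 : ∀ x, 0 ≤ B x x)
    (hB : ∀ x y, B x y = B y x) {a b c : ℝ} (ha : a ∈ Icc 0 T)
    (hb : b ∈ Icc 0 T) (hc : c ∈ Icc a b) :
    √(B (g b - g a - (b - a) • g' c) (g b - g a - (b - a) • g' c))
      ≤ (b - a) * ∫ t in a..b, √(B (g'' t) (g'' t)) := by
  have hab : a ≤ b := hc.1.trans hc.2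
  have hI : 0 ≤ ∫ t in a..b, √(B (g'' t) (g'' t)) :=
    intervalIntegral.integral_nonneg hab fun t _ => Real.sqrt_nonneg _
  refine sqrt_form_le_of_abs_le h0 (mul_nonneg (sub_nonneg.2 hab) hI) ?_
  set w := g b - g a - (b - a) • g' c with hw
  have hsub : Icc a b ⊆ Icc 0 T := Icc_subset_Icc ha.1 hb.2
  have hder : ∀ t ∈ Icc a b, HasDerivWithinAt (fun t => B w (g t) - t * B w (g' c))
      (B w (g' t) - 1 * B w (g' c)) (Icc a b) t := by
    intro t ht
    have h1 : HasDerivWithinAt (fun t => B w (g t)) (B w (g' t)) (Icc a b) t :=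
      (LinearMap.toContinuousLinearMap (B w)).hasFDerivAt.comp_hasDerivWithinAt t
        ((hg t (hsub ht)).mono hsub)
    exact h1.sub ((hasDerivWithinAt_id t _).mul_const _)
  have hbd : ∀ t ∈ Icc a b, ‖B w (g' t) - 1 * B w (g' c)‖
      ≤ √(B w w) * ∫ t in a..b, √(B (g'' t) (g'' t)) := by
    intro t ht
    rw [one_mul, ← map_sub, Real.norm_eq_abs]
    have hmono : ∀ x ∈ Icc a b, ∀ y ∈ Icc a b, x ≤ y → ∫ t in x..y, √(B (g'' t) (g'' t))
        ≤ ∫ t in a..b, √(B (g'' t) (g'' t)) := fun x hx y hy hxy =>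
      intervalIntegral.integral_mono_interval hx.1 hxy hy.2
        (Filter.Eventually.of_forall fun t => Real.sqrt_nonneg _)
        (intervalIntegrable_sqrt_form B (h.mono_interval ha hb))
    rcases le_total c t with hct | hct
    · exact (h.abs_form_sub_le h0 hB w (hsub hc) (hsub ht) hct).trans
        (mul_le_mul_of_nonneg_left (hmono c hc t ht hct) (Real.sqrt_nonneg _))
    · rw [← neg_sub, map_neg, abs_neg]
      exact (h.abs_form_sub_le h0 hB w (hsub ht) (hsub hc) hct).trans
        (mul_le_mul_of_nonneg_left (hmono t ht c hc hct) (Real.sqrt_nonneg _))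
  have := (convex_Icc a b).norm_image_sub_le_of_norm_hasDerivWithin_le hder hbd
    (left_mem_Icc.2 hab) (right_mem_Icc.2 hab)
  rw [Real.norm_eq_abs, Real.norm_eq_abs, abs_of_nonneg (sub_nonneg.2 hab)] at this
  have he : B w w = B w (g b) - b * B w (g' c) - (B w (g a) - a * B w (g' c)) := by
    have h1 : B w w = B w (g b - g a - (b - a) • g' c) := rfl
    rw [h1]
    simp only [map_sub, map_smul, smul_eq_mul]
    ring
  rw [he]
  calc _ ≤ _ := this
    _ = _ := by rw [← he]; ring

theorem HasACDeriv.continuousOn (h : HasACDeriv T g g') (hT : 0 ≤ T) :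
    ContinuousOn g (Icc 0 T) := by
  have h1 := intervalIntegral.continuousOn_primitive_interval' h.1
    (a := 0) left_mem_uIcc
  rw [uIcc_of_le hT] at h1
  exact (continuousOn_const.add h1).congr fun t ht => h.2 t ht

theorem hasACDeriv_of_hasDerivWithinAt (hT : 0 ≤ T)
    (hg : ∀ t ∈ Icc 0 T, HasDerivWithinAt g (g' t) (Icc 0 T) t)
    (hc : ContinuousOn g' (Icc 0 T)) : HasACDeriv T g g' := by
  refine ⟨(by rwa [uIcc_of_le hT] : ContinuousOn g' (uIcc 0 T)).intervalIntegrable, ?_⟩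
  intro t ht
  have hsub : Icc 0 t ⊆ Icc 0 T := Icc_subset_Icc le_rfl ht.2
  rw [intervalIntegral.integral_eq_sub_of_hasDerivAt_of_le ht.1
    (fun x hx => ((hg x (hsub hx)).continuousWithinAt).mono hsub)
    (fun x hx => (hg x (hsub (Ioo_subset_Icc_self hx))).hasDerivAt
      (Icc_mem_nhds hx.1 (hx.2.trans_le ht.2)))
    ((hc.mono hsub).mono (by rw [uIcc_of_le ht.1])).intervalIntegrable]
  abel

/-- The Cauchy–Schwarz inequality in time for an increment, by Young's inequality under the
integral. -/
theorem HasACDeriv.form_sub_self_le (h : HasACDeriv T g g') (h0 : ∀ x, 0 ≤ B x x)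
    (hB : ∀ x y, B x y = B y x) (hc : ContinuousOn g' (Icc 0 T)) {a b : ℝ} (ha : a ∈ Icc 0 T)
    (hb : b ∈ Icc 0 T) (hab : a < b) :
    B (g b - g a) (g b - g a) ≤ (b - a) * ∫ t in a..b, B (g' t) (g' t) := by
  have hba : 0 < b - a := sub_pos.2 hab
  set w := g b - g a with hw
  have hi : IntervalIntegrable (fun t => B (g' t) (g' t)) volume a b :=
    ((continuous_form_self B).comp_continuousOn
      (hc.mono (uIcc_subset_Icc ha hb))).intervalIntegrable
  have h1 : B w w ≤ ∫ t in a..b, ((2 * (b - a))⁻¹ * B w w + (b - a) / 2 * B (g' t) (g' t)) := by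
    conv_lhs => rw [hw, h.form_sub_eq (B := B) _ ha hb, ← hw]
    refine intervalIntegral.integral_mono_on hab.le
      (intervalIntegrable_form B w (h.mono_interval ha hb))
      (intervalIntegrable_const.add (hi.const_mul _)) fun t _ => ?_
    have := form_le_young h0 hB (c := (2 * (b - a))⁻¹) (by positivity) w (g' t)
    calc _ ≤ _ := this
      _ = _ := by congr 2; field_simp; norm_num
  rw [intervalIntegral.integral_add intervalIntegrable_const (hi.const_mul _),
    intervalIntegral.integral_const, intervalIntegral.integral_const_mul, smul_eq_mul] at h1
  have h2 : (b - a) * ((2 * (b - a))⁻¹ * B w w) = 1 / 2 * B w w := by field_simp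
  linarith

end Time

/-! ### Affine functions on simplices -/

section Simplex

variable {d : ℕ} {s : Finset (Pt d)} {g : Pt d} {c : ℝ}

theorem abs_affine_le_of_vertices {M : ℝ} (h : ∀ x ∈ s, |c + inner ℝ g x| ≤ M) {y : Pt d}
    (hy : y ∈ convexHull ℝ (s : Set (Pt d))) : |c + inner ℝ g y| ≤ M := by
  have hconv : Convex ℝ {y : Pt d | |c + inner ℝ g y| ≤ M} := by
    intro x hx y hy p q hp hq hpq
    simp only [mem_ofPred_eq] at *
    have : c + inner ℝ g (p • x + q • y) = p * (c + inner ℝ g x) + q * (c + inner ℝ g y) := by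
      rw [inner_add_right, inner_smul_right, inner_smul_right]
      linear_combination (-c) * hpq
    rw [this]
    calc _ ≤ |p * (c + inner ℝ g x)| + |q * (c + inner ℝ g y)| := abs_add_le _ _
      _ = p * |c + inner ℝ g x| + q * |c + inner ℝ g y| := by
        rw [abs_mul, abs_mul, abs_of_nonneg hp, abs_of_nonneg hq]
      _ ≤ p * M + q * M := by gcongr
      _ = M := by rw [← add_mul, hpq, one_mul]
  exact convexHull_min (fun x hx => h x hx) hconv hy

theorem finrank_vectorSpan_of_card (hs : AffineIndependent ℝ ((↑) : s → Pt d)) {k : ℕ}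
    (hk : s.card = k + 1) : Module.finrank ℝ (vectorSpan ℝ (s : Set (Pt d))) = k := by
  have h := hs.finrank_vectorSpan (n := k) (by simpa using hk)
  rwa [show range ((↑) : s → Pt d) = (s : Set (Pt d)) from Subtype.range_coe] at h

theorem isCompact_simplex (s : Finset (Pt d)) : IsCompact (convexHull ℝ (s : Set (Pt d))) :=
  s.finite_toSet.isCompact_convexHull ℝ

theorem measurableSet_simplex (s : Finset (Pt d)) :
    MeasurableSet (convexHull ℝ (s : Set (Pt d))) :=
  (isCompact_simplex s).isClosed.measurableSet

theorem integrableOn_simplex {μ : Measure (Pt d)} (hμ : μ (convexHull ℝ (s : Set (Pt d))) ≠ ⊤)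
    {f : Pt d → ℝ} (hf : Continuous f) : IntegrableOn f (convexHull ℝ (s : Set (Pt d))) μ := by
  obtain ⟨C, hC⟩ := (isCompact_simplex s).exists_bound_of_continuousOn hf.continuousOn
  exact Measure.integrableOn_of_bounded (M := C) hμ hf.aestronglyMeasurable
    ((ae_restrict_iff' (measurableSet_simplex s)).2 (Filter.Eventually.of_forall hC))

/-- The square integral of an affine function over a `k`-simplex controls its vertex values: near
the vertex where it is largest, on a quarter-size copy of the simplex, the function is at least
half of its largest value. -/
theorem sq_vertex_mul_measure_le {k : ℕ}
    (hμ : Measure.euclideanHausdorffMeasure k (convexHull ℝ (s : Set (Pt d))) ≠ ⊤)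
    {z : Pt d} (hz : z ∈ s) :
    (1 / 4 : ℝ) ^ (k + 1) * (c + inner ℝ g z) ^ 2
      * (Measure.euclideanHausdorffMeasure k).real (convexHull ℝ (s : Set (Pt d)))
      ≤ ∫ y in convexHull ℝ (s : Set (Pt d)), (c + inner ℝ g y) ^ 2
          ∂(Measure.euclideanHausdorffMeasure k) := by
  set K := convexHull ℝ (s : Set (Pt d)) with hK
  set μ : Measure (Pt d) := Measure.euclideanHausdorffMeasure k with hμd
  obtain ⟨x, hx, hmax⟩ := s.exists_max_image (fun x => |c + inner ℝ g x|) ⟨z, hz⟩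
  set M := |c + inner ℝ g x| with hM
  have hxK : x ∈ K := subset_convexHull ℝ _ hx
  set K' := AffineMap.homothety x (1 / 4 : ℝ) '' K with hK'
  have hK'K : K' ⊆ K := by
    rintro _ ⟨y, hy, rfl⟩
    rw [AffineMap.homothety_eq_lineMap]
    exact (convex_convexHull ℝ _).lineMap_mem hxK hy ⟨by norm_num, by norm_num⟩
  have hmeas : MeasurableSet K' :=
    ((isCompact_simplex s).image (AffineMap.homothety_continuous x _)).isClosed.measurableSet
  have hvol : μ.real K' = (1 / 4 : ℝ) ^ k * μ.real K := by
    rw [Measure.real, hK', euclideanHausdorffMeasure_homothety_image k x (by norm_num)]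
    simp [Measure.real, hμd]
  have hint : IntegrableOn (fun y => (c + inner ℝ g y) ^ 2) K μ :=
    integrableOn_simplex hμ (by fun_prop)
  -- on the small copy the function is a mean with weight `3/4` on its largest value `M`
  have hlow : ∀ y ∈ K', (M / 2) ^ 2 ≤ (c + inner ℝ g y) ^ 2 := by
    rintro _ ⟨y, hy, rfl⟩
    have h1 : |c + inner ℝ g y| ≤ M := abs_affine_le_of_vertices hmax hy
    have h2 : c + inner ℝ g (AffineMap.homothety x (1 / 4 : ℝ) y)
        = 3 / 4 * (c + inner ℝ g x) + 1 / 4 * (c + inner ℝ g y) := by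
      rw [AffineMap.homothety_apply]
      simp only [vsub_eq_sub, vadd_eq_add, inner_add_right, inner_smul_right, inner_sub_right]
      ring
    rw [h2, sq_le_sq, abs_of_nonneg (by positivity)]
    calc M / 2 ≤ |3 / 4 * (c + inner ℝ g x)| - |1 / 4 * (c + inner ℝ g y)| := by
          rw [abs_mul, abs_mul, ← hM, abs_of_pos (by norm_num : (0 : ℝ) < 3 / 4),
            abs_of_pos (by norm_num : (0 : ℝ) < 1 / 4)]
          linarith
      _ ≤ _ := by
          have := abs_sub_abs_le_abs_sub (3 / 4 * (c + inner ℝ g x)) (-(1 / 4 * (c + inner ℝ g y)))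
          rwa [abs_neg, sub_neg_eq_add] at this
  have hzM : (c + inner ℝ g z) ^ 2 ≤ M ^ 2 := by
    rw [← sq_abs]; exact pow_le_pow_left₀ (abs_nonneg _) (hmax z hz) 2
  calc _ ≤ (1 / 4 : ℝ) ^ (k + 1) * M ^ 2 * μ.real K := by gcongr
    _ = (M / 2) ^ 2 * μ.real K' := by rw [hvol]; ring
    _ = ∫ _ in K', (M / 2) ^ 2 ∂μ := by rw [setIntegral_const, smul_eq_mul, mul_comm]
    _ ≤ ∫ y in K', (c + inner ℝ g y) ^ 2 ∂μ := by
        refine setIntegral_mono_on (integrableOn_const ?_) (hint.mono_set hK'K) hmeas hlow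
        exact ((measure_mono hK'K).trans_lt hμ.lt_top).ne
    _ ≤ _ := setIntegral_mono_set hint (Filter.Eventually.of_forall fun y => sq_nonneg _)
        hK'K.eventuallyLE

/-- The gradient of an affine function on a simplex containing a ball of radius `r`, from the
difference of its values at the two ends of the diameter in the direction of the gradient. -/
theorem norm_grad_mul_le {M r : ℝ} {x₀ : Pt d} (h : ∀ x ∈ s, |c + inner ℝ g x| ≤ M)
    (hr : 0 ≤ r) (hball : Metric.closedBall x₀ r ⊆ convexHull ℝ (s : Set (Pt d))) :
    ‖g‖ * r ≤ M := by
  have hM : 0 ≤ M := (abs_nonneg _).trans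
    (abs_affine_le_of_vertices h (hball (Metric.mem_closedBall_self hr)))
  rcases eq_or_ne g 0 with rfl | hg
  · simpa using hM
  have hg' : ‖g‖ ≠ 0 := norm_ne_zero_iff.2 hg
  set w : Pt d := (r * ‖g‖⁻¹) • g with hw
  have hwn : ‖w‖ = r := by
    rw [hw, norm_smul, Real.norm_of_nonneg (by positivity)]; field_simp
  have hin : inner ℝ g w = ‖g‖ * r := by
    rw [hw, inner_smul_right, real_inner_self_eq_norm_sq]; field_simp
  have h1 := abs_affine_le_of_vertices h (hball (show x₀ + w ∈ Metric.closedBall x₀ r by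
    simp [hwn]))
  have h2 := abs_affine_le_of_vertices h (hball (show x₀ - w ∈ Metric.closedBall x₀ r by
    simp [hwn]))
  rw [inner_add_right] at h1
  rw [inner_sub_right] at h2
  have := le_abs_self (c + (inner ℝ g x₀ + inner ℝ g w))
  have := neg_le_abs (c + (inner ℝ g x₀ - inner ℝ g w))
  linarith

/-- The intersection of a simplex containing a ball of radius `r` with the hyperplane through the
centre parallel to a facet is a scaled-down copy of the facet. Hence the facet contains a disc of
the same radius. -/
theorem exists_disc_subset_facet {E F : Finset (Pt d)} (hE : AffineIndependent ℝ ((↑) : E → Pt d))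
    (hFE : F ⊆ E) (hFne : F.Nonempty) (hcard : E.card = F.card + 1) {x₀ : Pt d} {r : ℝ}
    (hr : 0 ≤ r) (hball : Metric.closedBall x₀ r ⊆ convexHull ℝ (E : Set (Pt d))) :
    ∃ p : Pt d, ∀ w ∈ vectorSpan ℝ (F : Set (Pt d)), ‖w‖ ≤ r →
      p + w ∈ convexHull ℝ (F : Set (Pt d)) := by
  classical
  obtain ⟨a, ha⟩ : ∃ a, E \ F = {a} := Finset.card_eq_one.1 (by
    rw [Finset.card_sdiff_of_subset hFE]; omega)
  have haE : a ∈ E := (Finset.mem_sdiff.1 (ha ▸ Finset.mem_singleton_self a)).1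
  have haF : a ∉ F := (Finset.mem_sdiff.1 (ha ▸ Finset.mem_singleton_self a)).2
  have hins : (E : Set (Pt d)) = insert a (F : Set (Pt d)) := by
    rw [← Finset.coe_insert, Finset.insert_eq, ← ha, Finset.sdiff_union_of_subset hFE]
  have hg := (nodalGrad_spec hE haE).2
  -- `n` is normal to the facet; `inner ℝ n (a - y)` measures how far `y` lies below the apex
  -- `a`, as a fraction of the height of the simplex
  set n := nodalGrad E a with hn
  have hgF : ∀ y ∈ F, inner ℝ n (a - y) = 1 := fun y hy =>
    hg y (hFE hy) fun h => haF (h ▸ hy)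
  have hgF' : ∀ y ∈ convexHull ℝ (F : Set (Pt d)), inner ℝ n (a - y) = 1 := by
    intro y hy
    have := abs_affine_le_of_vertices (s := F) (g := -n) (c := inner ℝ n a - 1) (M := 0)
      (fun x hx => by
        have := hgF x hx
        rw [inner_sub_right] at this
        rw [inner_neg_left, ← sub_eq_add_neg, sub_right_comm, this]; simp) hy
    have h0 := abs_nonpos_iff.1 this
    rw [inner_neg_left] at h0
    rw [inner_sub_right]; linarith
  have hperp : ∀ w ∈ vectorSpan ℝ (F : Set (Pt d)), inner ℝ n w = 0 := by
    intro w hw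
    rw [vectorSpan_def] at hw
    induction hw using Submodule.span_induction with
    | mem v hv =>
      obtain ⟨y, hy, y', hy', rfl⟩ := hv
      have e1 := hgF y hy
      have e2 := hgF y' hy'
      rw [inner_sub_right] at e1 e2
      simp only [vsub_eq_sub, inner_sub_right]
      linarith
    | zero => simp
    | add v w _ _ hv hw => rw [inner_add_right, hv, hw, add_zero]
    | smul c v _ hv => rw [inner_smul_right, hv, mul_zero]
  have hdec : ∀ y ∈ convexHull ℝ (E : Set (Pt d)), ∃ f ∈ convexHull ℝ (F : Set (Pt d)),
      ∃ t : ℝ, 0 ≤ t ∧ t ≤ 1 ∧ y = a + t • (f - a) ∧ inner ℝ n (a - y) = t := by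
    intro y hy
    rw [hins, convexHull_insert (by simpa using hFne), mem_convexJoin] at hy
    obtain ⟨a', ha', f, hf, hy⟩ := hy
    rw [mem_singleton_iff] at ha'
    subst ha'
    rw [segment_eq_image'] at hy
    obtain ⟨t, ht, rfl⟩ := hy
    refine ⟨f, hf, t, ht.1, ht.2, rfl, ?_⟩
    have : a' - (a' + t • (f - a')) = t • (a' - f) := by
      rw [← neg_sub a' f, smul_neg]; abel
    rw [this, inner_smul_right, hgF' f hf, mul_one]
  obtain ⟨f, hf, t, ht0, ht1, hx₀, htn⟩ := hdec x₀ (hball (Metric.mem_closedBall_self hr))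
  refine ⟨f, fun w hw hwr => ?_⟩
  have key : ∀ v ∈ vectorSpan ℝ (F : Set (Pt d)), ‖v‖ ≤ r →
      ∃ f' ∈ convexHull ℝ (F : Set (Pt d)), v = t • (f' - f) := by
    intro v hv hvr
    obtain ⟨f', hf', t', -, -, hy, htn'⟩ := hdec (x₀ + v) (hball (by simpa using hvr))
    have : t' = t := by
      rw [← htn', ← htn, ← sub_sub, inner_sub_right, hperp v hv, sub_zero]
    subst this
    refine ⟨f', hf', ?_⟩
    have : v = a + t' • (f' - a) - x₀ := by rw [← hy]; abel
    rw [this, hx₀]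
    module
  -- if the centre were the apex itself, the section would be a point and `w` zero
  rcases eq_or_lt_of_le ht0 with h0 | hpos
  · obtain ⟨f', -, h⟩ := key w hw hwr
    rw [← h0, zero_smul] at h
    rwa [h, add_zero]
  · obtain ⟨f', hf', h⟩ := key (t • w) (Submodule.smul_mem _ _ hw) (by
      rw [norm_smul, Real.norm_of_nonneg ht0]
      calc t * ‖w‖ ≤ 1 * ‖w‖ := by gcongr
        _ ≤ r := by rwa [one_mul])
    have : w = f' - f := smul_right_injective _ hpos.ne' h
    rw [this]
    simpa using hf'

/-- A disc of radius `r` in a `k`-dimensional plane, as an isometric image of a ball in `ℝ^k`. -/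
theorem euclideanHausdorffMeasure_disc {k : ℕ} (W : Submodule ℝ (Pt d))
    (hW : Module.finrank ℝ W = k) (p : Pt d) {r : ℝ} (hr : 0 ≤ r) :
    Measure.euclideanHausdorffMeasure k {y : Pt d | ∃ w ∈ W, ‖w‖ ≤ r ∧ y = p + w}
      = ENNReal.ofReal (r ^ k) * volume (Metric.ball (0 : EuclideanSpace ℝ (Fin k)) 1) := by
  subst hW
  set e := (stdOrthonormalBasis ℝ W).repr with he
  set f : EuclideanSpace ℝ (Fin (Module.finrank ℝ W)) → Pt d := fun v => p + (e.symm v : Pt d)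
    with hf
  have hiso : Isometry f := Isometry.of_dist_eq fun x y => by
    simp only [hf, dist_add_left]
    exact (Subtype.dist_eq _ _).symm.trans (e.symm.dist_map x y)
  have himg : {y : Pt d | ∃ w ∈ W, ‖w‖ ≤ r ∧ y = p + w} = f '' Metric.closedBall 0 r := by
    ext y
    constructor
    · rintro ⟨w, hw, hwr, rfl⟩
      refine ⟨e ⟨w, hw⟩, ?_, by simp [hf]⟩
      simpa using hwr
    · rintro ⟨v, hv, rfl⟩
      refine ⟨e.symm v, (e.symm v).2, ?_, rfl⟩
      rw [show ‖((e.symm v : W) : Pt d)‖ = ‖e.symm v‖ from rfl, e.symm.norm_map]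
      simpa using hv
  rw [himg, hiso.euclideanHausdorffMeasure_image,
    EuclideanSpace.euclideanHausdorffMeasure_eq_volume, Measure.addHaar_closedBall _ _ hr]
  simp

theorem euclideanHausdorffMeasure_simplex_ne_top {k : ℕ}
    (hk : Module.finrank ℝ (vectorSpan ℝ (s : Set (Pt d))) = k) :
    Measure.euclideanHausdorffMeasure k (convexHull ℝ (s : Set (Pt d))) ≠ ⊤ := by
  rcases s.eq_empty_or_nonempty with rfl | ⟨p, hp⟩
  · simp
  obtain ⟨R, hR⟩ := (isCompact_simplex s).isBounded.subset_closedBall p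
  have hp' : p ∈ convexHull ℝ (s : Set (Pt d)) := subset_convexHull ℝ _ hp
  have hR0 : 0 ≤ R := by simpa using hR hp'
  have hsub : convexHull ℝ (s : Set (Pt d)) ⊆
      {y : Pt d | ∃ w ∈ vectorSpan ℝ (s : Set (Pt d)), ‖w‖ ≤ R ∧ y = p + w} := by
    intro y hy
    refine ⟨y - p, ?_, by simpa [dist_eq_norm] using hR hy, by abel⟩
    rw [← direction_affineSpan]
    exact AffineSubspace.vsub_mem_direction (convexHull_subset_affineSpan _ hy)
      (subset_affineSpan ℝ _ hp)
  refine ((measure_mono hsub).trans_lt ?_).ne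
  rw [euclideanHausdorffMeasure_disc _ hk p hR0]
  exact ENNReal.mul_lt_top ENNReal.ofReal_lt_top measure_ball_lt_top

/-- The volume of the unit ball of `ℝ^k`. -/
noncomputable def unitBallVolume (k : ℕ) : ℝ :=
  (volume : Measure (EuclideanSpace ℝ (Fin k))).real (Metric.ball 0 1)

theorem unitBallVolume_pos (k : ℕ) : 0 < unitBallVolume k :=
  ENNReal.toReal_pos (Metric.measure_ball_pos _ _ one_pos).ne' measure_ball_lt_top.ne

/-- Lower bound for the area of a facet of a simplex containing a ball of radius `r`. -/
theorem le_measure_facet {E F : Finset (Pt d)} (hE : AffineIndependent ℝ ((↑) : E → Pt d))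
    (hFE : F ⊆ E) {k : ℕ} (hF : F.card = k + 1) (hcard : E.card = k + 2) {x₀ : Pt d} {r : ℝ}
    (hr : 0 ≤ r) (hball : Metric.closedBall x₀ r ⊆ convexHull ℝ (E : Set (Pt d))) :
    r ^ k * unitBallVolume k
      ≤ (Measure.euclideanHausdorffMeasure k).real (convexHull ℝ (F : Set (Pt d))) := by
  have hFi : AffineIndependent ℝ ((↑) : F → Pt d) := hE.mono hFE
  have hdim := finrank_vectorSpan_of_card hFi hF
  obtain ⟨p, hp⟩ := exists_disc_subset_facet hE hFE (Finset.card_pos.1 (by omega))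
    (by omega) hr hball
  have h1 := euclideanHausdorffMeasure_disc (vectorSpan ℝ (F : Set (Pt d))) hdim p hr
  have h2 : (Measure.euclideanHausdorffMeasure k).real
      {y : Pt d | ∃ w ∈ vectorSpan ℝ (F : Set (Pt d)), ‖w‖ ≤ r ∧ y = p + w}
      = r ^ k * unitBallVolume k := by
    rw [Measure.real, h1, ENNReal.toReal_mul, ENNReal.toReal_ofReal (by positivity)]; rfl
  rw [← h2]
  refine measureReal_mono ?_ (euclideanHausdorffMeasure_simplex_ne_top hdim)
  rintro y ⟨w, hw, hwr, rfl⟩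
  exact hp w hw hwr

theorem le_diam_facet {E F : Finset (Pt d)} (hE : AffineIndependent ℝ ((↑) : E → Pt d))
    (hFE : F ⊆ E) {k : ℕ} (hk : 1 ≤ k) (hF : F.card = k + 1) (hcard : E.card = k + 2)
    {x₀ : Pt d} {r : ℝ} (hr : 0 ≤ r)
    (hball : Metric.closedBall x₀ r ⊆ convexHull ℝ (E : Set (Pt d))) :
    r ≤ Metric.diam (convexHull ℝ (F : Set (Pt d))) := by
  have hFi : AffineIndependent ℝ ((↑) : F → Pt d) := hE.mono hFE
  have hdim := finrank_vectorSpan_of_card hFi hF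
  obtain ⟨p, hp⟩ := exists_disc_subset_facet hE hFE (Finset.card_pos.1 (by omega))
    (by omega) hr hball
  have : Nontrivial (vectorSpan ℝ (F : Set (Pt d))) :=
    Module.nontrivial_of_finrank_pos (R := ℝ) (by omega)
  obtain ⟨w, hw⟩ := exists_norm_eq (vectorSpan ℝ (F : Set (Pt d))) hr
  have h1 := hp w w.2 (by rw [← Submodule.coe_norm, hw])
  have h0 := hp 0 (Submodule.zero_mem _) (by simpa using hr)
  have := Metric.dist_le_diam_of_mem (isCompact_simplex F).isBounded h1 h0
  rw [dist_add_left, dist_zero_right, ← Submodule.coe_norm, hw] at this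
  exact this

/-- A nondegenerate `d`-simplex contains a ball. -/
theorem exists_closedBall_subset {E : Finset (Pt d)} (hE : AffineIndependent ℝ ((↑) : E → Pt d))
    (hcard : E.card = d + 1) :
    ∃ (x₀ : Pt d) (r : ℝ), 0 < r ∧ Metric.closedBall x₀ r ⊆ convexHull ℝ (E : Set (Pt d)) := by
  have htop : affineSpan ℝ (E : Set (Pt d)) = ⊤ := by
    have := hE.affineSpan_eq_top_iff_card_eq_finrank_add_one.2 (by simpa using hcard)
    simpa using this
  obtain ⟨x₀, hx₀⟩ := interior_convexHull_nonempty_iff_affineSpan_eq_top.2 htop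
  obtain ⟨r, hr, h⟩ := Metric.nhds_basis_closedBall.mem_iff.1 (mem_interior_iff_mem_nhds.1 hx₀)
  exact ⟨x₀, r, hr, h⟩

end Simplex

/-! ### Finite element matrices -/

section Interpolation

variable {d : ℕ} {J : Type*} [Fintype J]

/-- The restriction, to the simplex with vertex set `s`, of the finite element function with
nodal values `v` at the nodes `pos`. -/
noncomputable def interp (s : Finset (Pt d)) (pos : J → Pt d) (v : J → ℝ) (y : Pt d) : ℝ :=
  ∑ j, v j * nodalFun s (pos j) y

/-- The (tangential) gradient of the finite element function with nodal values `v`. -/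
noncomputable def interpGrad (s : Finset (Pt d)) (pos : J → Pt d) (v : J → ℝ) : Pt d :=
  ∑ j, v j • nodalGrad s (pos j)

theorem nodalFun_eq_affine (s : Finset (Pt d)) (x y : Pt d) :
    nodalFun s x y = nodalFun s x 0 + inner ℝ (nodalGrad s x) y := by
  by_cases hx : x ∈ s
  · simp only [nodalFun, if_pos hx, inner_sub_right, inner_zero_right]; ring
  · have : nodalGrad s x = 0 := dif_neg fun h => hx h.1
    simp [nodalFun, if_neg hx, this]

theorem interp_eq_affine (s : Finset (Pt d)) (pos : J → Pt d) (v : J → ℝ) (y : Pt d) :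
    interp s pos v y = interp s pos v 0 + inner ℝ (interpGrad s pos v) y := by
  simp only [interp, interpGrad, sum_inner, inner_smul_left, ← Finset.sum_add_distrib]
  refine Finset.sum_congr rfl fun j _ => ?_
  rw [nodalFun_eq_affine s (pos j) y]
  simp only [conj_trivial]
  ring

theorem continuous_nodalFun (s : Finset (Pt d)) (x : Pt d) : Continuous (nodalFun s x) := by
  rw [show nodalFun s x = fun y => nodalFun s x 0 + inner ℝ (nodalGrad s x) y from
    funext (nodalFun_eq_affine s x)]
  fun_prop

theorem continuous_interp (s : Finset (Pt d)) (pos : J → Pt d) (v : J → ℝ) :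
    Continuous (interp s pos v) :=
  continuous_finsetSum _ fun j _ => continuous_const.mul (continuous_nodalFun s (pos j))

theorem interp_pos {s : Finset (Pt d)} (hs : AffineIndependent ℝ ((↑) : s → Pt d))
    {pos : J → Pt d} (hpos : Function.Injective pos) (v : J → ℝ) {i : J} (hi : pos i ∈ s) :
    interp s pos v (pos i) = v i := by
  classical
  rw [interp, Finset.sum_eq_single i]
  · rw [nodalFun_vertex hs _ hi, if_pos rfl, mul_one]
  · intro j _ hj
    rw [nodalFun_vertex hs _ hi, if_neg fun h => hj (hpos h.symm), mul_zero]
  · simp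

theorem interp_vertex_of_ne {s : Finset (Pt d)} (hs : AffineIndependent ℝ ((↑) : s → Pt d))
    {pos : J → Pt d} (v : J → ℝ) {y : Pt d} (hy : y ∈ s) (h : ∀ i, pos i ≠ y) :
    interp s pos v y = 0 :=
  Finset.sum_eq_zero fun j _ => by
    rw [nodalFun_vertex hs _ hy, if_neg fun e => h j e.symm, mul_zero]

/-- The matrix with entries `∫ α φ_j φ_i + κ ∇φ_j · ∇φ_i dμ` on a finite set `S` of simplices. All
mass and stiffness matrices, in the bulk and on the surface, are of this form. -/
noncomputable def energyMatrix (S : Finset (Finset (Pt d))) (μ : Measure (Pt d)) (α : ℝ)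
    (κ : Pt d → ℝ) (pos : J → Pt d) : Matrix J J ℝ :=
  Matrix.of fun i j => ∑ E ∈ S, ∫ y in convexHull ℝ (E : Set (Pt d)),
    (α * (nodalFun E (pos j) y * nodalFun E (pos i) y) +
      κ y * inner ℝ (nodalGrad E (pos j)) (nodalGrad E (pos i))) ∂μ

variable {S : Finset (Finset (Pt d))} {μ : Measure (Pt d)} {α : ℝ} {κ : Pt d → ℝ}
  {pos : J → Pt d}

omit [Fintype J] in
theorem energyMatrix_transpose : (energyMatrix S μ α κ pos)ᵀ = energyMatrix S μ α κ pos := by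
  ext i j
  simp only [energyMatrix, Matrix.transpose_apply, Matrix.of_apply]
  refine Finset.sum_congr rfl fun E _ => ?_
  congr 1
  ext y
  rw [real_inner_comm, mul_comm (nodalFun E (pos i) y)]

theorem normSq_energyMatrix (hμ : ∀ E ∈ S, μ (convexHull ℝ (E : Set (Pt d))) ≠ ⊤)
    (hκ : ∀ E ∈ S, IntegrableOn κ (convexHull ℝ (E : Set (Pt d))) μ) (v : J → ℝ) :
    normSq (energyMatrix S μ α κ pos) v = ∑ E ∈ S, ∫ y in convexHull ℝ (E : Set (Pt d)),
      (α * interp E pos v y ^ 2 + κ y * ‖interpGrad E pos v‖ ^ 2) ∂μ := by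
  have hint : ∀ E ∈ S, ∀ i j, Integrable (fun y => v i * v j *
      (α * (nodalFun E (pos j) y * nodalFun E (pos i) y) +
      κ y * inner ℝ (nodalGrad E (pos j)) (nodalGrad E (pos i))))
      (μ.restrict (convexHull ℝ (E : Set (Pt d)))) := by
    intro E hE i j
    refine Integrable.const_mul (Integrable.add ?_ ((hκ E hE).mul_const _)) _
    exact integrableOn_simplex (hμ E hE) (continuous_const.mul
      ((continuous_nodalFun E _).mul (continuous_nodalFun E _)))
  have h1 : normSq (energyMatrix S μ α κ pos) v = ∑ E ∈ S, ∑ i, ∑ j,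
      ∫ y in convexHull ℝ (E : Set (Pt d)), v i * v j *
      (α * (nodalFun E (pos j) y * nodalFun E (pos i) y) +
      κ y * inner ℝ (nodalGrad E (pos j)) (nodalGrad E (pos i))) ∂μ := by
    simp only [normSq, dotProduct, Matrix.mulVec, energyMatrix, Matrix.of_apply,
      integral_const_mul, Finset.mul_sum, Finset.sum_mul]
    symm
    rw [Finset.sum_comm]
    refine Finset.sum_congr rfl fun i _ => ?_
    rw [Finset.sum_comm]
    exact Finset.sum_congr rfl fun j _ => Finset.sum_congr rfl fun E _ => by ring
  rw [h1]
  refine Finset.sum_congr rfl fun E hE => ?_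
  have h2 : ∀ i, ∑ j, ∫ y in convexHull ℝ (E : Set (Pt d)), v i * v j *
      (α * (nodalFun E (pos j) y * nodalFun E (pos i) y) +
      κ y * inner ℝ (nodalGrad E (pos j)) (nodalGrad E (pos i))) ∂μ
      = ∫ y in convexHull ℝ (E : Set (Pt d)), ∑ j, v i * v j *
      (α * (nodalFun E (pos j) y * nodalFun E (pos i) y) +
      κ y * inner ℝ (nodalGrad E (pos j)) (nodalGrad E (pos i))) ∂μ := fun i =>
    (integral_finsetSum _ fun j _ => hint E hE i j).symm
  simp only [h2]
  rw [← integral_finsetSum _ fun i _ => integrable_finsetSum _ fun j _ => hint E hE i j]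
  congr 1
  ext y
  rw [← real_inner_self_eq_norm_sq]
  simp only [interp, interpGrad, sq, Finset.sum_mul, sum_inner, inner_sum, inner_smul_left,
    inner_smul_right, Finset.mul_sum, ← Finset.sum_add_distrib, conj_trivial]
  refine Finset.sum_congr rfl fun i _ => Finset.sum_congr rfl fun j _ => ?_
  rw [real_inner_comm]
  ring

theorem normSq_energyMatrix_nonneg (hμ : ∀ E ∈ S, μ (convexHull ℝ (E : Set (Pt d))) ≠ ⊤)
    (hκ : ∀ E ∈ S, IntegrableOn κ (convexHull ℝ (E : Set (Pt d))) μ) (hα : 0 ≤ α)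
    (hκ0 : ∀ E ∈ S, ∀ᵐ y ∂μ.restrict (convexHull ℝ (E : Set (Pt d))), 0 ≤ κ y) (v : J → ℝ) :
    0 ≤ normSq (energyMatrix S μ α κ pos) v := by
  rw [normSq_energyMatrix hμ hκ]
  refine Finset.sum_nonneg fun E hE => integral_nonneg_of_ae ?_
  filter_upwards [hκ0 E hE] with y hy
  simp only [Pi.zero_apply]
  positivity

theorem normSq_mass (hμ : ∀ E ∈ S, μ (convexHull ℝ (E : Set (Pt d))) ≠ ⊤) (v : J → ℝ) :
    normSq (energyMatrix S μ 1 0 pos) v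
      = ∑ E ∈ S, ∫ y in convexHull ℝ (E : Set (Pt d)), interp E pos v y ^ 2 ∂μ := by
  rw [normSq_energyMatrix (κ := 0) hμ fun E _ => integrableOn_zero]
  simp

/-- Lower bound for the mass on a `k`-simplex by the values of the finite element function at the
vertices. -/
theorem interp_sq_mul_measure_le {s : Finset (Pt d)} {k : ℕ}
    (hμ : Measure.euclideanHausdorffMeasure k (convexHull ℝ (s : Set (Pt d))) ≠ ⊤) (v : J → ℝ)
    {z : Pt d} (hz : z ∈ s) :
    (1 / 4 : ℝ) ^ (k + 1) * interp s pos v z ^ 2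
      * (Measure.euclideanHausdorffMeasure k).real (convexHull ℝ (s : Set (Pt d)))
      ≤ ∫ y in convexHull ℝ (s : Set (Pt d)), interp s pos v y ^ 2
          ∂(Measure.euclideanHausdorffMeasure k) := by
  have h := sq_vertex_mul_measure_le (c := interp s pos v 0) (g := interpGrad s pos v) hμ hz
  simp only [← interp_eq_affine] at h
  exact h

end Interpolation

namespace Triangulation

variable {d : ℕ} (𝒯 : Triangulation d)

theorem mem_elements {E : Finset (Pt d)} :
    E ∈ 𝒯.elements ↔ E ∈ 𝒯.complex.faces ∧ E.card = d + 1 := by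
  simp [elements]

theorem mem_boundaryFacets {F : Finset (Pt d)} :
    F ∈ 𝒯.boundaryFacets ↔ F ∈ 𝒯.complex.faces ∧ F.card = d ∧
      convexHull ℝ (F : Set (Pt d)) ⊆ frontier 𝒯.domain := by
  simp [boundaryFacets]

theorem exists_element_of_boundaryFacet {F : Finset (Pt d)} (hF : F ∈ 𝒯.boundaryFacets) :
    ∃ E ∈ 𝒯.elements, F ⊆ E := by
  obtain ⟨E, hE, hFE, hc⟩ := 𝒯.pure F (𝒯.mem_boundaryFacets.1 hF).1
  exact ⟨E, 𝒯.mem_elements.2 ⟨hE, hc⟩, hFE⟩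

theorem elements_nonempty : 𝒯.elements.Nonempty := by
  obtain ⟨s, hs⟩ := 𝒯.nonempty
  obtain ⟨t, ht, -, hc⟩ := 𝒯.pure s hs
  exact ⟨t, 𝒯.mem_elements.2 ⟨ht, hc⟩⟩

theorem indep_element {E : Finset (Pt d)} (hE : E ∈ 𝒯.elements) :
    AffineIndependent ℝ ((↑) : E → Pt d) := 𝒯.complex.indep (𝒯.mem_elements.1 hE).1

theorem indep_facet {F : Finset (Pt d)} (hF : F ∈ 𝒯.boundaryFacets) :
    AffineIndependent ℝ ((↑) : F → Pt d) := 𝒯.complex.indep (𝒯.mem_boundaryFacets.1 hF).1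

theorem diam_element_le {E : Finset (Pt d)} (hE : E ∈ 𝒯.elements) :
    Metric.diam (convexHull ℝ (E : Set (Pt d))) ≤ 𝒯.meshWidth :=
  le_csSup (𝒯.elements.finite_toSet.image _).bddAbove (mem_image_of_mem _ hE)

theorem diam_facet_le {F : Finset (Pt d)} (hF : F ∈ 𝒯.boundaryFacets) :
    Metric.diam (convexHull ℝ (F : Set (Pt d))) ≤ 𝒯.surfaceMeshWidth :=
  le_csSup (𝒯.boundaryFacets.finite_toSet.image _).bddAbove (mem_image_of_mem _ hF)

theorem meshWidth_nonneg : 0 ≤ 𝒯.meshWidth := by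
  obtain ⟨E, hE⟩ := 𝒯.elements_nonempty
  exact Metric.diam_nonneg.trans (𝒯.diam_element_le hE)

theorem surfaceMeshWidth_le : 𝒯.surfaceMeshWidth ≤ 𝒯.meshWidth := by
  refine Real.sSup_le ?_ 𝒯.meshWidth_nonneg
  rintro _ ⟨F, hF, rfl⟩
  obtain ⟨E, hE, hFE⟩ := 𝒯.exists_element_of_boundaryFacet hF
  exact (Metric.diam_mono (convexHull_mono (by exact_mod_cast hFE))
    (isCompact_simplex E).isBounded).trans (𝒯.diam_element_le hE)

theorem meshWidth_pos (hd : 1 ≤ d) : 0 < 𝒯.meshWidth := by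
  obtain ⟨E, hE⟩ := 𝒯.elements_nonempty
  obtain ⟨x, hx, y, hy, hxy⟩ := Finset.one_lt_card.1
    (show 1 < E.card by rw [(𝒯.mem_elements.1 hE).2]; omega)
  have := Metric.dist_le_diam_of_mem (isCompact_simplex E).isBounded
    (subset_convexHull ℝ _ hx) (subset_convexHull ℝ _ hy)
  exact (dist_pos.2 hxy).trans_le (this.trans (𝒯.diam_element_le hE))

theorem volume_element_ne_top (E : Finset (Pt d)) :
    (volume : Measure (Pt d)) (convexHull ℝ (E : Set (Pt d))) ≠ ⊤ :=
  (isCompact_simplex E).measure_lt_top.ne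

theorem measure_facet_ne_top (hd : 1 ≤ d) {F : Finset (Pt d)} (hF : F ∈ 𝒯.boundaryFacets) :
    Measure.euclideanHausdorffMeasure (d - 1) (convexHull ℝ (F : Set (Pt d))) ≠ ⊤ :=
  euclideanHausdorffMeasure_simplex_ne_top (finrank_vectorSpan_of_card (𝒯.indep_facet hF)
    (by rw [(𝒯.mem_boundaryFacets.1 hF).2.1]; omega))

theorem bulkMass_eq : 𝒯.bulkMass = energyMatrix 𝒯.elements volume 1 0 𝒯.pos := by
  ext i j; simp [bulkMass, energyMatrix]

theorem bulkMass_toBlocks₂₂ : 𝒯.bulkMass.toBlocks₂₂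
    = energyMatrix 𝒯.elements volume 1 0 ((↑) : 𝒯.BdNode → Pt d) := by
  rw [bulkMass_eq]; rfl

theorem bulkStiff_toBlocks₂₂ (κ : Pt d → ℝ) (αΩ : ℝ) : (𝒯.bulkStiff κ αΩ).toBlocks₂₂
    = energyMatrix 𝒯.elements volume αΩ κ ((↑) : 𝒯.BdNode → Pt d) := rfl

theorem surfaceMass_eq : 𝒯.surfaceMass = energyMatrix 𝒯.boundaryFacets
    (Measure.euclideanHausdorffMeasure (d - 1)) 1 0 ((↑) : 𝒯.BdNode → Pt d) := by
  ext i j; simp [surfaceMass, surfaceMassForm, energyMatrix]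

theorem surfaceStiff_eq (αΓ β : ℝ) : 𝒯.surfaceStiff αΓ β = energyMatrix 𝒯.boundaryFacets
    (Measure.euclideanHausdorffMeasure (d - 1)) αΓ (fun _ => β) ((↑) : 𝒯.BdNode → Pt d) := rfl

theorem exists_facet_of_boundaryNode (x : 𝒯.BdNode) : ∃ F ∈ 𝒯.boundaryFacets, (x : Pt d) ∈ F := by
  have := x.2
  simpa [boundaryNodes] using this

/-- The surface mass matrix is positive definite, as every surface node is a vertex of a boundary
facet of positive area. -/
theorem eq_zero_of_normSq_surfaceMass (hd : 1 ≤ d) {v : 𝒯.BdNode → ℝ}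
    (h : normSq 𝒯.surfaceMass v = 0) : v = 0 := by
  funext x
  obtain ⟨F, hF, hxF⟩ := 𝒯.exists_facet_of_boundaryNode x
  rw [surfaceMass_eq, normSq_mass fun F hF => 𝒯.measure_facet_ne_top hd hF,
    Finset.sum_eq_zero_iff_of_nonneg fun F _ => integral_nonneg fun y => sq_nonneg _] at h
  have h1 := interp_sq_mul_measure_le (pos := ((↑) : 𝒯.BdNode → Pt d))
    (𝒯.measure_facet_ne_top hd hF) v hxF
  rw [h F hF, interp_pos (𝒯.indep_facet hF) Subtype.val_injective v hxF] at h1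
  obtain ⟨E, hE, hFE⟩ := 𝒯.exists_element_of_boundaryFacet hF
  obtain ⟨x₀, r, hr, hball⟩ := exists_closedBall_subset (𝒯.indep_element hE)
    (𝒯.mem_elements.1 hE).2
  have h2 := le_measure_facet (𝒯.indep_element hE) hFE (k := d - 1)
    (by rw [(𝒯.mem_boundaryFacets.1 hF).2.1]; omega) (by rw [(𝒯.mem_elements.1 hE).2]; omega)
    hr.le hball
  have h3 : 0 < r ^ (d - 1) * unitBallVolume (d - 1) :=
    mul_pos (pow_pos hr _) (unitBallVolume_pos _)
  by_contra hv
  have : 0 < v x ^ 2 := sq_pos_of_ne_zero hv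
  have : 0 < (1 / 4 : ℝ) ^ (d - 1 + 1) * v x ^ 2 := by positivity
  exact absurd h1 (not_le.2 (mul_pos this (h3.trans_le h2)))

end Triangulation

section Diffusion

variable {d : ℕ} {𝒯 : Triangulation d} {κmin κmax : ℝ} {κ : Pt d → ℝ}

theorem IsDiffusion.ae_element (h : IsDiffusion 𝒯 κmin κmax κ) {E : Finset (Pt d)}
    (hE : E ∈ 𝒯.elements) :
    ∀ᵐ x ∂(volume.restrict (convexHull ℝ (E : Set (Pt d)))), κmin ≤ κ x ∧ κ x ≤ κmax :=
  ae_restrict_of_ae_restrict_of_subset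
    (𝒯.complex.convexHull_subset_space (𝒯.mem_elements.1 hE).1) h.2

theorem IsDiffusion.integrableOn (h : IsDiffusion 𝒯 κmin κmax κ) {E : Finset (Pt d)}
    (hE : E ∈ 𝒯.elements) : IntegrableOn κ (convexHull ℝ (E : Set (Pt d))) volume := by
  refine IntegrableOn.of_bound (Triangulation.volume_element_ne_top E).lt_top
    (AEStronglyMeasurable.mono_measure h.1 (Measure.restrict_mono
      (𝒯.complex.convexHull_subset_space (𝒯.mem_elements.1 hE).1) le_rfl))
    (max |κmin| |κmax|) ?_
  filter_upwards [h.ae_element hE] with x hx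
  exact abs_le_max_abs_abs hx.1 hx.2

end Diffusion

/-! ### The boundary estimate and the inverse estimate -/

section Constants

variable {d : ℕ} {𝒯 : Triangulation d} {ϱ : ℝ}

/-- If all elements are comparable to the mesh width, each of them contains a ball whose radius is
a fixed multiple of the mesh width. Since the inradius is a supremum, half of it is used. -/
theorem Triangulation.HasComparableElements.exists_closedBall (h : 𝒯.HasComparableElements ϱ)
    (hd : 1 ≤ d) (hϱ : 0 < ϱ) {E : Finset (Pt d)} (hE : E ∈ 𝒯.elements) :
    ∃ x₀ : Pt d, Metric.closedBall x₀ (𝒯.meshWidth / (2 * ϱ)) ⊆ convexHull ℝ (E : Set (Pt d)) := by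
  have hh := 𝒯.meshWidth_pos hd
  have hlt : 𝒯.meshWidth / (2 * ϱ) < inradius E := by
    rw [div_lt_iff₀ (by positivity)]
    have := h E hE
    linarith
  have hne : {r : ℝ | 0 ≤ r ∧ ∃ c : Pt d,
      Metric.closedBall c r ⊆ convexHull ℝ (E : Set (Pt d))}.Nonempty := by
    obtain ⟨x₀, r, hr, hb⟩ := exists_closedBall_subset (𝒯.indep_element hE)
      (𝒯.mem_elements.1 hE).2
    exact ⟨r, hr.le, x₀, hb⟩
  obtain ⟨r, ⟨-, x₀, hx₀⟩, hr⟩ := exists_lt_of_lt_csSup hne hlt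
  exact ⟨x₀, (Metric.closedBall_subset_closedBall hr.le).trans hx₀⟩

/-- Distinct elements overlap in the convex hull of fewer than `d + 1` points. -/
theorem Triangulation.volume_inter_eq_zero {E E' : Finset (Pt d)} (hE : E ∈ 𝒯.elements)
    (hE' : E' ∈ 𝒯.elements) (hne : E ≠ E') :
    volume (convexHull ℝ (E : Set (Pt d)) ∩ convexHull ℝ (E' : Set (Pt d))) = 0 := by
  classical
  rw [𝒯.complex.convexHull_inter_convexHull (𝒯.mem_elements.1 hE).1 (𝒯.mem_elements.1 hE').1,
    ← Finset.coe_inter]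
  have hcard : (E ∩ E').card < d + 1 := by
    rw [← (𝒯.mem_elements.1 hE).2]
    refine Finset.card_lt_card (Finset.ssubset_iff_subset_ne.2 ⟨Finset.inter_subset_left, ?_⟩)
    intro h
    exact hne (Finset.eq_of_subset_of_card_le (Finset.inter_eq_left.1 h)
      (by rw [(𝒯.mem_elements.1 hE).2, (𝒯.mem_elements.1 hE').2]))
  have hi : AffineIndependent ℝ ((↑) : (E ∩ E' : Finset (Pt d)) → Pt d) :=
    (𝒯.indep_element hE).mono (Finset.coe_subset.2 Finset.inter_subset_left)
  have hspan : affineSpan ℝ ((E ∩ E' : Finset (Pt d)) : Set (Pt d)) ≠ ⊤ := by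
    intro htop
    have := hi.affineSpan_eq_top_iff_card_eq_finrank_add_one.1 (by
      rwa [show range ((↑) : (E ∩ E' : Finset (Pt d)) → Pt d)
        = ((E ∩ E' : Finset (Pt d)) : Set (Pt d)) from Subtype.range_coe])
    rw [Fintype.card_coe, finrank_euclideanSpace_fin] at this
    omega
  exact measure_mono_null (convexHull_subset_affineSpan _)
    (Measure.addHaar_affineSubspace _ _ hspan)

/-- The elements that meet at a node have total volume at most that of the ball of radius `h`,
since they overlap in null sets only. -/
theorem Triangulation.sum_volume_star_le (x : Pt d) :
    ∑ E ∈ 𝒯.elements.filter (fun E => x ∈ E),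
      (volume : Measure (Pt d)).real (convexHull ℝ (E : Set (Pt d)))
      ≤ 𝒯.meshWidth ^ d * unitBallVolume d := by
  classical
  have hdisj : ((𝒯.elements.filter (fun E => x ∈ E) : Finset (Finset (Pt d))) :
      Set (Finset (Pt d))).Pairwise
      (Function.onFun (AEDisjoint (volume : Measure (Pt d)))
        fun E : Finset (Pt d) => convexHull ℝ (E : Set (Pt d))) := by
    intro E hE E' hE' hne
    exact 𝒯.volume_inter_eq_zero (Finset.mem_filter.1 hE).1 (Finset.mem_filter.1 hE').1 hne
  have hsub : (⋃ E ∈ 𝒯.elements.filter (fun E => x ∈ E), convexHull ℝ (E : Set (Pt d)))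
      ⊆ Metric.closedBall x 𝒯.meshWidth := by
    refine iUnion₂_subset fun E hE y hy => ?_
    obtain ⟨hE, hx⟩ := Finset.mem_filter.1 hE
    exact (Metric.dist_le_diam_of_mem (isCompact_simplex E).isBounded hy
      (subset_convexHull ℝ _ hx)).trans (𝒯.diam_element_le hE)
  have hball : (volume : Measure (Pt d)).real (Metric.closedBall x 𝒯.meshWidth)
      = 𝒯.meshWidth ^ d * unitBallVolume d := by
    rw [Measure.real, Measure.addHaar_closedBall _ _ 𝒯.meshWidth_nonneg, ENNReal.toReal_mul,
      ENNReal.toReal_ofReal (pow_nonneg 𝒯.meshWidth_nonneg _), finrank_euclideanSpace_fin]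
    rfl
  rw [← hball]
  refine le_trans (le_of_eq ?_) (measureReal_mono hsub (measure_closedBall_lt_top.ne))
  simp only [Measure.real]
  rw [measure_biUnion_finset₀ hdisj fun E _ => (measurableSet_simplex E).nullMeasurableSet,
    ENNReal.toReal_sum fun E _ => Triangulation.volume_element_ne_top E]

open Classical in
/-- Upper bound for the mass on an element by the surface nodal values. -/
theorem integral_interp_sq_le {E : Finset (Pt d)} (hE : E ∈ 𝒯.elements) (v : 𝒯.BdNode → ℝ) :
    ∫ y in convexHull ℝ (E : Set (Pt d)), interp E ((↑) : 𝒯.BdNode → Pt d) v y ^ 2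
      ≤ ∑ x : 𝒯.BdNode, if (x : Pt d) ∈ E then
        v x ^ 2 * (volume : Measure (Pt d)).real (convexHull ℝ (E : Set (Pt d))) else 0 := by
  set M2 := ∑ x : 𝒯.BdNode, if (x : Pt d) ∈ E then v x ^ 2 else 0 with hM2
  have hM0 : 0 ≤ M2 := Finset.sum_nonneg fun x _ => by split_ifs <;> positivity
  have hvert : ∀ y ∈ E, |interp E ((↑) : 𝒯.BdNode → Pt d) v 0
      + inner ℝ (interpGrad E ((↑) : 𝒯.BdNode → Pt d) v) y| ≤ √M2 := by
    intro y hy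
    rw [← interp_eq_affine]
    by_cases hb : y ∈ 𝒯.boundaryNodes
    · have hi := interp_pos (𝒯.indep_element hE) Subtype.val_injective v
        (i := (⟨y, hb⟩ : 𝒯.BdNode)) hy
      rw [show interp E ((↑) : 𝒯.BdNode → Pt d) v y = v ⟨y, hb⟩ from hi]
      apply Real.abs_le_sqrt
      have := Finset.single_le_sum (f := fun x : 𝒯.BdNode => if (x : Pt d) ∈ E then v x ^ 2 else 0)
        (fun x _ => by split_ifs <;> positivity) (Finset.mem_univ (⟨y, hb⟩ : 𝒯.BdNode))
      exact (if_pos hy).symm.le.trans this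
    · rw [interp_vertex_of_ne (𝒯.indep_element hE) v hy fun i hi => hb (hi ▸ i.2), abs_zero]
      exact Real.sqrt_nonneg _
  have hle : ∀ y ∈ convexHull ℝ (E : Set (Pt d)),
      interp E ((↑) : 𝒯.BdNode → Pt d) v y ^ 2 ≤ M2 := by
    intro y hy
    have := abs_affine_le_of_vertices hvert hy
    rw [← interp_eq_affine] at this
    rw [← sq_abs, ← Real.sq_sqrt hM0]
    exact pow_le_pow_left₀ (abs_nonneg _) this 2
  have hcont : Continuous fun y => interp E ((↑) : 𝒯.BdNode → Pt d) v y ^ 2 :=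
    (continuous_interp E _ v).pow 2
  calc _ ≤ ∫ _ in convexHull ℝ (E : Set (Pt d)), M2 :=
        setIntegral_mono_on (integrableOn_simplex (Triangulation.volume_element_ne_top E) hcont)
          (integrableOn_const (Triangulation.volume_element_ne_top E)) (measurableSet_simplex E) hle
    _ = M2 * (volume : Measure (Pt d)).real (convexHull ℝ (E : Set (Pt d))) := by
        rw [setIntegral_const, smul_eq_mul, mul_comm]
    _ = _ := by
        rw [hM2, Finset.sum_mul]
        exact Finset.sum_congr rfl fun x _ => by split_ifs <;> simp

theorem normSq_bulkMass_boundary_le (v : 𝒯.BdNode → ℝ) :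
    normSq 𝒯.bulkMass.toBlocks₂₂ v
      ≤ 𝒯.meshWidth ^ d * unitBallVolume d * ∑ x : 𝒯.BdNode, v x ^ 2 := by
  classical
  rw [𝒯.bulkMass_toBlocks₂₂, normSq_mass fun E _ => Triangulation.volume_element_ne_top E]
  calc _ ≤ ∑ E ∈ 𝒯.elements, ∑ x : 𝒯.BdNode, if (x : Pt d) ∈ E then
        v x ^ 2 * (volume : Measure (Pt d)).real (convexHull ℝ (E : Set (Pt d))) else 0 :=
        Finset.sum_le_sum fun E hE => integral_interp_sq_le hE v
    _ = ∑ x : 𝒯.BdNode, v x ^ 2 * ∑ E ∈ 𝒯.elements.filter (fun E => (x : Pt d) ∈ E),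
        (volume : Measure (Pt d)).real (convexHull ℝ (E : Set (Pt d))) := by
        rw [Finset.sum_comm]
        refine Finset.sum_congr rfl fun x _ => ?_
        rw [Finset.mul_sum, Finset.sum_filter]
    _ ≤ ∑ x : 𝒯.BdNode, v x ^ 2 * (𝒯.meshWidth ^ d * unitBallVolume d) := by
        gcongr with x
        exact 𝒯.sum_volume_star_le x
    _ = _ := by rw [← Finset.sum_mul, mul_comm]

/-- Lower bound for the surface mass by the nodal values. The divisor `d` is the number of nodes
that share a facet. -/
theorem le_normSq_surfaceMass (h : 𝒯.HasComparableElements ϱ) (hd : 1 ≤ d) (hϱ : 0 < ϱ)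
    (v : 𝒯.BdNode → ℝ) :
    (1 / 4 : ℝ) ^ d / d * ((𝒯.meshWidth / (2 * ϱ)) ^ (d - 1) * unitBallVolume (d - 1))
      * ∑ x : 𝒯.BdNode, v x ^ 2 ≤ normSq 𝒯.surfaceMass v := by
  classical
  have hd0 : (0 : ℝ) < d := by exact_mod_cast hd
  have hh := 𝒯.meshWidth_pos hd
  set m := (𝒯.meshWidth / (2 * ϱ)) ^ (d - 1) * unitBallVolume (d - 1) with hm
  have hm0 : 0 ≤ m := by have := unitBallVolume_pos (d - 1); positivity
  rw [𝒯.surfaceMass_eq, normSq_mass fun F hF => 𝒯.measure_facet_ne_top hd hF]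
  have hfacet : ∀ F ∈ 𝒯.boundaryFacets,
      (1 / 4 : ℝ) ^ d / d * m * ∑ x : 𝒯.BdNode, (if (x : Pt d) ∈ F then v x ^ 2 else 0)
      ≤ ∫ y in convexHull ℝ (F : Set (Pt d)), interp F ((↑) : 𝒯.BdNode → Pt d) v y ^ 2
        ∂(Measure.euclideanHausdorffMeasure (d - 1)) := by
    intro F hF
    set I := ∫ y in convexHull ℝ (F : Set (Pt d)), interp F ((↑) : 𝒯.BdNode → Pt d) v y ^ 2
        ∂(Measure.euclideanHausdorffMeasure (d - 1)) with hI
    obtain ⟨-, hFc, -⟩ := 𝒯.mem_boundaryFacets.1 hF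
    obtain ⟨E, hE, hFE⟩ := 𝒯.exists_element_of_boundaryFacet hF
    obtain ⟨x₀, hball⟩ := h.exists_closedBall hd hϱ hE
    have hmF := le_measure_facet (𝒯.indep_element hE) hFE (k := d - 1) (by omega)
      (by rw [(𝒯.mem_elements.1 hE).2]; omega) (by positivity) hball
    have hx : ∀ x : 𝒯.BdNode, (x : Pt d) ∈ F → (1 / 4 : ℝ) ^ d * m * v x ^ 2 ≤ I := by
      intro x hx
      have h1 := interp_sq_mul_measure_le (pos := ((↑) : 𝒯.BdNode → Pt d))
        (𝒯.measure_facet_ne_top hd hF) v hx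
      rw [interp_pos (𝒯.indep_facet hF) Subtype.val_injective v hx, Nat.sub_add_cancel hd] at h1
      refine le_trans ?_ h1
      calc (1 / 4 : ℝ) ^ d * m * v x ^ 2 = (1 / 4 : ℝ) ^ d * v x ^ 2 * m := by ring
        _ ≤ _ := by gcongr
    have hcard : (Finset.univ.filter fun x : 𝒯.BdNode => (x : Pt d) ∈ F).card ≤ d := by
      refine le_trans ?_ hFc.le
      exact Finset.card_le_card_of_injOn Subtype.val (fun x hx => (Finset.mem_filter.1 hx).2)
        Subtype.val_injective.injOn
    have hI0 : 0 ≤ I := integral_nonneg fun y => sq_nonneg _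
    rw [← Finset.sum_filter]
    have h2 : (1 / 4 : ℝ) ^ d * m * ∑ x ∈ Finset.univ.filter (fun x : 𝒯.BdNode => (x : Pt d) ∈ F),
        v x ^ 2 ≤ d * I := by
      rw [Finset.mul_sum]
      refine (Finset.sum_le_card_nsmul _ _ I fun x hx' => hx x (Finset.mem_filter.1 hx').2).trans ?_
      rw [nsmul_eq_mul]
      gcongr
    calc _ = (1 / 4 : ℝ) ^ d * m * (∑ x ∈ Finset.univ.filter
          (fun x : 𝒯.BdNode => (x : Pt d) ∈ F), v x ^ 2) / d := by ring
      _ ≤ I := by rw [div_le_iff₀ hd0]; linarith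
  refine le_trans ?_ (Finset.sum_le_sum hfacet)
  rw [← Finset.mul_sum, Finset.sum_comm]
  gcongr with x
  obtain ⟨F, hF, hxF⟩ := 𝒯.exists_facet_of_boundaryNode x
  have := Finset.single_le_sum (f := fun F : Finset (Pt d) => if (x : Pt d) ∈ F then v x ^ 2 else 0)
    (fun F _ => by split_ifs <;> positivity) hF
  simpa [hxF] using this

/-- The boundary estimate holds uniformly on families of meshes with comparable elements. -/
theorem exists_boundaryConst (hd : 2 ≤ d) (hϱ : 0 < ϱ) :
    ∃ cM : ℝ, 0 < cM ∧ ∀ 𝒯 : Triangulation d, 𝒯.HasComparableElements ϱ →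
      IsBoundaryConst 𝒯 cM := by
  have hd0 : (0 : ℝ) < d := by exact_mod_cast (by omega : 0 < d)
  have hω := unitBallVolume_pos d
  have hω' := unitBallVolume_pos (d - 1)
  refine ⟨unitBallVolume d * (2 * ϱ) ^ d * (4 ^ d * d / unitBallVolume (d - 1)), by positivity,
    fun 𝒯 h v => ?_⟩
  rcases isEmpty_or_nonempty 𝒯.BdNode with hemp | ⟨⟨x⟩⟩
  · simp [normSq, dotProduct]
  have hh := 𝒯.meshWidth_pos (by omega)
  -- one power of the bulk mesh width is traded for the surface mesh width
  have hΓ : 𝒯.meshWidth / (2 * ϱ) ≤ 𝒯.surfaceMeshWidth := by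
    obtain ⟨F, hF, -⟩ := 𝒯.exists_facet_of_boundaryNode x
    obtain ⟨E, hE, hFE⟩ := 𝒯.exists_element_of_boundaryFacet hF
    obtain ⟨x₀, hball⟩ := h.exists_closedBall (by omega) hϱ hE
    have hFc := (𝒯.mem_boundaryFacets.1 hF).2.1
    exact (le_diam_facet (𝒯.indep_element hE) hFE (k := d - 1) (by omega) (by omega)
      (by rw [(𝒯.mem_elements.1 hE).2]; omega) (by positivity) hball).trans (𝒯.diam_facet_le hF)
  have hlow := le_normSq_surfaceMass h (by omega) hϱ v
  set c := unitBallVolume d * (2 * ϱ) ^ d * (4 ^ d * d / unitBallVolume (d - 1)) with hc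
  have hc0 : 0 ≤ c := by positivity
  set q := ∑ x : 𝒯.BdNode, v x ^ 2
  have hq : 0 ≤ q := Finset.sum_nonneg fun x _ => sq_nonneg _
  calc _ ≤ 𝒯.meshWidth ^ d * unitBallVolume d * q := normSq_bulkMass_boundary_le v
    _ = c * (𝒯.meshWidth / (2 * ϱ)) * ((1 / 4 : ℝ) ^ d / d *
        ((𝒯.meshWidth / (2 * ϱ)) ^ (d - 1) * unitBallVolume (d - 1)) * q) := by
        have e : (𝒯.meshWidth / (2 * ϱ)) * (𝒯.meshWidth / (2 * ϱ)) ^ (d - 1)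
            = 𝒯.meshWidth ^ d / (2 * ϱ) ^ d := by
          rw [← pow_succ', Nat.sub_add_cancel (by omega), div_pow]
        calc _ = c * (𝒯.meshWidth ^ d / (2 * ϱ) ^ d) * ((1 / 4 : ℝ) ^ d / d)
              * unitBallVolume (d - 1) * q := by
              rw [hc, div_pow, one_pow]
              field_simp
          _ = _ := by rw [← e]; ring
    _ ≤ c * 𝒯.surfaceMeshWidth * normSq 𝒯.surfaceMass v :=
        mul_le_mul (mul_le_mul_of_nonneg_left hΓ hc0) hlow (by positivity)
          (mul_nonneg hc0 (le_trans (by positivity) hΓ))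

/-- The inverse estimate holds uniformly on families of meshes with comparable elements. -/
theorem exists_inverseConst (hd : 1 ≤ d) (hϱ : 0 < ϱ) {κmin κmax : ℝ} (hκmin : 0 < κmin)
    (hκ : κmin ≤ κmax) :
    ∃ cinv : ℝ, 0 < cinv ∧ ∀ 𝒯 : Triangulation d, 𝒯.HasComparableElements ϱ →
      ∀ κ : Pt d → ℝ, IsDiffusion 𝒯 κmin κmax κ → ∀ αΩ : ℝ, IsInverseConst 𝒯 κ αΩ cinv := by
  have hκmax : 0 < κmax := hκmin.trans_le hκ
  refine ⟨κmax * (4 * ϱ ^ 2) * 4 ^ (d + 1), by positivity, fun 𝒯 h κ hdiff αΩ v => ?_⟩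
  have hh := 𝒯.meshWidth_pos hd
  rw [𝒯.bulkMass_toBlocks₂₂, 𝒯.bulkStiff_toBlocks₂₂,
    normSq_mass fun E _ => Triangulation.volume_element_ne_top E,
    normSq_energyMatrix (fun E _ => Triangulation.volume_element_ne_top E)
      fun E hE => hdiff.integrableOn hE, Finset.mul_sum]
  refine Finset.sum_le_sum fun E hE => ?_
  set w := interp E ((↑) : 𝒯.BdNode → Pt d) v with hw
  set g := interpGrad E ((↑) : 𝒯.BdNode → Pt d) v with hg
  have hcont : Continuous fun y => w y ^ 2 := (continuous_interp E _ v).pow 2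
  have hi1 := integrableOn_simplex (s := E) (Triangulation.volume_element_ne_top E) hcont
  have hi2 := hdiff.integrableOn hE
  rw [integral_add (hi1.const_mul _) (hi2.mul_const _), integral_const_mul, integral_mul_const,
    add_mul]
  refine add_le_add le_rfl ?_
  -- the gradient term
  set I := ∫ y in convexHull ℝ (E : Set (Pt d)), w y ^ 2
  set V := (volume : Measure (Pt d)).real (convexHull ℝ (E : Set (Pt d))) with hV
  have hκI : ∫ y in convexHull ℝ (E : Set (Pt d)), κ y ≤ κmax * V := by
    calc _ ≤ ∫ _ in convexHull ℝ (E : Set (Pt d)), κmax :=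
          integral_mono_ae hi2 (integrableOn_const (Triangulation.volume_element_ne_top E))
            ((hdiff.ae_element hE).mono fun x hx => hx.2)
      _ = _ := by rw [setIntegral_const, smul_eq_mul, mul_comm]
  obtain ⟨x₀, hball⟩ := h.exists_closedBall hd hϱ hE
  have hEne : E.Nonempty := Finset.card_pos.1 (by rw [(𝒯.mem_elements.1 hE).2]; omega)
  obtain ⟨z, hz, hmax⟩ := E.exists_max_image (fun x => |w x|) hEne
  have hgr := norm_grad_mul_le (s := E) (c := w 0) (g := g) (M := |w z|)
    (fun x hx => by rw [hw, hg, ← interp_eq_affine]; exact hmax x hx) (by positivity) hball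
  have hμE : Measure.euclideanHausdorffMeasure d = (volume : Measure (Pt d)) :=
    EuclideanSpace.euclideanHausdorffMeasure_eq_volume d
  have hz2 := interp_sq_mul_measure_le (k := d) (pos := ((↑) : 𝒯.BdNode → Pt d))
    (by rw [hμE]; exact Triangulation.volume_element_ne_top E) v hz
  rw [hμE] at hz2
  have hV0 : 0 ≤ V := measureReal_nonneg
  have hsq : ‖g‖ ^ 2 ≤ w z ^ 2 * (4 * ϱ ^ 2) / 𝒯.meshWidth ^ 2 := by
    have h1 : ‖g‖ ≤ |w z| * (2 * ϱ) / 𝒯.meshWidth := by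
      rw [le_div_iff₀ hh]
      have h2 := mul_le_mul_of_nonneg_right hgr (show 0 ≤ 2 * ϱ by positivity)
      calc _ = ‖g‖ * (𝒯.meshWidth / (2 * ϱ)) * (2 * ϱ) := by field_simp
        _ ≤ _ := h2
    calc _ ≤ (|w z| * (2 * ϱ) / 𝒯.meshWidth) ^ 2 := pow_le_pow_left₀ (norm_nonneg _) h1 2
      _ = _ := by rw [div_pow, mul_pow, sq_abs]; ring
  calc _ ≤ κmax * V * ‖g‖ ^ 2 := by gcongr
    _ ≤ κmax * V * (w z ^ 2 * (4 * ϱ ^ 2) / 𝒯.meshWidth ^ 2) := by gcongr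
    _ = κmax * (4 * ϱ ^ 2) * 4 ^ (d + 1) / 𝒯.meshWidth ^ 2
        * ((1 / 4 : ℝ) ^ (d + 1) * w z ^ 2 * V) := by
        rw [div_pow, one_pow]; field_simp
    _ ≤ _ := by gcongr

end Constants

/-! ### Block matrices and the error equation -/

section Blocks

variable {I J : Type*} [Fintype I] [Fintype J] [DecidableEq I] [DecidableEq J]

theorem toBilin'_self (Q : Matrix I I ℝ) (x : I → ℝ) : Matrix.toBilin' Q x x = normSq Q x :=
  Matrix.toBilin'_apply' Q x x

theorem toBilin'_comm {Q : Matrix I I ℝ} (hQ : Qᵀ = Q) (x y : I → ℝ) :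
    Matrix.toBilin' Q x y = Matrix.toBilin' Q y x := by
  rw [Matrix.toBilin'_apply', Matrix.toBilin'_apply', Matrix.dotProduct_mulVec, dotProduct_comm,
    ← Matrix.mulVec_transpose, hQ]

theorem toBilin'_eq_dotProduct {Q : Matrix I I ℝ} (hQ : Qᵀ = Q) (x y : I → ℝ) :
    Matrix.toBilin' Q x y = y ⬝ᵥ (Q *ᵥ x) := by
  rw [toBilin'_comm hQ, Matrix.toBilin'_apply']

/-- The inverse of a positive semidefinite matrix is positive semidefinite, also in the singular
case, where `Q⁻¹ = 0`. -/
theorem normSq_inv_nonneg {Q : Matrix I I ℝ} (h0 : ∀ x, 0 ≤ normSq Q x)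
    (x : I → ℝ) : 0 ≤ normSq Q⁻¹ x := by
  by_cases hu : IsUnit Q.det
  · have h1 : Q *ᵥ (Q⁻¹ *ᵥ x) = x := by
      rw [Matrix.mulVec_mulVec, Matrix.mul_nonsing_inv _ hu, Matrix.one_mulVec]
    have h2 : normSq Q⁻¹ x = normSq Q (Q⁻¹ *ᵥ x) := by
      rw [normSq, normSq, h1, dotProduct_comm]
    rw [h2]; exact h0 _
  · rw [Matrix.nonsing_inv_apply_not_isUnit _ hu]
    simp [normSq]

/-- Extension of a surface vector by zero at the interior nodes. -/
def extZero (I J : Type*) : (J → ℝ) →ₗ[ℝ] (I ⊕ J → ℝ) where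
  toFun x := Sum.elim 0 x
  map_add' x y := by ext (i | j) <;> simp
  map_smul' c x := by ext (i | j) <;> simp

/-- Restriction of a bulk vector to the surface nodes. -/
def bdTrace (I J : Type*) : (I ⊕ J → ℝ) →ₗ[ℝ] (J → ℝ) := LinearMap.funLeft ℝ ℝ Sum.inr

omit [DecidableEq I] [DecidableEq J] in
theorem normSq_extZero (Q : Matrix (I ⊕ J) (I ⊕ J) ℝ) (x : J → ℝ) :
    normSq Q (extZero I J x) = normSq Q.toBlocks₂₂ x := by
  conv_lhs => rw [← Matrix.fromBlocks_toBlocks Q]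
  simp [normSq, extZero, Matrix.fromBlocks_mulVec, dotProduct]

end Blocks

section Triangulation

variable {d : ℕ} {𝒯 : Triangulation d} {κ : Pt d → ℝ} {αΩ αΓ β T : ℝ}

/-- The coupling matrix is `(0, M_Γ)`, as nodal functions of interior nodes vanish on the surface. -/
theorem Triangulation.coupling_mulVec (v : 𝒯.Node → ℝ) :
    𝒯.coupling *ᵥ v = 𝒯.surfaceMass *ᵥ bdTrace 𝒯.IntNode 𝒯.BdNode v := by
  ext i
  simp only [Matrix.mulVec, dotProduct, Fintype.sum_sum_type]
  have h0 : ∀ j : 𝒯.IntNode, 𝒯.coupling i (Sum.inl j) = 0 := by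
    intro j
    simp only [coupling, Matrix.of_apply, surfaceMassForm]
    refine Finset.sum_eq_zero fun F hF => ?_
    have hj : (j : Pt d) ∉ F := fun h => j.2.2 (by
      simp only [boundaryNodes, Finset.mem_biUnion, id]
      exact ⟨F, hF, h⟩)
    have : ∀ z, nodalFun F (𝒯.pos (Sum.inl j)) z = 0 := fun z => if_neg hj
    simp [this]
  simp only [h0, zero_mul, Finset.sum_const_zero, zero_add]
  rfl

theorem Triangulation.surfaceMass_transpose : 𝒯.surfaceMassᵀ = 𝒯.surfaceMass := by
  rw [surfaceMass_eq]; exact energyMatrix_transpose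

theorem Triangulation.surfaceStiff_transpose :
    (𝒯.surfaceStiff αΓ β)ᵀ = 𝒯.surfaceStiff αΓ β := energyMatrix_transpose

theorem Triangulation.bulkMass_transpose : 𝒯.bulkMassᵀ = 𝒯.bulkMass := by
  rw [bulkMass_eq]; exact energyMatrix_transpose

theorem Triangulation.bulkStiff_transpose :
    (𝒯.bulkStiff κ αΩ)ᵀ = 𝒯.bulkStiff κ αΩ := energyMatrix_transpose

theorem Triangulation.normSq_bulkMass_nonneg (x : 𝒯.Node → ℝ) : 0 ≤ normSq 𝒯.bulkMass x := by
  rw [bulkMass_eq, normSq_mass fun E _ => volume_element_ne_top E]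
  exact Finset.sum_nonneg fun E _ => integral_nonneg fun y => sq_nonneg _

theorem Triangulation.normSq_surfaceMass_nonneg (hd : 1 ≤ d) (x : 𝒯.BdNode → ℝ) :
    0 ≤ normSq 𝒯.surfaceMass x := by
  rw [surfaceMass_eq, normSq_mass fun F hF => 𝒯.measure_facet_ne_top hd hF]
  exact Finset.sum_nonneg fun E _ => integral_nonneg fun y => sq_nonneg _

theorem Triangulation.normSq_surfaceStiff_nonneg (hd : 1 ≤ d) (hα : 0 ≤ αΓ) (hβ : 0 ≤ β)
    (x : 𝒯.BdNode → ℝ) : 0 ≤ normSq (𝒯.surfaceStiff αΓ β) x := by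
  rw [surfaceStiff_eq]
  exact normSq_energyMatrix_nonneg (fun F hF => 𝒯.measure_facet_ne_top hd hF)
    (fun F hF => integrableOn_const (𝒯.measure_facet_ne_top hd hF)) hα
    (fun _ _ => Filter.Eventually.of_forall fun _ => hβ) x

theorem IsDiffusion.normSq_bulkStiff_nonneg {κmin κmax : ℝ} (h : IsDiffusion 𝒯 κmin κmax κ)
    (hκ : 0 < κmin) (hα : 0 ≤ αΩ) (x : 𝒯.Node → ℝ) : 0 ≤ normSq (𝒯.bulkStiff κ αΩ) x :=
  normSq_energyMatrix_nonneg (fun E _ => Triangulation.volume_element_ne_top E)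
    (fun _ hE => h.integrableOn hE) hα
    (fun _ hE => (h.ae_element hE).mono fun _ hy => hκ.le.trans hy.1) x

variable {fΩ : ℝ → 𝒯.Node → ℝ} {fΓ : ℝ → 𝒯.BdNode → ℝ} {u du : ℝ → 𝒯.Node → ℝ}
  {p dp lam : ℝ → 𝒯.BdNode → ℝ}

/-- The constraint identifies `p` with the trace of `u`. -/
theorem IsSemidiscreteSolution.trace_eq
    (h : IsSemidiscreteSolution 𝒯 κ αΩ αΓ β T fΩ fΓ u du p dp lam) (hd : 1 ≤ d) {t : ℝ}
    (ht : t ∈ Icc 0 T) : bdTrace 𝒯.IntNode 𝒯.BdNode (u t) = p t := by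
  have h1 := h.constraint t ht
  rw [𝒯.coupling_mulVec] at h1
  have h2 : 𝒯.surfaceMass *ᵥ (bdTrace 𝒯.IntNode 𝒯.BdNode (u t) - p t) = 0 := by
    rw [Matrix.mulVec_sub, h1, sub_self]
  exact sub_eq_zero.1 (𝒯.eq_zero_of_normSq_surfaceMass hd (by rw [normSq, h2, dotProduct_zero]))

/-- The weak form of the semi-discrete problem after elimination of the multiplier. -/
theorem IsSemidiscreteSolution.weak_form
    (h : IsSemidiscreteSolution 𝒯 κ αΩ αΓ β T fΩ fΓ u du p dp lam) {t : ℝ}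
    (ht : t ∈ Icc 0 T) (v : 𝒯.Node → ℝ) :
    Matrix.toBilin' 𝒯.bulkMass (du t) v + Matrix.toBilin' (𝒯.bulkStiff κ αΩ) (u t) v
      + Matrix.toBilin' 𝒯.surfaceMass (dp t) (bdTrace _ _ v)
      + Matrix.toBilin' (𝒯.surfaceStiff αΓ β) (p t) (bdTrace _ _ v)
      = v ⬝ᵥ fΩ t + bdTrace 𝒯.IntNode 𝒯.BdNode v ⬝ᵥ fΓ t := by
  rw [toBilin'_eq_dotProduct 𝒯.bulkMass_transpose, toBilin'_eq_dotProduct 𝒯.bulkStiff_transpose,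
    toBilin'_eq_dotProduct 𝒯.surfaceMass_transpose,
    toBilin'_eq_dotProduct 𝒯.surfaceStiff_transpose, ← h.bulk t ht, ← h.surface t ht]
  have hB : v ⬝ᵥ (𝒯.couplingᵀ *ᵥ lam t)
      = bdTrace 𝒯.IntNode 𝒯.BdNode v ⬝ᵥ (𝒯.surfaceMass *ᵥ lam t) := by
    rw [Matrix.dotProduct_mulVec, Matrix.vecMul_transpose, 𝒯.coupling_mulVec,
      Matrix.dotProduct_mulVec, ← Matrix.mulVec_transpose, 𝒯.surfaceMass_transpose]
  rw [dotProduct_add, dotProduct_add, dotProduct_sub, dotProduct_add, hB]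
  ring

/-- The weak form of one step of the splitting scheme. -/
theorem IsLieEuler.weak_form {τ : ℝ} {u₁ : ℕ → 𝒯.IntNode → ℝ} {pτ q : ℕ → 𝒯.BdNode → ℝ}
    (h : IsLieEuler 𝒯 κ αΩ αΓ β T τ fΩ fΓ u₁ pτ q) {n : ℕ} (hn : ((n : ℝ) + 1) * τ ≤ T)
    (v : 𝒯.Node → ℝ) :
    Matrix.toBilin' 𝒯.bulkMass (Sum.elim (τ⁻¹ • (u₁ (n + 1) - u₁ n)) (q n)) v
      + Matrix.toBilin' (𝒯.bulkStiff κ αΩ) (Sum.elim (u₁ (n + 1)) (pτ n)) v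
      + Matrix.toBilin' 𝒯.surfaceMass (q (n + 1)) (bdTrace _ _ v)
      + Matrix.toBilin' (𝒯.surfaceStiff αΓ β) (pτ (n + 1)) (bdTrace _ _ v)
      = v ⬝ᵥ fΩ (((n : ℝ) + 1) * τ) + bdTrace 𝒯.IntNode 𝒯.BdNode v ⬝ᵥ fΓ (((n : ℝ) + 1) * τ) := by
  rw [toBilin'_eq_dotProduct 𝒯.bulkMass_transpose, toBilin'_eq_dotProduct 𝒯.bulkStiff_transpose,
    toBilin'_eq_dotProduct 𝒯.surfaceMass_transpose,
    toBilin'_eq_dotProduct 𝒯.surfaceStiff_transpose]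
  have hsplit : ∀ (Q : Matrix 𝒯.Node 𝒯.Node ℝ) (x : 𝒯.IntNode → ℝ) (y : 𝒯.BdNode → ℝ),
      v ⬝ᵥ (Q *ᵥ Sum.elim x y)
        = (fun i => v (Sum.inl i)) ⬝ᵥ (Q.toBlocks₁₁ *ᵥ x + Q.toBlocks₁₂ *ᵥ y)
          + bdTrace 𝒯.IntNode 𝒯.BdNode v ⬝ᵥ (Q.toBlocks₂₁ *ᵥ x + Q.toBlocks₂₂ *ᵥ y) := by
    intro Q x y
    conv_lhs => rw [← Matrix.fromBlocks_toBlocks Q]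
    rw [Matrix.fromBlocks_mulVec]
    simp only [dotProduct, Fintype.sum_sum_type, Sum.elim_inl, Sum.elim_inr]
    rfl
  have hf : v ⬝ᵥ fΩ (((n : ℝ) + 1) * τ)
      = (fun i => v (Sum.inl i)) ⬝ᵥ (fun i => fΩ (((n : ℝ) + 1) * τ) (Sum.inl i))
        + bdTrace 𝒯.IntNode 𝒯.BdNode v ⬝ᵥ (fun i => fΩ (((n : ℝ) + 1) * τ) (Sum.inr i)) := by
    simp only [dotProduct, Fintype.sum_sum_type]
    rfl
  have h1 := congrArg (fun z => (fun i => v (Sum.inl i)) ⬝ᵥ z) (h.bulk_step n hn)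
  have h2 := congrArg (fun z => bdTrace 𝒯.IntNode 𝒯.BdNode v ⬝ᵥ z) (h.surface_step n hn)
  rw [hsplit, hsplit, hf]
  simp only [dotProduct_add, dotProduct_sub] at h1 h2 ⊢
  linarith

/-- The weak CFL condition turns the boundary and inverse estimates into the inequalities that
the stability analysis needs. -/
theorem isSplitSystem_of_cfl (hd : 1 ≤ d) {κmin κmax cM cinv τ : ℝ}
    (hκ : IsDiffusion 𝒯 κmin κmax κ) (hκmin : 0 < κmin) (hαΩ : 0 ≤ αΩ) (hαΓ : 0 ≤ αΓ)
    (hβ : 0 ≤ β) (hcM : 0 < cM) (hcinv : 0 < cinv) (hM : IsBoundaryConst 𝒯 cM)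
    (hinv : IsInverseConst 𝒯 κ αΩ cinv) (hτ : 0 < τ)
    (hcfl : 7 * cinv * cM * τ < 3 * 𝒯.meshWidth) (hh : 7 * 𝒯.meshWidth < 1 / cM) :
    IsSplitSystem (Matrix.toBilin' 𝒯.bulkMass) (Matrix.toBilin' (𝒯.bulkStiff κ αΩ))
      (Matrix.toBilin' 𝒯.surfaceMass) (Matrix.toBilin' (𝒯.surfaceStiff αΓ β))
      (extZero 𝒯.IntNode 𝒯.BdNode) (bdTrace 𝒯.IntNode 𝒯.BdNode) αΩ τ := by
  have hh0 := 𝒯.meshWidth_pos hd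
  have hmass : ∀ x, normSq 𝒯.bulkMass.toBlocks₂₂ x
      ≤ cM * 𝒯.meshWidth * normSq 𝒯.surfaceMass x := fun x =>
    (hM x).trans (by
      have := 𝒯.normSq_surfaceMass_nonneg hd x
      have := 𝒯.surfaceMeshWidth_le
      gcongr)
  have hcMh : cM * 𝒯.meshWidth ≤ 1 / 7 := by
    rw [lt_div_iff₀ hcM] at hh
    linarith
  have hmass' : ∀ x, normSq 𝒯.bulkMass.toBlocks₂₂ x ≤ 1 / 7 * normSq 𝒯.surfaceMass x := fun x =>
    (hmass x).trans (mul_le_mul_of_nonneg_right hcMh (𝒯.normSq_surfaceMass_nonneg hd x))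
  refine ⟨fun x => ?_, fun x => ?_, fun x => ?_, fun x => ?_,
    toBilin'_comm 𝒯.bulkMass_transpose, toBilin'_comm 𝒯.bulkStiff_transpose,
    toBilin'_comm 𝒯.surfaceMass_transpose,
    fun x => rfl, fun x => ?_, fun x => ?_⟩
  · rw [toBilin'_self]; exact 𝒯.normSq_bulkMass_nonneg x
  · rw [toBilin'_self]; exact hκ.normSq_bulkStiff_nonneg hκmin hαΩ x
  · rw [toBilin'_self]; exact 𝒯.normSq_surfaceMass_nonneg hd x
  · rw [toBilin'_self]; exact 𝒯.normSq_surfaceStiff_nonneg hd hαΓ hβ x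
  · rw [toBilin'_self, toBilin'_self, normSq_extZero]; exact hmass' x
  · rw [toBilin'_self, toBilin'_self, normSq_extZero]
    have hs := 𝒯.normSq_surfaceMass_nonneg hd x
    have h1 : τ * cinv / 𝒯.meshWidth ^ 2 * normSq 𝒯.bulkMass.toBlocks₂₂ x
        ≤ 3 / 7 * normSq 𝒯.surfaceMass x := by
      calc _ ≤ τ * cinv / 𝒯.meshWidth ^ 2 * (cM * 𝒯.meshWidth * normSq 𝒯.surfaceMass x) := by
            gcongr; exact hmass x
        _ = τ * cinv * cM / 𝒯.meshWidth * normSq 𝒯.surfaceMass x := by field_simp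
        _ ≤ _ := by
            refine mul_le_mul_of_nonneg_right ?_ hs
            rw [div_le_iff₀ hh0]
            linarith
    have h2 := mul_le_mul_of_nonneg_left (hmass' x) (mul_nonneg hτ.le hαΩ)
    calc _ ≤ τ * ((αΩ + cinv / 𝒯.meshWidth ^ 2) * normSq 𝒯.bulkMass.toBlocks₂₂ x) := by
          gcongr; exact hinv x
      _ = τ * αΩ * normSq 𝒯.bulkMass.toBlocks₂₂ x
          + τ * cinv / 𝒯.meshWidth ^ 2 * normSq 𝒯.bulkMass.toBlocks₂₂ x := by ring
      _ ≤ _ := by linarith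

end Triangulation

/-! ### The error estimate -/

theorem sum_integral_steps_le {f : ℝ → ℝ} {T τ : ℝ} {N : ℕ} (hf : ∀ t, 0 ≤ f t)
    (hi : IntervalIntegrable f volume 0 T) (hτ : 0 ≤ τ) (hN : N * τ ≤ T) :
    ∑ n ∈ Finset.range N, ∫ t in (n * τ)..((n + 1 : ℕ) * τ), f t ≤ ∫ t in (0 : ℝ)..T, f t := by
  have h0N : 0 ≤ N * τ := by positivity
  have hmem : ∀ n ≤ N, (n : ℝ) * τ ∈ uIcc 0 T := fun n hn => by
    rw [uIcc_of_le (h0N.trans hN)]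
    exact ⟨by positivity, le_trans (by gcongr) hN⟩
  rw [intervalIntegral.sum_integral_adjacent_intervals (a := fun n : ℕ => (n : ℝ) * τ)
    fun k hk => hi.mono_set (uIcc_subset_uIcc (hmem k hk.le) (hmem (k + 1) hk))]
  simp only [Nat.cast_zero, zero_mul]
  exact intervalIntegral.integral_mono_interval le_rfl h0N hN (Filter.Eventually.of_forall hf) hi

section Error

variable {d : ℕ} {𝒯 : Triangulation d} {κ : Pt d → ℝ} {αΩ αΓ β T τ : ℝ}
  {fΩ : ℝ → 𝒯.Node → ℝ} {fΓ : ℝ → 𝒯.BdNode → ℝ} {u du ddu : ℝ → 𝒯.Node → ℝ}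
  {p dp ddp lam : ℝ → 𝒯.BdNode → ℝ} {u₁ : ℕ → 𝒯.IntNode → ℝ} {pτ q : ℕ → 𝒯.BdNode → ℝ}

/-- The increments of the exact surface solution, preceded by the scaled initial derivative, as in
the start of the splitting scheme. -/
def exactIncr {W : Type*} [AddCommGroup W] [Module ℝ W] (τ : ℝ) (p dp : ℝ → W) : ℕ → W
  | 0 => τ • dp 0
  | n + 1 => p ((n + 1 : ℕ) * τ) - p (n * τ)

/-- The integral of `f` over the time step before the `n`-th one, zero for the first step. -/
noncomputable def prevIntegral (τ : ℝ) (f : ℝ → ℝ) : ℕ → ℝ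
  | 0 => 0
  | n + 1 => ∫ t in (n * τ)..((n + 1 : ℕ) * τ), f t

theorem prevIntegral_nonneg {f : ℝ → ℝ} (hf : ∀ t, 0 ≤ f t) (hτ : 0 ≤ τ) (n : ℕ) :
    0 ≤ prevIntegral τ f n := by
  cases n with
  | zero => exact le_rfl
  | succ n =>
    exact intervalIntegral.integral_nonneg (by push_cast; nlinarith) fun t _ => hf t

theorem sum_prevIntegral_le {f : ℝ → ℝ} {N : ℕ} (hf : ∀ t, 0 ≤ f t)
    (hi : IntervalIntegrable f volume 0 T) (hτ : 0 ≤ τ) (hN : N * τ ≤ T) :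
    ∑ n ∈ Finset.range N, prevIntegral τ f n ≤ ∫ t in (0 : ℝ)..T, f t := by
  refine le_trans ?_ (sum_integral_steps_le hf hi hτ hN)
  cases N with
  | zero => simp
  | succ N =>
    rw [Finset.sum_range_succ']
    simp only [prevIntegral, add_zero]
    exact Finset.sum_le_sum_of_subset_of_nonneg (by simp) fun n _ _ =>
      intervalIntegral.integral_nonneg (by push_cast; nlinarith) fun t _ => hf t

/-- The residual of the exact solution in the splitting scheme: the consistency errors of the
implicit Euler method in the bulk and on the surface, and the errors caused by taking the surface
values and their difference quotients from the previous step. -/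
noncomputable def splitResidual (𝒯 : Triangulation d) (κ : Pt d → ℝ) (αΩ τ : ℝ)
    (u du : ℝ → 𝒯.Node → ℝ) (p dp : ℝ → 𝒯.BdNode → ℝ) (n : ℕ) (v : 𝒯.Node → ℝ) : ℝ :=
  Matrix.toBilin' 𝒯.bulkMass (u ((n + 1 : ℕ) * τ) - u (n * τ) - τ • du ((n + 1 : ℕ) * τ)) v
    - Matrix.toBilin' 𝒯.bulkMass
      (extZero _ _ (exactIncr τ p dp (n + 1) - exactIncr τ p dp n)) v
    - τ * Matrix.toBilin' (𝒯.bulkStiff κ αΩ) (extZero _ _ (exactIncr τ p dp (n + 1))) v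
    + Matrix.toBilin' 𝒯.surfaceMass (exactIncr τ p dp (n + 1) - τ • dp ((n + 1 : ℕ) * τ))
      (bdTrace _ _ v)

/-- The consistency bound in the mass norms for the step `n`. -/
noncomputable def massDefect (𝒯 : Triangulation d) (τ : ℝ) (ddu : ℝ → 𝒯.Node → ℝ)
    (ddp : ℝ → 𝒯.BdNode → ℝ) (n : ℕ) : ℝ :=
  (∫ t in (n * τ)..((n + 1 : ℕ) * τ), √(normSq 𝒯.bulkMass (ddu t)))
    + 2 * (∫ t in (n * τ)..((n + 1 : ℕ) * τ), √(normSq 𝒯.surfaceMass (ddp t)))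
    + prevIntegral τ (fun t => √(normSq 𝒯.surfaceMass (ddp t))) n

/-- The consistency bound in the stiffness norm for the step `n`. -/
noncomputable def stiffDefect (𝒯 : Triangulation d) (κ : Pt d → ℝ) (αΩ τ : ℝ)
    (p dp : ℝ → 𝒯.BdNode → ℝ) (n : ℕ) : ℝ :=
  √(normSq (𝒯.bulkStiff κ αΩ).toBlocks₂₂ (exactIncr τ p dp (n + 1)))

/-- The increment over a time step differs from the scaled derivative at its end by a Taylor
remainder, which vanishes for the initial value. -/
theorem sqrt_form_exactIncr_le {J : Type*} [Fintype J] {B : LinearMap.BilinForm ℝ (J → ℝ)}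
    {p dp ddp : ℝ → J → ℝ} (h0 : ∀ x, 0 ≤ B x x) (hB : ∀ x y, B x y = B y x)
    (hp : ∀ t ∈ Icc 0 T, HasDerivWithinAt p (dp t) (Icc 0 T) t) (hdp : HasACDeriv T dp ddp)
    (hτ : 0 ≤ τ) {n : ℕ} (hn : n * τ ≤ T) :
    √(B (exactIncr τ p dp n - τ • dp (n * τ)) (exactIncr τ p dp n - τ • dp (n * τ)))
      ≤ τ * prevIntegral τ (fun t => √(B (ddp t) (ddp t))) n := by
  cases n with
  | zero => simp [exactIncr, prevIntegral]
  | succ n =>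
    have hle : (n : ℝ) * τ ≤ (n + 1 : ℕ) * τ := by push_cast; nlinarith
    have h := sqrt_form_taylor_le (a := n * τ) (b := (n + 1 : ℕ) * τ) hp hdp h0 hB
      ⟨by positivity, hle.trans hn⟩ ⟨by positivity, hn⟩ (right_mem_Icc.2 hle)
    rw [show ((n + 1 : ℕ) : ℝ) * τ - n * τ = τ by push_cast; ring] at h
    exact h

/-- Consistency of the splitting scheme. -/
theorem abs_splitResidual_le
    (S : IsSplitSystem (Matrix.toBilin' 𝒯.bulkMass) (Matrix.toBilin' (𝒯.bulkStiff κ αΩ))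
      (Matrix.toBilin' 𝒯.surfaceMass) (Matrix.toBilin' (𝒯.surfaceStiff αΓ β))
      (extZero 𝒯.IntNode 𝒯.BdNode) (bdTrace 𝒯.IntNode 𝒯.BdNode) αΩ τ)
    (hu : ∀ t ∈ Icc 0 T, HasDerivWithinAt u (du t) (Icc 0 T) t)
    (hp : ∀ t ∈ Icc 0 T, HasDerivWithinAt p (dp t) (Icc 0 T) t)
    (hdu : HasACDeriv T du ddu) (hdp : HasACDeriv T dp ddp) (hτ : 0 ≤ τ) {n : ℕ}
    (hn : (n + 1 : ℕ) * τ ≤ T) (v : 𝒯.Node → ℝ) :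
    |splitResidual 𝒯 κ αΩ τ u du p dp n v|
      ≤ τ * (massDefect 𝒯 τ ddu ddp n * (√(Matrix.toBilin' 𝒯.bulkMass v v)
        + √(Matrix.toBilin' 𝒯.surfaceMass (bdTrace _ _ v) (bdTrace _ _ v)))
        + stiffDefect 𝒯 κ αΩ τ p dp n * √(Matrix.toBilin' (𝒯.bulkStiff κ αΩ) v v)) := by
  have hle : (n : ℝ) * τ ≤ (n + 1 : ℕ) * τ := by push_cast; nlinarith
  have ha : (n : ℝ) * τ ∈ Icc 0 T := ⟨by positivity, hle.trans hn⟩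
  have hb : ((n + 1 : ℕ) : ℝ) * τ ∈ Icc 0 T := ⟨by positivity, hn⟩
  have hlen : ((n + 1 : ℕ) : ℝ) * τ - n * τ = τ := by push_cast; ring
  set Iu := ∫ t in (n * τ)..((n + 1 : ℕ) * τ), √(normSq 𝒯.bulkMass (ddu t)) with hIu
  set Ip := ∫ t in (n * τ)..((n + 1 : ℕ) * τ), √(normSq 𝒯.surfaceMass (ddp t)) with hIp
  set Jp := prevIntegral τ (fun t => √(normSq 𝒯.surfaceMass (ddp t))) n with hJp
  have hIu0 : 0 ≤ Iu := intervalIntegral.integral_nonneg hle fun t _ => Real.sqrt_nonneg _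
  have hIp0 : 0 ≤ Ip := intervalIntegral.integral_nonneg hle fun t _ => Real.sqrt_nonneg _
  have hJp0 : 0 ≤ Jp := prevIntegral_nonneg (fun t => Real.sqrt_nonneg _) hτ n
  set M := Matrix.toBilin' 𝒯.bulkMass with hM
  set A := Matrix.toBilin' (𝒯.bulkStiff κ αΩ) with hA
  set MΓ := Matrix.toBilin' 𝒯.surfaceMass with hMΓ
  set P := exactIncr τ p dp with hP
  have hIu' : Iu = ∫ t in (n * τ)..((n + 1 : ℕ) * τ), √(M (ddu t) (ddu t)) := by
    simp only [hIu, hM, toBilin'_self]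
  have hIp' : Ip = ∫ t in (n * τ)..((n + 1 : ℕ) * τ), √(MΓ (ddp t) (ddp t)) := by
    simp only [hIp, hMΓ, toBilin'_self]
  have hJp' : Jp = prevIntegral τ (fun t => √(MΓ (ddp t) (ddp t))) n := by
    simp only [hJp, hMΓ, toBilin'_self]
  have e1 : √(M (u ((n + 1 : ℕ) * τ) - u (n * τ) - τ • du ((n + 1 : ℕ) * τ))
      (u ((n + 1 : ℕ) * τ) - u (n * τ) - τ • du ((n + 1 : ℕ) * τ))) ≤ τ * Iu := by
    have h := sqrt_form_taylor_le hu hdu S.m_nonneg S.m_symm ha hb (right_mem_Icc.2 hle)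
    rw [hlen] at h
    rw [hIu']; exact h
  have e2 : √(MΓ (P (n + 1) - τ • dp (n * τ)) (P (n + 1) - τ • dp (n * τ))) ≤ τ * Ip := by
    have h := sqrt_form_taylor_le hp hdp S.s_nonneg S.s_symm ha hb (left_mem_Icc.2 hle)
    rw [hlen] at h
    rw [hIp']; exact h
  have e3 : √(MΓ (P n - τ • dp (n * τ)) (P n - τ • dp (n * τ))) ≤ τ * Jp := by
    rw [hJp']
    exact sqrt_form_exactIncr_le S.s_nonneg S.s_symm hp hdp hτ ha.2
  have e4 : √(MΓ (P (n + 1) - τ • dp ((n + 1 : ℕ) * τ)) (P (n + 1) - τ • dp ((n + 1 : ℕ) * τ)))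
      ≤ τ * Ip := by
    have h := sqrt_form_taylor_le hp hdp S.s_nonneg S.s_symm ha hb (right_mem_Icc.2 hle)
    rw [hlen] at h
    rw [hIp']; exact h
  have e5 : √(A (extZero _ _ (P (n + 1))) (extZero _ _ (P (n + 1))))
      = stiffDefect 𝒯 κ αΩ τ p dp n := by
    rw [hA, toBilin'_self, normSq_extZero]; rfl
  have hext : ∀ x, √(M (extZero _ _ x) (extZero _ _ x)) ≤ √(MΓ x x) := fun x =>
    Real.sqrt_le_sqrt ((S.mass_le x).trans (by linarith [S.s_nonneg x]))
  set X := √(M v v) with hX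
  set Y := √(MΓ (bdTrace _ _ v) (bdTrace _ _ v)) with hY
  set Z := √(A v v) with hZ
  have hX0 : 0 ≤ X := Real.sqrt_nonneg _
  have hY0 : 0 ≤ Y := Real.sqrt_nonneg _
  have hZ0 : 0 ≤ Z := Real.sqrt_nonneg _
  have t1 := (abs_form_le S.m_nonneg S.m_symm
    (u ((n + 1 : ℕ) * τ) - u (n * τ) - τ • du ((n + 1 : ℕ) * τ)) v).trans
    (mul_le_mul_of_nonneg_right e1 hX0)
  have t2 := (abs_form_le S.m_nonneg S.m_symm (extZero _ _ (P (n + 1) - τ • dp (n * τ))) v).trans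
    (mul_le_mul_of_nonneg_right ((hext _).trans e2) hX0)
  have t3 := (abs_form_le S.m_nonneg S.m_symm (extZero _ _ (P n - τ • dp (n * τ))) v).trans
    (mul_le_mul_of_nonneg_right ((hext _).trans e3) hX0)
  have t4 := (abs_form_le S.s_nonneg S.s_symm (P (n + 1) - τ • dp ((n + 1 : ℕ) * τ))
    (bdTrace _ _ v)).trans (mul_le_mul_of_nonneg_right e4 hY0)
  have t5 := abs_form_le S.a_nonneg S.a_symm (extZero _ _ (P (n + 1))) v
  rw [e5] at t5
  have t5' : |τ * A (extZero _ _ (P (n + 1))) v| ≤ τ * (stiffDefect 𝒯 κ αΩ τ p dp n * Z) := by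
    rw [abs_mul, abs_of_nonneg hτ]; gcongr
  -- the second difference of `p` is split at the scaled derivative in the middle
  have hdecomp : splitResidual 𝒯 κ αΩ τ u du p dp n v
      = M (u ((n + 1 : ℕ) * τ) - u (n * τ) - τ • du ((n + 1 : ℕ) * τ)) v
        - M (extZero _ _ (P (n + 1) - τ • dp (n * τ))) v
        + M (extZero _ _ (P n - τ • dp (n * τ))) v
        - τ * A (extZero _ _ (P (n + 1))) v
        + MΓ (P (n + 1) - τ • dp ((n + 1 : ℕ) * τ)) (bdTrace _ _ v) := by
    simp only [splitResidual, ← hM, ← hA, ← hMΓ, ← hP, map_sub, LinearMap.sub_apply]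
    ring
  rw [hdecomp]
  generalize M (u ((n + 1 : ℕ) * τ) - u (n * τ) - τ • du ((n + 1 : ℕ) * τ)) v = z1 at *
  generalize M (extZero _ _ (P (n + 1) - τ • dp (n * τ))) v = z2 at *
  generalize M (extZero _ _ (P n - τ • dp (n * τ))) v = z3 at *
  generalize τ * A (extZero _ _ (P (n + 1))) v = z5 at *
  generalize MΓ (P (n + 1) - τ • dp ((n + 1 : ℕ) * τ)) (bdTrace _ _ v) = z4 at *
  have htri : |z1 - z2 + z3 - z5 + z4| ≤ |z1| + |z2| + |z3| + |z5| + |z4| := by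
    refine abs_le.2 ⟨?_, ?_⟩ <;>
    linarith [le_abs_self z1, neg_abs_le z1, le_abs_self z2, neg_abs_le z2, le_abs_self z3,
      neg_abs_le z3, le_abs_self z4, neg_abs_le z4, le_abs_self z5, neg_abs_le z5]
  have hdef : massDefect 𝒯 τ ddu ddp n = Iu + 2 * Ip + Jp := rfl
  rw [hdef]
  have p1 : 0 ≤ τ * Ip * X := by positivity
  have p2 : 0 ≤ τ * Iu * Y := by positivity
  have p3 : 0 ≤ τ * Ip * Y := by positivity
  have p4 : 0 ≤ τ * Jp * Y := by positivity
  linarith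

/-- The error of the splitting scheme satisfies the abstract error equation. -/
theorem isErrorRecursion (hd : 1 ≤ d)
    (S : IsSplitSystem (Matrix.toBilin' 𝒯.bulkMass) (Matrix.toBilin' (𝒯.bulkStiff κ αΩ))
      (Matrix.toBilin' 𝒯.surfaceMass) (Matrix.toBilin' (𝒯.surfaceStiff αΓ β))
      (extZero 𝒯.IntNode 𝒯.BdNode) (bdTrace 𝒯.IntNode 𝒯.BdNode) αΩ τ)
    (hsol : IsSemidiscreteSolution 𝒯 κ αΩ αΓ β T fΩ fΓ u du p dp lam)
    (hdu : HasACDeriv T du ddu) (hdp : HasACDeriv T dp ddp) (hτ : 0 < τ)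
    (hE : IsLieEuler 𝒯 κ αΩ αΓ β T τ fΩ fΓ u₁ pτ q) {N : ℕ} (hN : N * τ ≤ T) :
    IsErrorRecursion (Matrix.toBilin' 𝒯.bulkMass) (Matrix.toBilin' (𝒯.bulkStiff κ αΩ))
      (Matrix.toBilin' 𝒯.surfaceMass) (Matrix.toBilin' (𝒯.surfaceStiff αΓ β))
      (extZero 𝒯.IntNode 𝒯.BdNode) (bdTrace 𝒯.IntNode 𝒯.BdNode) τ N
      (fun n => u (n * τ) - Sum.elim (u₁ n) (pτ n))
      (fun n => exactIncr τ p dp n - τ • q n)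
      (splitResidual 𝒯 κ αΩ τ u du p dp) (massDefect 𝒯 τ ddu ddp)
      (stiffDefect 𝒯 κ αΩ τ p dp) := by
  have htime : ∀ n < N, ((n + 1 : ℕ) : ℝ) * τ ≤ T := fun n hn => by
    refine le_trans ?_ hN
    have : ((n + 1 : ℕ) : ℝ) ≤ N := by exact_mod_cast hn
    gcongr
  have hmem : ∀ n < N, ((n + 1 : ℕ) : ℝ) * τ ∈ Icc 0 T := fun n hn =>
    ⟨by positivity, htime n hn⟩
  have hmem' : ∀ n < N, (n : ℝ) * τ ∈ Icc 0 T := fun n hn =>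
    ⟨by positivity, le_trans (by push_cast; nlinarith) (htime n hn)⟩
  have htr : ∀ x : 𝒯.IntNode → ℝ, ∀ y : 𝒯.BdNode → ℝ,
      bdTrace 𝒯.IntNode 𝒯.BdNode (Sum.elim x y) = y := fun _ _ => rfl
  refine ⟨fun n hn => ?_, fun n hn v => ?_, fun n => ?_, fun n => Real.sqrt_nonneg _,
    fun n hn v => abs_splitResidual_le S hsol.deriv_u hsol.deriv_p hdu hdp hτ.le (htime n hn) v⟩
  · rw [map_sub, map_sub, hsol.trace_eq hd (hmem n hn), hsol.trace_eq hd (hmem' n hn), htr, htr,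
      exactIncr, hE.diff_p, smul_smul, mul_inv_cancel₀ hτ.ne', one_smul]
    abel
  · have h1 := hsol.weak_form (hmem n hn) v
    have h2 := hE.weak_form (n := n) (by simpa using htime n hn) v
    have hcast : ((n : ℝ) + 1) * τ = ((n + 1 : ℕ) : ℝ) * τ := by push_cast; ring
    rw [hcast, ← h1] at h2
    rw [map_sub (bdTrace 𝒯.IntNode 𝒯.BdNode), hsol.trace_eq hd (hmem n hn), htr]
    have hq : τ • q (n + 1) = pτ (n + 1) - pτ n := by
      rw [hE.diff_p, smul_smul, mul_inv_cancel₀ hτ.ne', one_smul]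
    -- the vectors to which the mass and the stiffness matrix are applied in the scheme
    have hX : (Sum.elim (u₁ (n + 1)) (pτ (n + 1)) : 𝒯.Node → ℝ) - Sum.elim (u₁ n) (pτ n)
        - extZero 𝒯.IntNode 𝒯.BdNode (τ • q (n + 1) - τ • q n)
        = τ • Sum.elim (τ⁻¹ • (u₁ (n + 1) - u₁ n)) (q n) := by
      rw [hq]
      ext (i | j)
      · simp [extZero, hτ.ne']
      · simp [extZero]
    have hY : (Sum.elim (u₁ (n + 1)) (pτ (n + 1)) : 𝒯.Node → ℝ)
        - extZero 𝒯.IntNode 𝒯.BdNode (τ • q (n + 1)) = Sum.elim (u₁ (n + 1)) (pτ n) := by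
      rw [hq]
      ext (i | j)
      · simp [extZero]
      · simp [extZero]
    set X : 𝒯.Node → ℝ := Sum.elim (τ⁻¹ • (u₁ (n + 1) - u₁ n)) (q n)
    set P := exactIncr τ p dp
    set U' : 𝒯.Node → ℝ := Sum.elim (u₁ (n + 1)) (pτ (n + 1))
    set U : 𝒯.Node → ℝ := Sum.elim (u₁ n) (pτ n)
    have a1 : u ((n + 1 : ℕ) * τ) - U' - (u (n * τ) - U)
        - extZero 𝒯.IntNode 𝒯.BdNode (P (n + 1) - τ • q (n + 1) - (P n - τ • q n))
        = u ((n + 1 : ℕ) * τ) - u (n * τ) - extZero 𝒯.IntNode 𝒯.BdNode (P (n + 1) - P n)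
          - τ • X := by
      rw [← hX]; simp only [map_sub]; abel
    have a2 : u ((n + 1 : ℕ) * τ) - U'
        - extZero 𝒯.IntNode 𝒯.BdNode (P (n + 1) - τ • q (n + 1))
        = u ((n + 1 : ℕ) * τ) - extZero 𝒯.IntNode 𝒯.BdNode (P (n + 1))
          - Sum.elim (u₁ (n + 1)) (pτ n) := by
      rw [← hY]; simp only [map_sub]; abel
    rw [a1, a2, splitResidual]
    simp only [map_sub, map_smul, LinearMap.sub_apply, LinearMap.smul_apply, smul_eq_mul]
    linear_combination (-τ) * h2
  · have hle : (n : ℝ) * τ ≤ (n + 1 : ℕ) * τ := by push_cast; nlinarith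
    have := prevIntegral_nonneg (f := fun t => √(normSq 𝒯.surfaceMass (ddp t)))
      (fun t => Real.sqrt_nonneg _) hτ.le n
    have h1 : 0 ≤ ∫ t in (n * τ)..((n + 1 : ℕ) * τ), √(normSq 𝒯.bulkMass (ddu t)) :=
      intervalIntegral.integral_nonneg hle fun t _ => Real.sqrt_nonneg _
    have h2 : 0 ≤ ∫ t in (n * τ)..((n + 1 : ℕ) * τ), √(normSq 𝒯.surfaceMass (ddp t)) :=
      intervalIntegral.integral_nonneg hle fun t _ => Real.sqrt_nonneg _
    unfold massDefect
    positivity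

/-- The consistency errors add up to the quantities in the error constant. -/
theorem sum_defects_le
    (hm0 : ∀ x, 0 ≤ normSq (𝒯.bulkStiff κ αΩ) x)
    (hp : ∀ t ∈ Icc 0 T, HasDerivWithinAt p (dp t) (Icc 0 T) t)
    (hdu : HasACDeriv T du ddu) (hdp : HasACDeriv T dp ddp) (hτ : 0 < τ) {N : ℕ}
    (hT : 0 ≤ T) (hN : N * τ ≤ T) :
    (τ * ∑ n ∈ Finset.range N, massDefect 𝒯 τ ddu ddp n) ^ 2
      + τ * ∑ n ∈ Finset.range N, stiffDefect 𝒯 κ αΩ τ p dp n ^ 2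
      ≤ 18 * τ ^ 2 * ((∫ s in (0 : ℝ)..T, √(normSq 𝒯.bulkMass (ddu s))) ^ 2
        + (∫ s in (0 : ℝ)..T, √(normSq 𝒯.surfaceMass (ddp s))) ^ 2
        + ∫ s in (0 : ℝ)..T, normSq (𝒯.bulkStiff κ αΩ).toBlocks₂₂ (dp s)) := by
  have hle : ∀ n : ℕ, (n : ℝ) * τ ≤ (n + 1 : ℕ) * τ := fun n => by push_cast; nlinarith
  have hmem : ∀ n ≤ N, (n : ℝ) * τ ∈ Icc 0 T := fun n hn =>
    ⟨by positivity, le_trans (by gcongr) hN⟩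
  set a := ∫ s in (0 : ℝ)..T, √(normSq 𝒯.bulkMass (ddu s)) with ha
  set b := ∫ s in (0 : ℝ)..T, √(normSq 𝒯.surfaceMass (ddp s)) with hb
  set c := ∫ s in (0 : ℝ)..T, normSq (𝒯.bulkStiff κ αΩ).toBlocks₂₂ (dp s) with hc
  have hia : IntervalIntegrable (fun s => √(normSq 𝒯.bulkMass (ddu s))) volume 0 T := by
    simpa only [toBilin'_self] using
      intervalIntegrable_sqrt_form (Matrix.toBilin' 𝒯.bulkMass) hdu.1
  have hib : IntervalIntegrable (fun s => √(normSq 𝒯.surfaceMass (ddp s))) volume 0 T := by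
    simpa only [toBilin'_self] using
      intervalIntegrable_sqrt_form (Matrix.toBilin' 𝒯.surfaceMass) hdp.1
  have hdpc := hdp.continuousOn hT
  have hic : IntervalIntegrable (fun s => normSq (𝒯.bulkStiff κ αΩ).toBlocks₂₂ (dp s))
      volume 0 T := by
    simpa only [toBilin'_self, Function.comp_def] using ((continuous_form_self
      (Matrix.toBilin' (𝒯.bulkStiff κ αΩ).toBlocks₂₂)).comp_continuousOn
      (hdpc.mono (by rw [uIcc_of_le hT]))).intervalIntegrable (μ := volume)
  have hA0 : ∀ x, 0 ≤ normSq (𝒯.bulkStiff κ αΩ).toBlocks₂₂ x := fun x => by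
    rw [← normSq_extZero]; exact hm0 _
  have hmass : ∑ n ∈ Finset.range N, massDefect 𝒯 τ ddu ddp n ≤ a + 3 * b := by
    simp only [massDefect, Finset.sum_add_distrib, ← Finset.mul_sum]
    have h1 := sum_integral_steps_le (fun t => Real.sqrt_nonneg _) hia hτ.le hN
    have h2 := sum_integral_steps_le (fun t => Real.sqrt_nonneg _) hib hτ.le hN
    have h3 := sum_prevIntegral_le (fun t => Real.sqrt_nonneg _) hib hτ.le hN
    linarith
  have hmass0 : 0 ≤ ∑ n ∈ Finset.range N, massDefect 𝒯 τ ddu ddp n := by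
    refine Finset.sum_nonneg fun n _ => add_nonneg (add_nonneg ?_ (mul_nonneg zero_le_two ?_)) ?_
    · exact intervalIntegral.integral_nonneg (hle n) fun t _ => Real.sqrt_nonneg _
    · exact intervalIntegral.integral_nonneg (hle n) fun t _ => Real.sqrt_nonneg _
    · exact prevIntegral_nonneg (fun t => Real.sqrt_nonneg _) hτ.le n
  have hstiff : ∑ n ∈ Finset.range N, stiffDefect 𝒯 κ αΩ τ p dp n ^ 2 ≤ τ * c := by
    refine le_trans ?_ (mul_le_mul_of_nonneg_left (sum_integral_steps_le (fun t => hA0 _) hic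
      hτ.le hN) hτ.le)
    rw [Finset.mul_sum]
    refine Finset.sum_le_sum fun n hn => ?_
    have hn := Finset.mem_range.1 hn
    have hcomm := toBilin'_comm (Q := (𝒯.bulkStiff κ αΩ).toBlocks₂₂) (by
      rw [𝒯.bulkStiff_toBlocks₂₂]; exact energyMatrix_transpose)
    have h := (hasACDeriv_of_hasDerivWithinAt hT hp hdpc).form_sub_self_le
      (fun x => by rw [toBilin'_self]; exact hA0 x) hcomm hdpc (hmem n hn.le) (hmem (n + 1) hn)
      (by push_cast; nlinarith)
    simp only [toBilin'_self] at h
    rw [stiffDefect, Real.sq_sqrt (hA0 _)]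
    calc _ ≤ _ := h
      _ = _ := by congr 1; push_cast; ring
  have h1 : (τ * ∑ n ∈ Finset.range N, massDefect 𝒯 τ ddu ddp n) ^ 2
      ≤ (τ * (a + 3 * b)) ^ 2 :=
    pow_le_pow_left₀ (mul_nonneg hτ.le hmass0) (mul_le_mul_of_nonneg_left hmass hτ.le) 2
  have h2 := mul_le_mul_of_nonneg_left hstiff hτ.le
  have hc0 : 0 ≤ c := intervalIntegral.integral_nonneg hT fun t _ => hA0 _
  have h3 : (a + 3 * b) ^ 2 + c ≤ 18 * (a ^ 2 + b ^ 2 + c) := by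
    nlinarith [sq_nonneg (a - 3 * b), sq_nonneg a]
  calc _ ≤ (τ * (a + 3 * b)) ^ 2 + τ * (τ * c) := add_le_add h1 h2
    _ = τ ^ 2 * ((a + 3 * b) ^ 2 + c) := by ring
    _ ≤ τ ^ 2 * (18 * (a ^ 2 + b ^ 2 + c)) := by gcongr
    _ = _ := by ring

/-- The remaining summands of `dataNormSq` are nonnegative. -/
theorem le_dataNormSq (hd : 1 ≤ d) {κmin κmax : ℝ} (hκ : IsDiffusion 𝒯 κmin κmax κ)
    (hκmin : 0 < κmin) (hαΩ : 0 ≤ αΩ) (hαΓ : 0 ≤ αΓ) (hβ : 0 ≤ β) (hT : 0 ≤ T)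
    (dfΩ : ℝ → 𝒯.Node → ℝ) (dfΓ : ℝ → 𝒯.BdNode → ℝ) :
    (∫ s in (0 : ℝ)..T, √(normSq 𝒯.bulkMass (ddu s))) ^ 2
        + (∫ s in (0 : ℝ)..T, √(normSq 𝒯.surfaceMass (ddp s))) ^ 2
        + ∫ s in (0 : ℝ)..T, normSq (𝒯.bulkStiff κ αΩ).toBlocks₂₂ (dp s)
      ≤ dataNormSq 𝒯 κ αΩ αΓ β T du ddu dfΩ dp ddp dfΓ := by
  have h1 := hκ.normSq_bulkStiff_nonneg hκmin hαΩ (du 0)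
  have h2 := 𝒯.normSq_surfaceStiff_nonneg hd hαΓ hβ (dp 0)
  have h3 := 𝒯.normSq_surfaceMass_nonneg hd (dp 0)
  have h4 : 0 ≤ ∫ s in (0 : ℝ)..T, normSq 𝒯.bulkMass⁻¹ (dfΩ s) :=
    intervalIntegral.integral_nonneg hT fun s _ => normSq_inv_nonneg 𝒯.normSq_bulkMass_nonneg _
  have h5 : 0 ≤ ∫ s in (0 : ℝ)..T, normSq 𝒯.surfaceMass⁻¹ (dfΓ s) :=
    intervalIntegral.integral_nonneg hT fun s _ =>
      normSq_inv_nonneg (𝒯.normSq_surfaceMass_nonneg hd) _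
  unfold dataNormSq
  linarith

/-- The error estimate in the mass norms, together with the accumulated energy norms: stability of
the scheme applied to its consistency errors. -/
theorem error_le (hd : 1 ≤ d) {κmin κmax cM cinv : ℝ} (hκ : IsDiffusion 𝒯 κmin κmax κ)
    (hκmin : 0 < κmin) (hαΩ : 0 ≤ αΩ) (hαΓ : 0 ≤ αΓ) (hβ : 0 ≤ β) (hcM : 0 < cM)
    (hcinv : 0 < cinv) (hM : IsBoundaryConst 𝒯 cM) (hinv : IsInverseConst 𝒯 κ αΩ cinv)
    (hsol : IsSemidiscreteSolution 𝒯 κ αΩ αΓ β T fΩ fΓ u du p dp lam)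
    (hdu : HasACDeriv T du ddu) (hdp : HasACDeriv T dp ddp)
    (dfΩ : ℝ → 𝒯.Node → ℝ) (dfΓ : ℝ → 𝒯.BdNode → ℝ) (hτ : 0 < τ)
    (hcfl : 7 * cinv * cM * τ < 3 * 𝒯.meshWidth) (hh : 7 * 𝒯.meshWidth < 1 / cM)
    (hE : IsLieEuler 𝒯 κ αΩ αΓ β T τ fΩ fΓ u₁ pτ q)
    (hu0 : u₁ 0 = fun i => u 0 (Sum.inl i)) (hp0 : pτ 0 = p 0) (hq0 : q 0 = dp 0) (n : ℕ)
    (hn : ((n : ℝ) + 1) * τ ≤ T) :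
    normSq 𝒯.bulkMass (u (((n : ℝ) + 1) * τ) - Sum.elim (u₁ (n + 1)) (pτ (n + 1)))
      + τ * ∑ k ∈ Finset.range (n + 1), normSq (𝒯.bulkStiff κ αΩ)
          (u (((k : ℝ) + 1) * τ) - Sum.elim (u₁ (k + 1)) (pτ (k + 1)))
      + normSq 𝒯.surfaceMass (p (((n : ℝ) + 1) * τ) - pτ (n + 1))
      + τ * ∑ k ∈ Finset.range (n + 1), normSq (𝒯.surfaceStiff αΓ β)
          (p (((k : ℝ) + 1) * τ) - pτ (k + 1))
      ≤ 18 * splitConst αΩ T * dataNormSq 𝒯 κ αΩ αΓ β T du ddu dfΩ dp ddp dfΓ * τ ^ 2 := by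
  have hT : 0 < T := lt_of_lt_of_le (by positivity) hn
  have hN : ((n + 1 : ℕ) : ℝ) * τ ≤ T := by push_cast; exact hn
  have S := isSplitSystem_of_cfl (αΓ := αΓ) (β := β) hd hκ hκmin hαΩ hαΓ hβ hcM hcinv hM hinv hτ
    hcfl hh
  have H := isErrorRecursion hd S hsol hdu hdp hτ hE hN
  have htr : ∀ k < n + 1, bdTrace 𝒯.IntNode 𝒯.BdNode
      (u (((k + 1 : ℕ) : ℝ) * τ) - Sum.elim (u₁ (k + 1)) (pτ (k + 1)))
      = p (((k + 1 : ℕ) : ℝ) * τ) - pτ (k + 1) := by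
    intro k hk
    have hk' : ((k + 1 : ℕ) : ℝ) ≤ (n + 1 : ℕ) := by exact_mod_cast hk
    rw [map_sub, hsol.trace_eq hd ⟨by positivity, le_trans (by gcongr) hN⟩]
    rfl
  have hE0 : u ((0 : ℕ) * τ) - Sum.elim (u₁ 0) (pτ 0) = 0 := by
    have htr0 := hsol.trace_eq hd (t := 0) ⟨le_rfl, hT.le⟩
    rw [Nat.cast_zero, zero_mul, hu0, hp0, ← htr0]
    ext (i | j)
    · simp
    · simp [bdTrace]
  have hδ0 : exactIncr τ p dp 0 - τ • q 0 = 0 := by rw [hq0, exactIncr, sub_self]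
  have hstab := H.stability S hτ hαΩ hT hN hE0 hδ0
  have hdef := sum_defects_le (fun x => hκ.normSq_bulkStiff_nonneg hκmin hαΩ x)
    hsol.deriv_p hdu hdp hτ hT.le hN
  have hdata := le_dataNormSq (du := du) (ddu := ddu) (dp := dp) (ddp := ddp) hd hκ hκmin hαΩ hαΓ
    hβ hT.le dfΩ dfΓ
  have hC : 0 ≤ splitConst αΩ T := by unfold splitConst splitRate; positivity
  simp only [toBilin'_self] at hstab
  rw [htr n n.lt_succ_self, Finset.sum_congr rfl fun k hk =>
    congrArg (normSq (𝒯.surfaceStiff αΓ β)) (htr k (Finset.mem_range.1 hk))] at hstab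
  push_cast at hstab
  calc _ ≤ _ := hstab
    _ ≤ splitConst αΩ T * (18 * τ ^ 2 * dataNormSq 𝒯 κ αΩ αΓ β T du ddu dfΩ dp ddp dfΓ) := by
        gcongr
        exact hdef.trans (by gcongr)
    _ = _ := by ring

end Error
end BulkSurface

theorem mainTheorem1 (d : ℕ) (hd : 2 ≤ d) (θ ϱ : ℝ) (hθ : 2 ≤ θ) (hϱ : 0 < ϱ)
    (κmin κmax : ℝ) (hκmin : 0 < κmin) (hκ : κmin ≤ κmax) :
    -- the constants `c_M` and `c_inv` exist, uniformly over quasi-uniform families of meshes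
    (∃ cM : ℝ, 0 < cM ∧ ∀ 𝒯 : Triangulation d, 𝒯.IsQuasiUniform θ →
      𝒯.HasComparableElements ϱ → IsBoundaryConst 𝒯 cM) ∧
    (∃ cinv : ℝ, 0 < cinv ∧ ∀ 𝒯 : Triangulation d, 𝒯.IsQuasiUniform θ →
      𝒯.HasComparableElements ϱ → ∀ κ : Pt d → ℝ, IsDiffusion 𝒯 κmin κmax κ → ∀ αΩ : ℝ, 0 ≤ αΩ →
        IsInverseConst 𝒯 κ αΩ cinv) ∧
    -- the error estimates, for any such constants
    ∀ (cM cinv αΩ T : ℝ), 0 < cM → 0 < cinv → 0 ≤ αΩ → 0 < T →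
      ∃ C : ℝ, 0 < C ∧
        ∀ (𝒯 : Triangulation d) (κ : Pt d → ℝ) (αΓ β : ℝ),
          𝒯.IsQuasiUniform θ → IsDiffusion 𝒯 κmin κmax κ → 0 ≤ αΓ → 0 ≤ β →
          IsBoundaryConst 𝒯 cM → IsInverseConst 𝒯 κ αΩ cinv →
        ∀ (fΩ dfΩ : ℝ → 𝒯.Node → ℝ) (fΓ dfΓ : ℝ → 𝒯.BdNode → ℝ)
          (u du ddu : ℝ → 𝒯.Node → ℝ) (p dp ddp lam : ℝ → 𝒯.BdNode → ℝ),
          HasL2Deriv T fΩ dfΩ → HasL2Deriv T fΓ dfΓ →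
          IsSemidiscreteSolution 𝒯 κ αΩ αΓ β T fΩ fΓ u du p dp lam →
          HasACDeriv T du ddu → HasACDeriv T dp ddp →
        ∀ (τ : ℝ) (u₁ : ℕ → 𝒯.IntNode → ℝ) (pτ q : ℕ → 𝒯.BdNode → ℝ),
          0 < τ →
          7 * cinv * cM * τ < 3 * 𝒯.meshWidth →
          7 * 𝒯.meshWidth < 1 / cM →
          IsLieEuler 𝒯 κ αΩ αΓ β T τ fΩ fΓ u₁ pτ q →
          u₁ 0 = (fun i => u 0 (Sum.inl i)) → pτ 0 = p 0 → q 0 = dp 0 →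
        ∀ n : ℕ, ((n : ℝ) + 1) * τ ≤ T →
          -- estimate (a)
          (normSq 𝒯.bulkMass (u (((n : ℝ) + 1) * τ) - Sum.elim (u₁ (n + 1)) (pτ (n + 1)))
            + τ * ∑ k ∈ Finset.range (n + 1), normSq (𝒯.bulkStiff κ αΩ)
                (u (((k : ℝ) + 1) * τ) - Sum.elim (u₁ (k + 1)) (pτ (k + 1)))
            + normSq 𝒯.surfaceMass (p (((n : ℝ) + 1) * τ) - pτ (n + 1))
            + τ * ∑ k ∈ Finset.range (n + 1), normSq (𝒯.surfaceStiff αΓ β)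
                (p (((k : ℝ) + 1) * τ) - pτ (k + 1))
            ≤ C * dataNormSq 𝒯 κ αΩ αΓ β T du ddu dfΩ dp ddp dfΓ * τ ^ 2) ∧
          -- estimate (b)
          (normSq (𝒯.bulkStiff κ αΩ)
              (u (((n : ℝ) + 1) * τ) - Sum.elim (u₁ (n + 1)) (pτ (n + 1)))
            + normSq (𝒯.surfaceStiff αΓ β) (p (((n : ℝ) + 1) * τ) - pτ (n + 1))
            ≤ C * dataNormSq 𝒯 κ αΩ αΓ β T du ddu dfΩ dp ddp dfΓ * τ) := by
  refine ⟨?_, ?_, ?_⟩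
  · obtain ⟨cM, hcM, h⟩ := exists_boundaryConst hd hϱ
    exact ⟨cM, hcM, fun 𝒯 _ h𝒯 => h 𝒯 h𝒯⟩
  · obtain ⟨cinv, hcinv, h⟩ := exists_inverseConst (by omega : 1 ≤ d) hϱ hκmin hκ
    exact ⟨cinv, hcinv, fun 𝒯 _ h𝒯 κ hd αΩ _ => h 𝒯 h𝒯 κ hd αΩ⟩
  · intro cM cinv αΩ T hcM hcinv hαΩ hT
    refine ⟨18 * splitConst αΩ T, ?_, ?_⟩
    · unfold splitConst splitRate
      positivity
    intro 𝒯 κ αΓ β _ hdiff hαΓ hβ hM hinv fΩ dfΩ fΓ dfΓ u du ddu p dp ddp lam _ _ hsol hdu hdp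
      τ u₁ pτ q hτ hcfl hh hE hu0 hp0 hq0 n hn
    have hd1 : 1 ≤ d := by omega
    have ha := error_le hd1 hdiff hκmin hαΩ hαΓ hβ hcM hcinv hM hinv hsol hdu hdp dfΩ dfΓ hτ hcfl
      hh hE hu0 hp0 hq0 n hn
    refine ⟨ha, ?_⟩
    -- the last summands of the accumulated energy norms already give the second estimate
    have hA := Finset.single_le_sum (f := fun k : ℕ => normSq (𝒯.bulkStiff κ αΩ)
      (u (((k : ℝ) + 1) * τ) - Sum.elim (u₁ (k + 1)) (pτ (k + 1))))
      (fun k _ => hdiff.normSq_bulkStiff_nonneg hκmin hαΩ _) (Finset.self_mem_range_succ n)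
    have hAΓ := Finset.single_le_sum (f := fun k : ℕ => normSq (𝒯.surfaceStiff αΓ β)
      (p (((k : ℝ) + 1) * τ) - pτ (k + 1)))
      (fun k _ => 𝒯.normSq_surfaceStiff_nonneg hd1 hαΓ hβ _) (Finset.self_mem_range_succ n)
    have hm := 𝒯.normSq_bulkMass_nonneg
      (u (((n : ℝ) + 1) * τ) - Sum.elim (u₁ (n + 1)) (pτ (n + 1)))
    have hs := 𝒯.normSq_surfaceMass_nonneg hd1 (p (((n : ℝ) + 1) * τ) - pτ (n + 1))
    have hA' := mul_le_mul_of_nonneg_left hA hτ.le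
    have hAΓ' := mul_le_mul_of_nonneg_left hAΓ hτ.le
    refine le_of_mul_le_mul_left ?_ hτ
    linarith
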